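/- Let $d\ge 1$, let $\mathbb B^d$ be the open unit ball of $\mathbb C^d$, and let $dz$ be Lebesgue measure. Put $d\tau(z)=(1-|z|^2)^{-(d+1)}dz$ on $\mathbb B^d$, $c_\lambda=\Gamma(\lambda)/(\pi^d\,\Gamma(\lambda-d))$ and $d\mu_\lambda=c_\lambda(1-|z|^2)^\lambda d\tau$. Let $N=\sum_j z_j\,\partial/\partial z_j$ and $\bar N=\sum_j\bar z_j\,\partial/\partial\bar z_j$. For $\lambda>0$ and an integer $n\ge1$ let $$C=\Big(I+\tfrac{\bar N}{\lambda+2n-1}\Big)\cdots\Big(I+\tfrac{\bar N}{\lambda+n}\Big)\Big(I+\tfrac{N}{\lambda+n-1}\Big)\cdots\Big(I+\tfrac{N}{\lambda}\Big).$$ Inner products are conjugate-linear in the first variable. Let $\phi:\mathbb B^d\to\mathbb C$ be $2n$ times continuously differentiable (in the real sense), with $\bar N^kN^l\phi$ bounded on $\mathbb B^d$ for all $0\le k,l\le n$. (1) Let $\lambda>d$. Let $\mathcal HL^2(\mathbb B^d,\mu_\lambda)$ be the space of holomorphic functions in $L^2(\mathbb B^d,\mu_\lambda)$, let $P_\lambda$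 be the orthogonal projection of $L^2(\mathbb B^d,\mu_\lambda)$ onto it, and let $T_\phi g=P_\lambda(\phi g)$. Then for all $f,g\in\mathcal HL^2(\mathbb B^d,\mu_\lambda)$ the following integral converges absolutely and $$\langle f,T_\phi g\rangle_{\mathcal HL^2(\mathbb B^d,\mu_\lambda)}=c_{\lambda+2n}\int_{\mathbb B^d}C\big[\,\overline{f}\,\phi\, g\,\big](z)\,(1-|z|^2)^{\lambda+2n}\,d\tau(z).$$ Moreover, there are constants $A_{jklm}$, depending only on $n$ and $\lambda$, such that for all such $\phi,f,g$ $$\langle f,T_\phi g\rangle_{\mathcal HL^2(\mathbb B^d,\mu_\lambda)}=\sum_{j,k,l,m=0}^{n}A_{jklm}\,\big\langle N^jf,(\bar N^kN^l\phi)\,N^mg\big\rangle_{L^2(\mathbb B^d,\mu_{\lambda+2n})},$$ where all the functions $N^jf$ and $(\bar N^kN^l\phi)N^mg$ with $0\le j,k,l,m\le n$ belong to $L^2(\mathbb B^d,\mu_{\lambda+2n})$. (2) Let $0<\lambda\le d$ and $\lambda+2n>d$. For any integer $m\ge0$ with $\lambda+2m>d$, let $H(\mathbb B^d,\lambda)$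 be the space of holomorphic $f$ on $\mathbb B^d$ with $N^kf\in L^2(\mathbb B^d,\mu_{\lambda+2m})$ for $0\le k\le m$, with the inner product $\langle f,g\rangle_\lambda=\langle Af,Bg\rangle_{L^2(\mathbb B^d,\mu_{\lambda+2m})}$, where $A=\prod_{i=0}^{m-1}\big(I+\frac N{\lambda+m+i}\big)$ and $B=\prod_{i=0}^{m-1}\big(I+\frac N{\lambda+i}\big)$, and the norm $\|f\|_\lambda=\langle f,f\rangle_\lambda^{1/2}$. Then for all $f,g\in H(\mathbb B^d,\lambda)$ the integral below converges absolutely, and there is a unique bounded linear operator $T_\phi$ on $H(\mathbb B^d,\lambda)$ such that for all $f,g\in H(\mathbb B^d,\lambda)$ $$\langle f,T_\phi g\rangle_{\lambda}=c_{\lambda+2n}\int_{\mathbb B^d}C\big[\,\overline{f}\,\phi\, g\,\big](z)\,(1-|z|^2)^{\lambda+2n}\,d\tau(z).$$ -/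

import Mathlib

namespace GenBergman

open MeasureTheory Filter Topology
noncomputable section

theorem differentiableAt_of_uniformCauchy {E : Type*} [NormedAddCommGroup E] [NormedSpace ℂ E]
    {f : ℕ → E → ℂ} {g : E → ℂ} {z₀ : E} {r : ℝ} (hr : 0 < r)
    (hf : ∀ n, DifferentiableOn ℂ (f n) (Metric.ball z₀ r))
    (hc : UniformCauchySeqOn f atTop (Metric.ball z₀ r))
    (hg : ∀ z ∈ Metric.ball z₀ r, Tendsto (fun n => f n z) atTop (𝓝 (g z))) :
    DifferentiableAt ℂ g z₀ := by
  have hsub : ∀ z ∈ Metric.ball z₀ (r / 2), Metric.ball z (r / 2) ⊆ Metric.ball z₀ r := by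
    intro z hz
    refine Metric.ball_subset_ball' ?_
    have := Metric.mem_ball.1 hz
    linarith
  have hdz : ∀ n, ∀ z ∈ Metric.ball z₀ (r / 2), DifferentiableAt ℂ (f n) z := fun n z hz =>
    (hf n).differentiableAt
      (Metric.isOpen_ball.mem_nhds (Metric.ball_subset_ball (by linarith) hz))
  have hcd : UniformCauchySeqOn (fun n z => fderiv ℂ (f n) z) atTop (Metric.ball z₀ (r / 2)) := by
    rw [Metric.uniformCauchySeqOn_iff] at hc ⊢
    intro ε hε
    obtain ⟨N, hN⟩ := hc (ε * r / 8) (by positivity)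
    refine ⟨N, fun m hm n hn z hz => ?_⟩
    rw [dist_eq_norm, ← fderiv_sub (hdz m z hz) (hdz n z hz)]
    have h1 : ‖fderiv ℂ (f m - f n) z‖ ≤ (ε * r / 4) / (r / 2) := by
      refine Complex.norm_fderiv_le_div_of_mapsTo_ball
        (((hf m).sub (hf n)).mono (hsub z hz)) ?_ (by positivity)
      intro w hw
      have hw' := hN m hm n hn w (hsub z hz hw)
      have hz' := hN m hm n hn z (hsub z hz (Metric.mem_ball_self (by positivity)))
      rw [dist_eq_norm] at hw' hz'
      rw [Metric.mem_closedBall, dist_eq_norm]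
      have := norm_sub_le (f m w - f n w) (f m z - f n z)
      simp only [Pi.sub_apply]
      linarith
    have h2 : (ε * r / 4) / (r / 2) = ε / 2 := by field_simp; norm_num
    linarith
  have hlim : ∀ z, ∃ L : E →L[ℂ] ℂ, z ∈ Metric.ball z₀ (r / 2) →
      Tendsto (fun n => fderiv ℂ (f n) z) atTop (𝓝 L) := by
    intro z
    by_cases hz : z ∈ Metric.ball z₀ (r / 2)
    · obtain ⟨L, hL⟩ := cauchySeq_tendsto_of_complete (hcd.cauchySeq hz)
      exact ⟨L, fun _ => hL⟩
    · exact ⟨0, fun h => absurd h hz⟩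
  choose g' hg' using hlim
  have hu : TendstoUniformlyOn (fun n z => fderiv ℂ (f n) z) g' atTop (Metric.ball z₀ (r / 2)) :=
    hcd.tendstoUniformlyOn_of_tendsto fun z hz => hg' z hz
  exact (hasFDerivAt_of_tendstoUniformlyOn Metric.isOpen_ball hu
    (fun n z hz => (hdz n z hz).hasFDerivAt)
    (fun z hz => hg z (Metric.ball_subset_ball (by linarith) hz))
    (Metric.mem_ball_self (by positivity))).differentiableAt

theorem differentiableAt_fderiv_apply {E : Type*} [NormedAddCommGroup E] [NormedSpace ℂ E]
    {f : E → ℂ} {U : Set E} (hU : IsOpen U) (hf : DifferentiableOn ℂ f U) (v : E) {z₀ : E}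
    (hz₀ : z₀ ∈ U) : DifferentiableAt ℂ (fun z => fderiv ℂ f z v) z₀ := by
  have hc : ∀ᶠ z in 𝓝 z₀, z ∈ U ∧ ‖f z‖ < ‖f z₀‖ + 1 := by
    refine (hU.eventually_mem hz₀).and ?_
    exact (hf.differentiableAt (hU.mem_nhds hz₀)).continuousAt.norm.eventually
      (gt_mem_nhds (lt_add_one _))
  obtain ⟨R, hR, hball⟩ := Metric.eventually_nhds_iff_ball.1 hc
  set r := R / 2 with hr_def
  have hr : 0 < r := by positivity
  set M := ‖f z₀‖ + 1 with hM
  have hMpos : 0 < M := by positivity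
  have hdiff : ∀ z ∈ Metric.ball z₀ R, DifferentiableAt ℂ f z := fun z hz =>
    hf.differentiableAt (hU.mem_nhds (hball z hz).1)
  have hsub : ∀ z ∈ Metric.ball z₀ r, Metric.ball z r ⊆ Metric.ball z₀ R := by
    intro z hz
    refine Metric.ball_subset_ball' ?_
    have := Metric.mem_ball.1 hz
    linarith
  -- second order Taylor estimate
  have hT : ∀ z ∈ Metric.ball z₀ r, ∀ w ∈ Metric.ball z r,
      ‖f w - f z - fderiv ℂ f z (w - z)‖ ≤ 4 * M * (dist w z / r) ^ 2 := by
    intro z hz w hw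
    have hzR : z ∈ Metric.ball z₀ R := Metric.ball_subset_ball (by linarith) hz
    have hfd : ‖fderiv ℂ f z‖ ≤ (2 * M) / r := by
      refine Complex.norm_fderiv_le_div_of_mapsTo_ball (R₁ := r)
        (fun x hx => (hdiff x (hsub z hz hx)).differentiableWithinAt) ?_ hr
      intro x hx
      rw [Metric.mem_closedBall, dist_eq_norm]
      have := norm_sub_le (f x) (f z)
      have h1 := (hball x (hsub z hz hx)).2
      have h2 := (hball z hzR).2
      linarith
    have key := Complex.dist_le_mul_div_pow_of_mapsTo_ball_of_isLittleO (n := 1)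
      (f := fun x => f x - f z - fderiv ℂ f z (x - z)) (c := z) (R₁ := r) (R₂ := 4 * M) (z := w)
      ?_ ?_ ?_ hw
    · simpa [dist_eq_norm] using key
    · intro x hx
      have := hdiff x (hsub z hz hx)
      exact DifferentiableAt.differentiableWithinAt (by fun_prop)
    · intro x hx
      rw [Metric.mem_closedBall, dist_eq_norm]
      have h1 := (hball x (hsub z hz hx)).2
      have h2 := (hball z hzR).2
      have h3 : ‖fderiv ℂ f z (x - z)‖ ≤ 2 * M := by
        refine (ContinuousLinearMap.le_opNorm _ _).trans ?_
        have hx' : ‖x - z‖ ≤ r := by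
          rw [← dist_eq_norm]; exact (Metric.mem_ball.1 hx).le
        calc ‖fderiv ℂ f z‖ * ‖x - z‖ ≤ (2 * M) / r * r := by gcongr
          _ = 2 * M := by field_simp
      have h4 := norm_sub_le (f x - f z) (fderiv ℂ f z (x - z))
      have h5 := norm_sub_le (f x) (f z)
      simp only [sub_self, map_zero, sub_zero]
      linarith
    · have := (hdiff z hzR).hasFDerivAt.isLittleO
      simpa using this.norm_right
  -- difference quotients
  set t : ℕ → ℝ := fun n => r / ((‖v‖ + 1) * (n + 2)) with ht
  have htpos : ∀ n, 0 < t n := fun n => by positivity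
  have htv : ∀ n, t n * ‖v‖ < r := by
    intro n
    have h1 : t n * (‖v‖ + 1) ≤ r / 2 := by
      have : t n * (‖v‖ + 1) = r / (n + 2) := by simp only [ht]; field_simp
      rw [this]
      gcongr
      linarith [Nat.cast_nonneg (α := ℝ) n]
    nlinarith [htpos n]
  have htlim : Tendsto t atTop (𝓝 0) := by
    have h1 : Tendsto (fun n : ℕ => (n : ℝ) + 2) atTop atTop :=
      tendsto_atTop_add_const_right _ _ tendsto_natCast_atTop_atTop
    exact Tendsto.div_atTop tendsto_const_nhds (h1.const_mul_atTop (by positivity))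
  have hmem : ∀ n, ∀ z : E, z + ((t n : ℝ) : ℂ) • v ∈ Metric.ball z r := by
    intro n z
    rw [Metric.mem_ball, dist_eq_norm, add_sub_cancel_left, norm_smul, Complex.norm_real,
      Real.norm_of_nonneg (htpos n).le]
    exact htv n
  have hest : ∀ n, ∀ z ∈ Metric.ball z₀ r,
      ‖fderiv ℂ f z v - ((t n : ℝ) : ℂ)⁻¹ * (f (z + ((t n : ℝ) : ℂ) • v) - f z)‖
        ≤ t n * (4 * M * (‖v‖ / r) ^ 2) := by
    intro n z hz
    have h := hT z hz _ (hmem n z)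
    rw [dist_eq_norm, add_sub_cancel_left, norm_smul, Complex.norm_real,
      Real.norm_of_nonneg (htpos n).le, map_smul, smul_eq_mul] at h
    have htn : ((t n : ℝ) : ℂ) ≠ 0 := by exact_mod_cast (htpos n).ne'
    have e : fderiv ℂ f z v - ((t n : ℝ) : ℂ)⁻¹ * (f (z + ((t n : ℝ) : ℂ) • v) - f z)
        = -(((t n : ℝ) : ℂ)⁻¹ * (f (z + ((t n : ℝ) : ℂ) • v) - f z
            - ((t n : ℝ) : ℂ) * fderiv ℂ f z v)) := by
      field_simp
      ring
    rw [e, norm_neg, norm_mul, norm_inv, Complex.norm_real, Real.norm_of_nonneg (htpos n).le]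
    calc (t n)⁻¹ * _ ≤ (t n)⁻¹ * (4 * M * (t n * ‖v‖ / r) ^ 2) := by gcongr
      _ = t n * (4 * M * (‖v‖ / r) ^ 2) := by
        have := (htpos n).ne'
        field_simp
  have hunif : TendstoUniformlyOn
      (fun n z => ((t n : ℝ) : ℂ)⁻¹ * (f (z + ((t n : ℝ) : ℂ) • v) - f z))
      (fun z => fderiv ℂ f z v) atTop (Metric.ball z₀ r) := by
    rw [Metric.tendstoUniformlyOn_iff]
    intro ε hε
    have h0 : Tendsto (fun n => t n * (4 * M * (‖v‖ / r) ^ 2)) atTop (𝓝 0) := by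
      simpa using htlim.mul_const (4 * M * (‖v‖ / r) ^ 2)
    filter_upwards [h0.eventually (gt_mem_nhds hε)] with n hn z hz
    rw [dist_eq_norm]
    exact (hest n z hz).trans_lt hn
  refine differentiableAt_of_uniformCauchy hr ?_ hunif.uniformCauchySeqOn
    (fun z hz => hunif.tendsto_at hz)
  intro n z hz
  have h1 := hdiff z (Metric.ball_subset_ball (by linarith) hz)
  have h2 := hdiff _ (hsub z hz (hmem n z))
  have h3 : DifferentiableAt ℂ (fun z => f (z + ((t n : ℝ) : ℂ) • v)) z :=
    DifferentiableAt.comp (g := f) z h2 (by fun_prop)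
  exact ((h3.sub h1).const_mul _).differentiableWithinAt

theorem enorm_mul_volume_ball_le {d : ℕ} {f : EuclideanSpace ℂ (Fin d) → ℂ}
    (hf : DifferentiableOn ℂ f (Metric.ball 0 1)) {z : EuclideanSpace ℂ (Fin d)} {r : ℝ}
    (hzr : Metric.ball z r ⊆ Metric.ball 0 1) :
    ‖f z‖ₑ * volume (Metric.ball (0 : EuclideanSpace ℂ (Fin d)) r) ≤
      ∫⁻ w in Metric.ball z r, ‖f w‖ₑ := by
  classical
  set F : EuclideanSpace ℂ (Fin d) → ENNReal :=
    fun w => ‖(Metric.ball (0 : EuclideanSpace ℂ (Fin d)) 1).piecewise f 0 w‖ₑ with hF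
  have hFm : Measurable F :=
    (hf.continuousOn.measurable_piecewise continuousOn_const measurableSet_ball).enorm
  have hFf : ∀ w ∈ Metric.ball z r, F w = ‖f w‖ₑ := fun w hw => by
    simp only [hF, Set.piecewise_eq_of_mem _ _ _ (hzr hw)]
  have hnorm : ∀ θ : ℝ, ‖circleMap 0 1 θ‖ = 1 := fun θ => by simp
  -- circle mean value inequality
  have h1 : ∀ w ∈ Metric.ball (0 : EuclideanSpace ℂ (Fin d)) r,
      ENNReal.ofReal (2 * Real.pi) * ‖f z‖ₑ ≤
        ∫⁻ θ in Set.Ioc 0 (2 * Real.pi), F (z + circleMap 0 1 θ • w) := by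
    intro w hw
    rw [mem_ball_zero_iff] at hw
    have hmem : ∀ ζ : ℂ, ‖ζ‖ ≤ 1 → z + ζ • w ∈ Metric.ball z r := by
      intro ζ hζ
      rw [Metric.mem_ball, dist_eq_norm, add_sub_cancel_left, norm_smul]
      nlinarith [norm_nonneg w]
    have hd : DifferentiableOn ℂ (fun ζ : ℂ => f (z + ζ • w)) (Metric.closedBall 0 |1|) := by
      refine hf.comp (f := fun ζ : ℂ => z + ζ • w) (by fun_prop) ?_
      intro ζ hζ
      exact hzr (hmem ζ (by simpa using hζ))
    have hmv : Real.circleAverage (fun ζ : ℂ => f (z + ζ • w)) 0 1 = f z := by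
      rw [DiffContOnCl.circleAverage (hd.diffContOnCl_ball subset_rfl)]
      simp
    rw [Real.circleAverage, intervalIntegral.integral_of_le (by positivity)] at hmv
    have hmv' : ∫ θ in Set.Ioc 0 (2 * Real.pi), f (z + circleMap 0 1 θ • w)
        = (2 * Real.pi : ℝ) • f z := by
      rw [← hmv, smul_smul, mul_inv_cancel₀ (by positivity), one_smul]
    calc ENNReal.ofReal (2 * Real.pi) * ‖f z‖ₑ
        = ‖∫ θ in Set.Ioc 0 (2 * Real.pi), f (z + circleMap 0 1 θ • w)‖ₑ := by
          rw [hmv', enorm_smul, Real.enorm_of_nonneg (by positivity)]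
      _ ≤ ∫⁻ θ in Set.Ioc 0 (2 * Real.pi), ‖f (z + circleMap 0 1 θ • w)‖ₑ :=
          enorm_integral_le_lintegral_enorm _
      _ = _ := by
          refine lintegral_congr fun θ => ?_
          rw [hFf _ (hmem _ (hnorm θ).le)]
  -- rotation invariance
  have h2 : ∀ θ : ℝ, ∫⁻ w in Metric.ball (0 : EuclideanSpace ℂ (Fin d)) r,
      F (z + circleMap 0 1 θ • w) = ∫⁻ w in Metric.ball z r, ‖f w‖ₑ := by
    intro θ
    have hne : circleMap 0 1 θ ≠ 0 := by
      intro h; have := hnorm θ; rw [h] at this; simp at this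
    let L : EuclideanSpace ℂ (Fin d) ≃ₗᵢ[ℝ] EuclideanSpace ℂ (Fin d) :=
      { (LinearEquiv.smulOfNeZero ℂ (EuclideanSpace ℂ (Fin d)) _ hne).restrictScalars ℝ with
        norm_map' := fun w => by
          change ‖circleMap 0 1 θ • w‖ = ‖w‖
          rw [norm_smul, hnorm, one_mul] }
    have hL : ∀ w, L w = circleMap 0 1 θ • w := fun w => rfl
    have hmp : MeasurePreserving (fun w => z + L w) volume volume :=
      (measurePreserving_add_left volume z).comp L.measurePreserving
    have hpre : (fun w => z + L w) ⁻¹' (Metric.ball z r) = Metric.ball 0 r := by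
      ext w
      simp [dist_eq_norm]
    have hkey := hmp.setLIntegral_comp_preimage (s := Metric.ball z r) measurableSet_ball hFm
    rw [hpre] at hkey
    simp only [hL] at hkey
    rw [hkey]
    exact setLIntegral_congr_fun measurableSet_ball hFf
  -- Fubini
  have hpi : ENNReal.ofReal (2 * Real.pi) ≠ 0 := by
    simp only [ne_eq, ENNReal.ofReal_eq_zero, not_le]; positivity
  have h3 : ENNReal.ofReal (2 * Real.pi) *
      (‖f z‖ₑ * volume (Metric.ball (0 : EuclideanSpace ℂ (Fin d)) r)) ≤
      ENNReal.ofReal (2 * Real.pi) * ∫⁻ w in Metric.ball z r, ‖f w‖ₑ := by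
    calc _ = ∫⁻ w in Metric.ball (0 : EuclideanSpace ℂ (Fin d)) r,
            ENNReal.ofReal (2 * Real.pi) * ‖f z‖ₑ := by
          rw [setLIntegral_const, mul_assoc]
      _ ≤ ∫⁻ w in Metric.ball (0 : EuclideanSpace ℂ (Fin d)) r,
            ∫⁻ θ in Set.Ioc 0 (2 * Real.pi), F (z + circleMap 0 1 θ • w) :=
          setLIntegral_mono' measurableSet_ball h1
      _ = ∫⁻ θ in Set.Ioc 0 (2 * Real.pi),
            ∫⁻ w in Metric.ball (0 : EuclideanSpace ℂ (Fin d)) r,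
              F (z + circleMap 0 1 θ • w) := by
          refine lintegral_lintegral_swap (Measurable.aemeasurable ?_)
          have hcont : Continuous (fun p : EuclideanSpace ℂ (Fin d) × ℝ =>
              z + circleMap 0 1 p.2 • p.1) :=
            (((continuous_circleMap 0 1).comp continuous_snd).smul continuous_fst).const_add z
          exact hFm.comp hcont.measurable
      _ = _ := by
          simp only [h2]
          rw [setLIntegral_const, Real.volume_Ioc, sub_zero, mul_comm]
  exact (ENNReal.mul_le_mul_iff_right hpi ENNReal.ofReal_ne_top).1 h3


/-- Complex Euclidean space `ℂ^d`. -/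
abbrev CSpace (d : ℕ) : Type := EuclideanSpace ℂ (Fin d)

/-- The open unit ball of `ℂ^d`. -/
abbrev unitBall (d : ℕ) : Set (CSpace d) := Metric.ball 0 1

/-- The constant `c_λ = Γ(λ) / (π^d Γ(λ - d))`. -/
def normConst (d : ℕ) (lam : ℝ) : ℝ :=
  Real.Gamma lam / (Real.pi ^ d * Real.Gamma (lam - d))

/-- Hyperbolic volume `dτ(z) = (1 - |z|²)^{-(d+1)} dz` on the ball, as a measure on `ℂ^d`
carried by the ball. -/
def tau (d : ℕ) : Measure (CSpace d) :=
  (volume.restrict (unitBall d)).withDensity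
    fun z => ENNReal.ofReal ((1 - ‖z‖ ^ 2) ^ (-((d : ℝ) + 1)))

/-- The measure `dμ_λ(z) = c_λ (1 - |z|²)^λ dτ(z)`. -/
def mu (d : ℕ) (lam : ℝ) : Measure (CSpace d) :=
  (tau d).withDensity fun z => ENNReal.ofReal (normConst d lam * (1 - ‖z‖ ^ 2) ^ lam)

/-- The holomorphic subspace of `L²(μ_λ)`: the classes with a representative holomorphic on
the ball. For `λ > d` this is the weighted Bergman space. -/
def bergman (d : ℕ) (lam : ℝ) : Submodule ℂ (Lp ℂ 2 (mu d lam)) where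
  carrier := {u | ∃ f : CSpace d → ℂ, DifferentiableOn ℂ f (unitBall d) ∧ u =ᵐ[mu d lam] f}
  add_mem' := by
    rintro u v ⟨f, hf, huf⟩ ⟨g, hg, hvg⟩
    refine ⟨f + g, hf.add hg, ?_⟩
    filter_upwards [Lp.coeFn_add u v, huf, hvg] with z h1 h2 h3
    rw [h1, Pi.add_apply, h2, h3, Pi.add_apply]
  zero_mem' := ⟨0, differentiableOn_const 0, Lp.coeFn_zero _ _ _⟩
  smul_mem' := by
    rintro c u ⟨f, hf, huf⟩
    refine ⟨c • f, hf.const_smul c, ?_⟩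
    filter_upwards [Lp.coeFn_smul c u, huf] with z h1 h2
    rw [h1, Pi.smul_apply, h2, Pi.smul_apply]

theorem density_pos {d : ℕ} {z : CSpace d} (hz : z ∈ unitBall d) : 0 < 1 - ‖z‖ ^ 2 := by
  rw [mem_ball_zero_iff] at hz
  nlinarith [norm_nonneg z]

theorem measurable_tauDensity (d : ℕ) :
    Measurable fun z : CSpace d => ENNReal.ofReal ((1 - ‖z‖ ^ 2) ^ (-((d : ℝ) + 1))) := by
  fun_prop

theorem measurable_muDensity (d : ℕ) (lam : ℝ) :
    Measurable fun z : CSpace d =>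
      ENNReal.ofReal (normConst d lam * (1 - ‖z‖ ^ 2) ^ lam) := by
  fun_prop

theorem ae_mem_unitBall (d : ℕ) (lam : ℝ) : ∀ᵐ z ∂(mu d lam), z ∈ unitBall d := by
  refine (withDensity_absolutelyContinuous _ _).ae_le ?_
  refine (withDensity_absolutelyContinuous _ _).ae_le ?_
  exact ae_restrict_mem measurableSet_ball

/-- On compact subsets of the ball Lebesgue measure is dominated by `μ_λ`. -/
theorem restrict_le_mu {d : ℕ} {lam : ℝ} (hc : 0 < normConst d lam) {K : Set (CSpace d)}
    (hK : IsCompact K) (hKb : K ⊆ unitBall d) :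
    ∃ C : ENNReal, C ≠ ⊤ ∧ volume.restrict K ≤ C • mu d lam := by
  have hcont : ContinuousOn (fun z : CSpace d => (1 - ‖z‖ ^ 2) ^ (-((d : ℝ) + 1)) *
      (normConst d lam * (1 - ‖z‖ ^ 2) ^ lam)) K := by
    have h0 : ∀ z ∈ K, (1 - ‖z‖ ^ 2) ≠ 0 := fun z hz => (density_pos (hKb hz)).ne'
    have h1 : ContinuousOn (fun z : CSpace d => 1 - ‖z‖ ^ 2) K := by fun_prop
    exact (h1.rpow_const fun z hz => Or.inl (h0 z hz)).mul
      (continuousOn_const.mul (h1.rpow_const fun z hz => Or.inl (h0 z hz)))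
  have hpos : ∀ z ∈ K, 0 < (1 - ‖z‖ ^ 2) ^ (-((d : ℝ) + 1)) *
      (normConst d lam * (1 - ‖z‖ ^ 2) ^ lam) := fun z hz => by
    have := density_pos (hKb hz)
    positivity
  obtain ⟨m, hm, hmK⟩ : ∃ m : ℝ, 0 < m ∧ ∀ z ∈ K, m ≤ (1 - ‖z‖ ^ 2) ^ (-((d : ℝ) + 1)) *
      (normConst d lam * (1 - ‖z‖ ^ 2) ^ lam) := by
    rcases K.eq_empty_or_nonempty with rfl | hne
    · exact ⟨1, one_pos, by simp⟩
    · obtain ⟨x, hx, hmin⟩ := hK.exists_isMinOn hne hcont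
      exact ⟨_, hpos x hx, fun z hz => hmin hz⟩
  refine ⟨(ENNReal.ofReal m)⁻¹, by simpa using hm, ?_⟩
  refine Measure.le_iff.2 fun s hs => ?_
  have hm0 : ENNReal.ofReal m ≠ 0 := by simpa using hm
  rw [Measure.smul_apply, smul_eq_mul, ← ENNReal.mul_le_iff_le_inv hm0 ENNReal.ofReal_ne_top,
    Measure.restrict_apply hs, mu, tau, ← withDensity_mul _ (measurable_tauDensity d)
    (measurable_muDensity d lam), withDensity_apply _ hs, Measure.restrict_restrict hs]
  calc ENNReal.ofReal m * volume (s ∩ K) = ∫⁻ _ in s ∩ K, ENNReal.ofReal m := by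
        rw [setLIntegral_const]
    _ ≤ ∫⁻ z in s ∩ K, ENNReal.ofReal ((1 - ‖z‖ ^ 2) ^ (-((d : ℝ) + 1))) *
          ENNReal.ofReal (normConst d lam * (1 - ‖z‖ ^ 2) ^ lam) := by
        refine setLIntegral_mono' (hs.inter hK.measurableSet) fun z hz => ?_
        have := density_pos (hKb hz.2)
        rw [← ENNReal.ofReal_mul (by positivity)]
        exact ENNReal.ofReal_le_ofReal (hmK z hz.2)
    _ ≤ _ := lintegral_mono_set (Set.inter_subset_inter_right _ hKb)

/-- Locally uniform bound of holomorphic functions by their `L²(μ_λ)` norm. -/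
theorem exists_pointwise_bound {d : ℕ} {lam : ℝ} (hc : 0 < normConst d lam) {z₀ : CSpace d}
    (hz₀ : z₀ ∈ unitBall d) :
    ∃ r > 0, ∃ C : ℝ, 0 ≤ C ∧ Metric.ball z₀ r ⊆ unitBall d ∧
      ∀ (f : CSpace d → ℂ) (u : Lp ℂ 2 (mu d lam)), DifferentiableOn ℂ f (unitBall d) →
        u =ᵐ[mu d lam] f → ∀ z ∈ Metric.ball z₀ r, ‖f z‖ ≤ C * ‖u‖ := by
  obtain ⟨R, hR, hRb⟩ := Metric.isOpen_iff.1 (Metric.isOpen_ball (x := (0 : CSpace d)) (ε := 1))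
    z₀ hz₀
  set r := R / 4 with hr_def
  have hr : 0 < r := by positivity
  have hKb : Metric.closedBall z₀ (2 * r) ⊆ unitBall d :=
    (Metric.closedBall_subset_ball (by linarith)).trans hRb
  obtain ⟨C₁, hC₁, hle⟩ := restrict_le_mu hc (isCompact_closedBall z₀ (2 * r)) hKb
  set V := volume (Metric.ball (0 : CSpace d) r) with hV
  have hV0 : V ≠ 0 := (Metric.measure_ball_pos volume _ hr).ne'
  have hVt : V ≠ ⊤ := measure_ball_lt_top.ne
  set D : ENNReal := V⁻¹ * (C₁ ^ (1 / 2 : ℝ) *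
    (volume (Metric.closedBall z₀ (2 * r))) ^ (1 / 2 : ℝ)) with hD
  have hDt : D ≠ ⊤ := by
    refine ENNReal.mul_ne_top (ENNReal.inv_ne_top.2 hV0) (ENNReal.mul_ne_top ?_ ?_)
    · exact ENNReal.rpow_ne_top_of_nonneg (by norm_num) hC₁
    · exact ENNReal.rpow_ne_top_of_nonneg (by norm_num) measure_closedBall_lt_top.ne
  refine ⟨r, hr, D.toReal, ENNReal.toReal_nonneg,
    (Metric.ball_subset_closedBall.trans (Metric.closedBall_subset_closedBall (by linarith))).trans
      hKb, ?_⟩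
  intro f u hf huf z hz
  have hzK : Metric.ball z r ⊆ Metric.closedBall z₀ (2 * r) := by
    refine Metric.ball_subset_closedBall.trans (Metric.closedBall_subset_closedBall' ?_)
    have := Metric.mem_ball.1 hz
    linarith
  have hfm : AEStronglyMeasurable f (volume.restrict (Metric.closedBall z₀ (2 * r))) :=
    (hf.continuousOn.mono hKb).aestronglyMeasurable Metric.isClosed_closedBall.measurableSet
  have h1 := enorm_mul_volume_ball_le hf (hzK.trans hKb)
  have h2 : ∫⁻ w in Metric.ball z r, ‖f w‖ₑ ≤
      eLpNorm f 1 (volume.restrict (Metric.closedBall z₀ (2 * r))) := by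
    rw [eLpNorm_one_eq_lintegral_enorm]
    exact lintegral_mono_set hzK
  have h3 := eLpNorm_le_eLpNorm_mul_rpow_measure_univ (p := 1) (q := 2) (by norm_num) hfm
  have h4 : eLpNorm f 2 (volume.restrict (Metric.closedBall z₀ (2 * r))) ≤
      C₁ ^ (1 / 2 : ℝ) * eLpNorm f 2 (mu d lam) := by
    refine (eLpNorm_mono_measure f hle).trans ?_
    rw [eLpNorm_smul_measure_of_ne_top (by norm_num)]
    simp
  have h5 : eLpNorm f 2 (mu d lam) = ‖u‖ₑ := by
    rw [← eLpNorm_congr_ae huf, Lp.enorm_def]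
  have h6 : ‖f z‖ₑ ≤ D * ‖u‖ₑ := by
    rw [h5] at h4
    have h7 : ‖f z‖ₑ * V ≤ C₁ ^ (1 / 2 : ℝ) * ‖u‖ₑ *
        (volume (Metric.closedBall z₀ (2 * r))) ^ (1 / 2 : ℝ) := by
      refine (h1.trans (h2.trans h3)).trans ?_
      rw [Measure.restrict_apply_univ]
      have he : (1 / (1 : ENNReal).toReal - 1 / (2 : ENNReal).toReal) = (1 / 2 : ℝ) := by
        norm_num
      rw [he]
      gcongr
    calc ‖f z‖ₑ = V⁻¹ * (‖f z‖ₑ * V) := by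
          rw [mul_comm ‖f z‖ₑ, ← mul_assoc, ENNReal.inv_mul_cancel hV0 hVt, one_mul]
      _ ≤ V⁻¹ * (C₁ ^ (1 / 2 : ℝ) * ‖u‖ₑ *
          (volume (Metric.closedBall z₀ (2 * r))) ^ (1 / 2 : ℝ)) := by gcongr
      _ = D * ‖u‖ₑ := by rw [hD]; ring
  have h8 := ENNReal.toReal_mono (ENNReal.mul_ne_top hDt enorm_ne_top) h6
  simpa [ENNReal.toReal_mul] using h8

theorem isClosed_bergman (d : ℕ) (lam : ℝ) :
    IsClosed (bergman d lam : Set (Lp ℂ 2 (mu d lam))) := by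
  rcases le_or_gt (normConst d lam) 0 with hc | hc
  · have h0 : mu d lam = 0 := by
      rw [mu, ← withDensity_zero (μ := tau d)]
      refine withDensity_congr_ae ?_
      have hb : ∀ᵐ z ∂(tau d), z ∈ unitBall d :=
        (withDensity_absolutelyContinuous _ _).ae_le (ae_restrict_mem measurableSet_ball)
      filter_upwards [hb] with z hz
      simp only [Pi.zero_apply, ENNReal.ofReal_eq_zero]
      have := density_pos hz
      exact mul_nonpos_of_nonpos_of_nonneg hc (by positivity)
    have : (bergman d lam : Set (Lp ℂ 2 (mu d lam))) = Set.univ := by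
      refine Set.eq_univ_of_forall fun u => ⟨0, differentiableOn_const 0, ?_⟩
      have hbot : ae (mu d lam) = ⊥ := by rw [ae_eq_bot]; exact h0
      rw [Filter.EventuallyEq, hbot]
      exact eventually_bot
    rw [this]
    exact isClosed_univ
  refine IsSeqClosed.isClosed fun u v hu huv => ?_
  choose f hf huf using hu
  have hcau : ∀ z₀ ∈ unitBall d, ∃ r > 0, Metric.ball z₀ r ⊆ unitBall d ∧
      UniformCauchySeqOn f atTop (Metric.ball z₀ r) := by
    intro z₀ hz₀
    obtain ⟨r, hr, C, hC, hrb, hbd⟩ := exists_pointwise_bound (lam := lam) hc hz₀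
    refine ⟨r, hr, hrb, ?_⟩
    rw [Metric.uniformCauchySeqOn_iff]
    intro ε hε
    obtain ⟨N, hN⟩ := Metric.cauchySeq_iff.1 huv.cauchySeq (ε / (C + 1)) (by positivity)
    refine ⟨N, fun m hm n hn z hz => ?_⟩
    have h1 := hbd (f m - f n) (u m - u n) ((hf m).sub (hf n)) (by
      filter_upwards [Lp.coeFn_sub (u m) (u n), huf m, huf n] with z h1 h2 h3
      rw [h1, Pi.sub_apply, h2, h3, Pi.sub_apply]) z hz
    have h2 := hN m hm n hn
    rw [dist_eq_norm] at h2 ⊢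
    have h3 : (C + 1) * ‖u m - u n‖ < ε := by
      rwa [lt_div_iff₀' (by positivity)] at h2
    have h4 : ‖f m z - f n z‖ ≤ C * ‖u m - u n‖ := h1
    nlinarith [norm_nonneg (u m - u n)]
  have hlim : ∀ z, ∃ a : ℂ, z ∈ unitBall d → Tendsto (fun n => f n z) atTop (𝓝 a) := by
    intro z
    by_cases hz : z ∈ unitBall d
    · obtain ⟨r, hr, _, hu⟩ := hcau z hz
      obtain ⟨a, ha⟩ := cauchySeq_tendsto_of_complete (hu.cauchySeq (Metric.mem_ball_self hr))
      exact ⟨a, fun _ => ha⟩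
    · exact ⟨0, fun h => absurd h hz⟩
  choose g hg using hlim
  refine ⟨g, fun z hz => ?_, ?_⟩
  · obtain ⟨r, hr, hrb, hu⟩ := hcau z hz
    exact (differentiableAt_of_uniformCauchy hr (fun n => (hf n).mono hrb) hu
      fun w hw => hg w (hrb hw)).differentiableWithinAt
  · obtain ⟨ns, hns, hae⟩ := (tendstoInMeasure_of_tendsto_Lp huv).exists_seq_tendsto_ae
    filter_upwards [hae, ae_all_iff.2 huf, ae_mem_unitBall d lam] with z h1 h2 h3
    refine tendsto_nhds_unique h1 ?_
    simp only [h2]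
    exact (hg z h3).comp hns.tendsto_atTop

instance (d : ℕ) (lam : ℝ) : CompleteSpace (bergman d lam) :=
  (isClosed_bergman d lam).completeSpace_coe

/-- The Toeplitz operator `T_φ u = P_λ(φ u)`, where `P_λ` is the orthogonal projection of
`L²(μ_λ)` onto the holomorphic subspace. -/
def toeplitz (d : ℕ) (lam : ℝ) (φ : Lp ℂ ⊤ (mu d lam)) : bergman d lam →L[ℂ] bergman d lam :=
  (bergman d lam).orthogonalProjectionOnto ∘L
    ((ContinuousLinearMap.mul ℂ ℂ).holderL (mu d lam) ⊤ 2 2 φ) ∘L (bergman d lam).subtypeL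

/-- The Wirtinger derivative `∂f/∂z_j = ½(∂f/∂x_j - i ∂f/∂y_j)`. -/
def dZ {d : ℕ} (j : Fin d) (f : CSpace d → ℂ) (z : CSpace d) : ℂ :=
  (1 / 2) * (fderiv ℝ f z (EuclideanSpace.single j 1)
    - Complex.I * fderiv ℝ f z (EuclideanSpace.single j Complex.I))

/-- The Wirtinger derivative `∂f/∂z̄_j = ½(∂f/∂x_j + i ∂f/∂y_j)`. -/
def dZbar {d : ℕ} (j : Fin d) (f : CSpace d → ℂ) (z : CSpace d) : ℂ :=
  (1 / 2) * (fderiv ℝ f z (EuclideanSpace.single j 1)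
    + Complex.I * fderiv ℝ f z (EuclideanSpace.single j Complex.I))

/-- The number operator `N = ∑ z_j ∂/∂z_j`. -/
def numOp {d : ℕ} (f : CSpace d → ℂ) : CSpace d → ℂ :=
  fun z => ∑ j, z j * dZ j f z

/-- The operator `N̄ = ∑ z̄_j ∂/∂z̄_j`. -/
def numOpBar {d : ℕ} (f : CSpace d → ℂ) : CSpace d → ℂ :=
  fun z => ∑ j, starRingEnd ℂ (z j) * dZbar j f z

/-- The product `(I + D/(a+n-1)) ⋯ (I + D/(a+1)) (I + D/a)` of `n` factors. -/
def shiftProd {d : ℕ} (D : (CSpace d → ℂ) → CSpace d → ℂ) (a : ℝ) :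
    ℕ → (CSpace d → ℂ) → CSpace d → ℂ
  | 0, f => f
  | n + 1, f => fun z => shiftProd D a n f z + D (shiftProd D a n f) z / ((a + n : ℝ) : ℂ)

/-- The operator
`C = (I + N̄/(λ+2n-1)) ⋯ (I + N̄/(λ+n)) (I + N/(λ+n-1)) ⋯ (I + N/λ)`. -/
def opC {d : ℕ} (lam : ℝ) (n : ℕ) (f : CSpace d → ℂ) : CSpace d → ℂ :=
  shiftProd numOpBar (lam + n) n (shiftProd numOp lam n f)

/-- The form `c_{λ+2n} ∫ C[f̄ φ g] (1 - |z|²)^{λ+2n} dτ`. -/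
def toeplitzForm (d : ℕ) (lam : ℝ) (n : ℕ) (φ f g : CSpace d → ℂ) : ℂ :=
  (normConst d (lam + 2 * n) : ℂ) *
    ∫ z, opC lam n (fun w => starRingEnd ℂ (f w) * φ w * g w) z *
      (((1 - ‖z‖ ^ 2) ^ (lam + 2 * n) : ℝ) : ℂ) ∂(tau d)

theorem numOp_congr {d : ℕ} {f g : CSpace d → ℂ} (h : Set.EqOn f g (unitBall d)) :
    Set.EqOn (numOp f) (numOp g) (unitBall d) := by
  intro z hz
  have : f =ᶠ[𝓝 z] g := h.eventuallyEq_of_mem (Metric.isOpen_ball.mem_nhds hz)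
  simp only [numOp, dZ, this.fderiv_eq]

theorem numOp_iterate_congr {d : ℕ} {f g : CSpace d → ℂ} (h : Set.EqOn f g (unitBall d)) (k : ℕ) :
    Set.EqOn (numOp^[k] f) (numOp^[k] g) (unitBall d) := by
  induction k with
  | zero => exact h
  | succ k ih =>
    rw [Function.iterate_succ_apply', Function.iterate_succ_apply']
    exact numOp_congr ih

theorem dZ_eq {d : ℕ} {f : CSpace d → ℂ} {z : CSpace d} (hf : DifferentiableAt ℂ f z)
    (j : Fin d) : dZ j f z = fderiv ℂ f z (EuclideanSpace.single j 1) := by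
  have h1 : (EuclideanSpace.single j Complex.I : CSpace d)
      = Complex.I • EuclideanSpace.single j (1 : ℂ) := by
    ext i
    by_cases hij : i = j <;> simp [hij]
  rw [dZ, hf.fderiv_restrictScalars ℝ, ContinuousLinearMap.coe_restrictScalars', h1, map_smul,
    smul_eq_mul, ← mul_assoc, Complex.I_mul_I]
  ring

theorem differentiableOn_numOp {d : ℕ} {f : CSpace d → ℂ}
    (hf : DifferentiableOn ℂ f (unitBall d)) : DifferentiableOn ℂ (numOp f) (unitBall d) := by
  have h : DifferentiableOn ℂ
      (fun z : CSpace d => ∑ j, z j * fderiv ℂ f z (EuclideanSpace.single j 1)) (unitBall d) := by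
    intro z hz
    refine DifferentiableAt.differentiableWithinAt ?_
    refine DifferentiableAt.fun_sum fun j _ => DifferentiableAt.mul (by fun_prop) ?_
    exact differentiableAt_fderiv_apply Metric.isOpen_ball hf _ hz
  refine h.congr fun z hz => ?_
  simp only [numOp, dZ_eq (hf.differentiableAt (Metric.isOpen_ball.mem_nhds hz))]

theorem differentiableOn_numOp_iterate {d : ℕ} {f : CSpace d → ℂ}
    (hf : DifferentiableOn ℂ f (unitBall d)) (k : ℕ) :
    DifferentiableOn ℂ (numOp^[k] f) (unitBall d) := by
  induction k with
  | zero => exact hf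
  | succ k ih =>
    rw [Function.iterate_succ_apply']
    exact differentiableOn_numOp ih

theorem numOp_iterate_add {d : ℕ} {f g : CSpace d → ℂ} (hf : DifferentiableOn ℂ f (unitBall d))
    (hg : DifferentiableOn ℂ g (unitBall d)) (k : ℕ) :
    Set.EqOn (numOp^[k] (f + g)) (numOp^[k] f + numOp^[k] g) (unitBall d) := by
  induction k with
  | zero => exact fun _ _ => rfl
  | succ k ih =>
    simp only [Function.iterate_succ_apply']
    refine (numOp_congr ih).trans fun z hz => ?_
    have h1 := ((differentiableOn_numOp_iterate hf k).differentiableAt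
      (Metric.isOpen_ball.mem_nhds hz)).restrictScalars ℝ
    have h2 := ((differentiableOn_numOp_iterate hg k).differentiableAt
      (Metric.isOpen_ball.mem_nhds hz)).restrictScalars ℝ
    simp only [numOp, dZ, Pi.add_apply, fderiv_add h1 h2, ← Finset.sum_add_distrib,
      add_apply]
    refine Finset.sum_congr rfl fun j _ => by ring

theorem numOp_iterate_smul {d : ℕ} {f : CSpace d → ℂ} (hf : DifferentiableOn ℂ f (unitBall d))
    (c : ℂ) (k : ℕ) :
    Set.EqOn (numOp^[k] (c • f)) (c • numOp^[k] f) (unitBall d) := by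
  induction k with
  | zero => exact fun _ _ => rfl
  | succ k ih =>
    simp only [Function.iterate_succ_apply']
    refine (numOp_congr ih).trans fun z hz => ?_
    have h1 := ((differentiableOn_numOp_iterate hf k).differentiableAt
      (Metric.isOpen_ball.mem_nhds hz)).restrictScalars ℝ
    simp only [numOp, dZ, Pi.smul_apply, fderiv_const_smul h1 c, smul_eq_mul, Finset.mul_sum,
      smul_apply]
    refine Finset.sum_congr rfl fun j _ => by ring

theorem ae_eq_of_eqOn {d : ℕ} (lam : ℝ) {f g : CSpace d → ℂ} (h : Set.EqOn f g (unitBall d)) :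
    f =ᵐ[mu d lam] g := by
  filter_upwards [ae_mem_unitBall d lam] with z hz using h hz

/-- The space `H(𝔹^d, λ)`, presented with an order `m` such that `λ + 2m > d`: holomorphic
functions `f` on the ball with `N^k f ∈ L²(μ_{λ+2m})` for `0 ≤ k ≤ m`. A function on the ball
is represented by its extension by zero to `ℂ^d`, so that equality of elements is equality of
functions on the ball. -/
def sobolev (d : ℕ) (lam : ℝ) (m : ℕ) : Submodule ℂ (CSpace d → ℂ) where
  carrier := {f | DifferentiableOn ℂ f (unitBall d) ∧ (∀ z ∉ unitBall d, f z = 0) ∧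
    ∀ k ≤ m, MemLp (numOp^[k] f) 2 (mu d (lam + 2 * m))}
  add_mem' := by
    rintro f g ⟨hf, hf0, hfk⟩ ⟨hg, hg0, hgk⟩
    refine ⟨hf.add hg, fun z hz => by simp [hf0 z hz, hg0 z hz], fun k hk => ?_⟩
    exact (memLp_congr_ae (ae_eq_of_eqOn _ (numOp_iterate_add hf hg k))).2
      ((hfk k hk).add (hgk k hk))
  zero_mem' := by
    have h0 : DifferentiableOn ℂ (0 : CSpace d → ℂ) (unitBall d) := differentiableOn_const 0
    refine ⟨h0, fun _ _ => rfl, fun k _ => ?_⟩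
    have h := numOp_iterate_smul h0 0 k
    rw [zero_smul, zero_smul] at h
    exact (memLp_congr_ae (ae_eq_of_eqOn _ h)).2 MemLp.zero
  smul_mem' := by
    rintro c f ⟨hf, hf0, hfk⟩
    refine ⟨hf.const_smul c, fun z hz => by simp [hf0 z hz], fun k hk => ?_⟩
    exact (memLp_congr_ae (ae_eq_of_eqOn _ (numOp_iterate_smul hf c k))).2
      ((hfk k hk).const_smul c)

/-- The inner product `⟨f, g⟩_λ = ⟨A f, B g⟩_{L²(μ_{λ+2m})}` of `H(𝔹^d, λ)`, with
`A = ∏_{i<m} (I + N/(λ+m+i))` and `B = ∏_{i<m} (I + N/(λ+i))`. -/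
def sobInner (d : ℕ) (lam : ℝ) (m : ℕ) (f g : CSpace d → ℂ) : ℂ :=
  ∫ z, starRingEnd ℂ (shiftProd numOp (lam + m) m f z) * shiftProd numOp lam m g z
    ∂(mu d (lam + 2 * m))

/-- The norm `‖f‖_λ = ⟨f, f⟩_λ^{1/2}` of `H(𝔹^d, λ)`. -/
def sobNorm (d : ℕ) (lam : ℝ) (m : ℕ) (f : CSpace d → ℂ) : ℝ :=
  Real.sqrt (sobInner d lam m f f).re

end
end GenBergman

open MeasureTheory GenBergman

/-! Everything rests on one integration by parts. For s > d and ψ of class C¹ one has ∫ ψ dμ_s = ∫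
(ψ + Nψ/s) dμ_{s+1} as soon as both sides are integrable, and likewise with N̄ (`integral_step`).
Indeed N and N̄ are combinations of the derivatives along z and along iz; the first field has real
divergence 2d, the second has divergence 0 and is tangent to the spheres, so the two operators
behave alike against radial weights, and c_s is normalised so that the constants match. Starting
from ⟨f, T_φ g⟩ = ∫ f̄φg dμ_λ, n steps with N followed by n steps with N̄ produce exactly the
operator C at weight λ + 2n (`integral_product_eq`).

Since N kills f̄ and N̄ kills every N^m g, the Leibniz rule writes C[f̄φg] as a combination of terms
conj(N^j f) (N̄^k N^l φ) N^m g with coefficients depending only on n and λ (`mixed_expansion`). It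
remains to know that these terms are integrable.

For this, f is split into its homogeneous parts f_k. On the circle θ ↦ e^{iθ}z these are Fourier
components, so Parseval gives ‖f‖² = ∑ ‖f_k‖² for every weight, and N multiplies f_k by k. The
integration by parts, applied to |f_k|², yields ‖f_k‖²_{μ_s} = (1 + k/s) ‖f_k‖²_{μ_{s+1}}
(`homNormSq_step`): raising the weight by one is worth one power of 1 + k. Hence the energy ∑
(1+k)^{2m} ‖f_k‖²_{μ_{λ+2m}} does not depend on m up to constants (`homEnergy_transfer`). If λ > d,
level m = 0 is the Bergman norm, so N^j f lies in L²(μ_{λ+2n}) for j ≤ n.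

If λ ≤ d, the operators A and B act on f_k by positive factors comparable with (1+k)^m, so ⟨f, f⟩_λ
is comparable with the energy (`sobInner_self`). This makes H(𝔹^d, λ) a Hilbert space
(`sobolev_complete`) on which the expansion bounds the form (`toeplitzForm_sesquilinear`), and Riesz
representation gives T_φ. -/

namespace GenBergman
open MeasureTheory Filter Topology
noncomputable section

variable {d : ℕ}

/-! ### The operators N and N̄ as real first order operators -/

/-- The first order operator `½(∂_z + ε ∂_{iz})`, which is `N` for `ε = -i` and `N̄` for `ε = i`. -/
def eulerOp (ε : ℂ) (f : CSpace d → ℂ) : CSpace d → ℂ :=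
  fun z => (1 / 2) * (fderiv ℝ f z z + ε * fderiv ℝ f z (Complex.I • z))

theorem eq_sum_re_im (z : CSpace d) :
    z = ∑ j, ((z j).re • (EuclideanSpace.single j 1 : CSpace d)
      + (z j).im • (EuclideanSpace.single j Complex.I : CSpace d)) := by
  ext i
  simp only [WithLp.ofLp_sum, Finset.sum_apply, WithLp.ofLp_add, WithLp.ofLp_smul, Pi.add_apply,
    Pi.smul_apply, PiLp.single_apply]
  rw [Finset.sum_eq_single i (fun j _ hj => by simp [hj.symm]) (by simp)]
  simp [Complex.re_add_im]

theorem apply_eq_sum_re_im (L : CSpace d →L[ℝ] ℂ) (z : CSpace d) :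
    L z = ∑ j, (((z j).re : ℂ) * L (EuclideanSpace.single j 1)
      + ((z j).im : ℂ) * L (EuclideanSpace.single j Complex.I)) := by
  conv_lhs => rw [eq_sum_re_im z]
  simp [map_sum]

/-- If z_j = x + iy, then z_j ∂/∂z_j = ½(x∂_x + y∂_y) - (i/2)(x∂_y - y∂_x); summed over j, the
brackets are the derivatives along z and along iz. In this form N and N̄ differ only in ε and can be
treated together. -/
theorem numOp_eq (f : CSpace d → ℂ) : numOp f = eulerOp (-Complex.I) f := by
  funext z
  rw [numOp, eulerOp, apply_eq_sum_re_im _ z, apply_eq_sum_re_im _ (Complex.I • z),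
    Finset.mul_sum, ← Finset.sum_add_distrib, Finset.mul_sum]
  refine Finset.sum_congr rfl fun j _ => ?_
  have h : z j = (z j).re + (z j).im * Complex.I := (Complex.re_add_im _).symm
  simp only [dZ, PiLp.smul_apply, smul_eq_mul, Complex.mul_re, Complex.mul_im, Complex.I_re,
    Complex.I_im, zero_mul, one_mul, zero_sub, zero_add, Complex.ofReal_neg]
  conv_lhs => rw [h]
  linear_combination (-(1 / 2) * ((z j).im : ℂ) *
    fderiv ℝ f z (EuclideanSpace.single j Complex.I)) * Complex.I_mul_I

theorem numOpBar_eq (f : CSpace d → ℂ) : numOpBar f = eulerOp Complex.I f := by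
  funext z
  rw [numOpBar, eulerOp, apply_eq_sum_re_im _ z, apply_eq_sum_re_im _ (Complex.I • z),
    Finset.mul_sum, ← Finset.sum_add_distrib, Finset.mul_sum]
  refine Finset.sum_congr rfl fun j _ => ?_
  have h : starRingEnd ℂ (z j) = (z j).re - (z j).im * Complex.I := by
    apply Complex.ext <;> simp
  simp only [dZbar, PiLp.smul_apply, smul_eq_mul, Complex.mul_re, Complex.mul_im, Complex.I_re,
    Complex.I_im, zero_mul, one_mul, zero_sub, zero_add, Complex.ofReal_neg]
  rw [h]
  linear_combination (-(1 / 2) * ((z j).im : ℂ) *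
    fderiv ℝ f z (EuclideanSpace.single j Complex.I)) * Complex.I_mul_I

theorem numOp_eq' : (numOp : (CSpace d → ℂ) → CSpace d → ℂ) = eulerOp (-Complex.I) :=
  funext numOp_eq

theorem numOpBar_eq' : (numOpBar : (CSpace d → ℂ) → CSpace d → ℂ) = eulerOp Complex.I :=
  funext numOpBar_eq

theorem isOpen_unitBall : IsOpen (unitBall d) := Metric.isOpen_ball

theorem eulerOp_congr {ε : ℂ} {f g : CSpace d → ℂ} (h : Set.EqOn f g (unitBall d)) :
    Set.EqOn (eulerOp ε f) (eulerOp ε g) (unitBall d) := by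
  intro z hz
  have : f =ᶠ[𝓝 z] g := h.eventuallyEq_of_mem (isOpen_unitBall.mem_nhds hz)
  simp only [eulerOp, this.fderiv_eq]

theorem contDiffOn_eulerOp {ε : ℂ} {f : CSpace d → ℂ} {k : ℕ}
    (hf : ContDiffOn ℝ ((k + 1 : ℕ) : WithTop ℕ∞) f (unitBall d)) :
    ContDiffOn ℝ (k : WithTop ℕ∞) (eulerOp ε f) (unitBall d) := by
  have h : ContDiffOn ℝ (k : WithTop ℕ∞) (fderiv ℝ f) (unitBall d) :=
    hf.fderiv_of_isOpen isOpen_unitBall (by norm_cast)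
  have h1 : ContDiffOn ℝ (k : WithTop ℕ∞) (fun z => fderiv ℝ f z z) (unitBall d) :=
    h.clm_apply contDiffOn_id
  have h2 : ContDiffOn ℝ (k : WithTop ℕ∞) (fun z => fderiv ℝ f z (Complex.I • z))
      (unitBall d) := h.clm_apply (contDiff_id.const_smul Complex.I).contDiffOn
  exact contDiffOn_const.mul (h1.add (contDiffOn_const.mul h2))

theorem contDiffOn_eulerOp_iterate {ε : ℂ} {f : CSpace d → ℂ} {k j : ℕ}
    (hf : ContDiffOn ℝ ((k + j : ℕ) : WithTop ℕ∞) f (unitBall d)) :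
    ContDiffOn ℝ (k : WithTop ℕ∞) ((eulerOp ε)^[j] f) (unitBall d) := by
  induction j generalizing k with
  | zero => exact hf
  | succ j ih =>
    rw [Function.iterate_succ_apply']
    refine contDiffOn_eulerOp (ih ?_)
    rwa [add_assoc, add_comm 1 j]

theorem ContDiffOn.differentiableAt_ball {f : CSpace d → ℂ} {k : ℕ}
    (hf : ContDiffOn ℝ ((k + 1 : ℕ) : WithTop ℕ∞) f (unitBall d)) {z : CSpace d}
    (hz : z ∈ unitBall d) : DifferentiableAt ℝ f z :=
  (hf.contDiffAt (isOpen_unitBall.mem_nhds hz)).differentiableAt (by norm_cast)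

theorem eulerOp_const_mul {ε : ℂ} {f : CSpace d → ℂ} {z : CSpace d} (c : ℂ)
    (hf : DifferentiableAt ℝ f z) :
    eulerOp ε (fun w => c * f w) z = c * eulerOp ε f z := by
  simp only [eulerOp, fderiv_const_mul hf, smul_apply, smul_eq_mul]
  ring

theorem eulerOp_sum {ε : ℂ} {ι : Type*} (s : Finset ι) {F : ι → CSpace d → ℂ} {z : CSpace d}
    (hF : ∀ i ∈ s, DifferentiableAt ℝ (F i) z) :
    eulerOp ε (fun w => ∑ i ∈ s, F i w) z = ∑ i ∈ s, eulerOp ε (F i) z := by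
  simp only [eulerOp, fderiv_fun_sum hF, FunLike.coe_sum, Finset.sum_apply,
    Finset.mul_sum, ← Finset.sum_add_distrib]

theorem eulerOp_mul {ε : ℂ} {f g : CSpace d → ℂ} {z : CSpace d} (hf : DifferentiableAt ℝ f z)
    (hg : DifferentiableAt ℝ g z) :
    eulerOp ε (fun w => f w * g w) z = eulerOp ε f z * g z + f z * eulerOp ε g z := by
  simp only [eulerOp, fderiv_fun_mul hf hg, add_apply, smul_apply, smul_eq_mul]
  ring

theorem eulerOp_conj {ε : ℂ} (f : CSpace d → ℂ) (z : CSpace d) :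
    eulerOp ε (fun w => starRingEnd ℂ (f w)) z
      = starRingEnd ℂ (eulerOp (starRingEnd ℂ ε) f z) := by
  have h : fderiv ℝ (fun w => starRingEnd ℂ (f w)) z
      = (Complex.conjCLE : ℂ →L[ℝ] ℂ).comp (fderiv ℝ f z) :=
    Complex.conjCLE.comp_fderiv (f := f) (x := z)
  simp [eulerOp, h, Complex.conj_ofNat]

theorem numOpBar_conj (f : CSpace d → ℂ) :
    eulerOp Complex.I (fun w => starRingEnd ℂ (f w)) = fun z => starRingEnd ℂ (numOp f z) := by
  funext z
  rw [eulerOp_conj, numOp_eq, Complex.conj_I]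

theorem numOpBar_iterate_conj (f : CSpace d → ℂ) (k : ℕ) :
    (eulerOp Complex.I)^[k] (fun w => starRingEnd ℂ (f w))
      = fun z => starRingEnd ℂ (numOp^[k] f z) := by
  induction k with
  | zero => rfl
  | succ k ih =>
    rw [Function.iterate_succ_apply', Function.iterate_succ_apply', ih, numOpBar_conj]

/-- Complex linearity turns the derivative along iz into i times the derivative along z. The
resulting factor is 1 for ε = -i and 0 for ε = i. -/
theorem eulerOp_holo {ε : ℂ} {f : CSpace d → ℂ} {z : CSpace d} (hf : DifferentiableAt ℂ f z) :
    eulerOp ε f z = (1 / 2) * (1 + ε * Complex.I) * fderiv ℂ f z z := by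
  rw [eulerOp, hf.fderiv_restrictScalars ℝ, ContinuousLinearMap.coe_restrictScalars', map_smul,
    smul_eq_mul]
  ring

theorem numOp_holo {f : CSpace d → ℂ} {z : CSpace d} (hf : DifferentiableAt ℂ f z) :
    numOp f z = fderiv ℂ f z z := by
  rw [numOp_eq, eulerOp_holo hf, neg_mul, Complex.I_mul_I]
  ring

theorem numOpBar_holo {f : CSpace d → ℂ} (hf : DifferentiableOn ℂ f (unitBall d)) :
    Set.EqOn (eulerOp Complex.I f) 0 (unitBall d) := by
  intro z hz
  rw [eulerOp_holo (hf.differentiableAt (isOpen_unitBall.mem_nhds hz)), Complex.I_mul_I]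
  simp

theorem numOp_conj_holo {f : CSpace d → ℂ} (hf : DifferentiableOn ℂ f (unitBall d)) :
    Set.EqOn (eulerOp (-Complex.I) fun w => starRingEnd ℂ (f w)) 0 (unitBall d) := by
  intro z hz
  have h := numOpBar_holo hf hz
  rw [eulerOp_conj, map_neg, Complex.conj_I, neg_neg, h]
  simp

/-- Directional derivatives of holomorphic functions are holomorphic, and in finite dimension the
regularity of the derivative can be tested on fixed vectors, so induction on k applies. -/
theorem contDiffOn_holo_complex {f : CSpace d → ℂ} (hf : DifferentiableOn ℂ f (unitBall d))
    (k : ℕ) : ContDiffOn ℂ (k : WithTop ℕ∞) f (unitBall d) := by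
  induction k generalizing f with
  | zero => exact contDiffOn_zero.2 hf.continuousOn
  | succ k ih =>
    rw [Nat.cast_succ]
    refine (contDiffOn_succ_iff_fderiv_of_isOpen isOpen_unitBall).2 ⟨hf, by simp, ?_⟩
    refine contDiffOn_clm_apply.2 fun v => ih fun z hz => ?_
    exact (differentiableAt_fderiv_apply isOpen_unitBall hf v hz).differentiableWithinAt

theorem contDiffOn_holo {f : CSpace d → ℂ} (hf : DifferentiableOn ℂ f (unitBall d)) (k : ℕ) :
    ContDiffOn ℝ (k : WithTop ℕ∞) f (unitBall d) :=
  (contDiffOn_holo_complex hf k).restrict_scalars ℝ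

theorem contDiffOn_conj {f : CSpace d → ℂ} {k : ℕ}
    (hf : ContDiffOn ℝ (k : WithTop ℕ∞) f (unitBall d)) :
    ContDiffOn ℝ (k : WithTop ℕ∞) (fun z => starRingEnd ℂ (f z)) (unitBall d) :=
  Complex.conjCLE.contDiff.comp_contDiffOn hf

/-! ### Leibniz expansion of C[f̄φg] -/

/-- The coefficients of `(I + D/(a+n-1)) ⋯ (I + D/a)` as a polynomial in `D`. -/
def shiftCoef (a : ℝ) : ℕ → ℕ → ℂ
  | 0, 0 => 1
  | 0, _ + 1 => 0
  | n + 1, 0 => shiftCoef a n 0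
  | n + 1, i + 1 => shiftCoef a n (i + 1) + shiftCoef a n i / ((a + n : ℝ) : ℂ)

theorem shiftCoef_eq_zero (a : ℝ) {n i : ℕ} (h : n < i) : shiftCoef a n i = 0 := by
  induction n generalizing i with
  | zero => obtain ⟨i, rfl⟩ := Nat.exists_eq_succ_of_ne_zero h.ne'; rfl
  | succ n ih =>
    obtain ⟨i, rfl⟩ := Nat.exists_eq_succ_of_ne_zero (by omega : i ≠ 0)
    rw [shiftCoef, ih (by omega), ih (by omega)]
    simp

/-- The recursion for `shiftCoef` is multiplication of a polynomial by 1 + X/(a+n). Each of the n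
factors uses up one derivative of F. -/
theorem eulerOp_shift_sum {ε : ℂ} (a : ℝ) {n : ℕ} {F : CSpace d → ℂ}
    (hF : ContDiffOn ℝ (n : WithTop ℕ∞) F (unitBall d)) :
    Set.EqOn (shiftProd (eulerOp ε) a n F)
      (fun z => ∑ i ∈ Finset.range (n + 1), shiftCoef a n i * (eulerOp ε)^[i] F z)
      (unitBall d) := by
  induction n with
  | zero => intro z _; simp [shiftProd, shiftCoef]
  | succ n ih =>
    have hF' := hF.of_le (show ((n : ℕ) : WithTop ℕ∞) ≤ ((n + 1 : ℕ) : WithTop ℕ∞) by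
      norm_cast; omega)
    intro z hz
    have hd : ∀ i ∈ Finset.range (n + 1), DifferentiableAt ℝ ((eulerOp ε)^[i] F) z := by
      intro i hi
      rw [Finset.mem_range] at hi
      refine ContDiffOn.differentiableAt_ball (k := n - i) (contDiffOn_eulerOp_iterate ?_) hz
      rwa [show n - i + 1 + i = n + 1 by omega]
    simp only [shiftProd]
    rw [ih hF' hz, eulerOp_congr (ih hF') hz,
      eulerOp_sum _ fun i hi => (hd i hi).const_mul _]
    rw [Finset.sum_range_succ' _ (n + 1), Finset.sum_congr rfl fun i hi =>
      eulerOp_const_mul _ (hd i hi)]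
    simp only [shiftCoef, add_mul, Finset.sum_add_distrib, Function.iterate_succ_apply']
    rw [Finset.sum_range_succ' (fun i => shiftCoef a n i * (eulerOp ε)^[i] F z) n,
      Finset.sum_range_succ (fun i => shiftCoef a n (i + 1) * eulerOp ε ((eulerOp ε)^[i] F) z) n,
      shiftCoef_eq_zero a (Nat.lt_succ_self n), Finset.sum_div]
    simp only [Function.iterate_succ_apply', div_mul_eq_mul_div]
    ring

theorem shiftProd_congr {ε : ℂ} (a : ℝ) (n : ℕ) {F G : CSpace d → ℂ}
    (h : Set.EqOn F G (unitBall d)) :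
    Set.EqOn (shiftProd (eulerOp ε) a n F) (shiftProd (eulerOp ε) a n G) (unitBall d) := by
  induction n with
  | zero => exact h
  | succ n ih =>
    intro z hz
    simp only [shiftProd, ih hz, eulerOp_congr ih hz]

theorem contDiffOn_shiftProd {ε : ℂ} (a : ℝ) {n k : ℕ} {F : CSpace d → ℂ}
    (hF : ContDiffOn ℝ ((k + n : ℕ) : WithTop ℕ∞) F (unitBall d)) :
    ContDiffOn ℝ (k : WithTop ℕ∞) (shiftProd (eulerOp ε) a n F) (unitBall d) := by
  induction n generalizing k with
  | zero => exact hF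
  | succ n ih =>
    have h1 : ContDiffOn ℝ ((k + 1 : ℕ) : WithTop ℕ∞) (shiftProd (eulerOp ε) a n F)
        (unitBall d) := ih (by rwa [add_assoc, add_comm 1 n])
    exact (h1.of_le (by norm_cast; omega)).add ((contDiffOn_eulerOp h1).div_const _)

theorem eulerOp_iterate_mul {ε : ℂ} {i : ℕ} {p q : CSpace d → ℂ}
    (hp : ContDiffOn ℝ (i : WithTop ℕ∞) p (unitBall d))
    (hq : ContDiffOn ℝ (i : WithTop ℕ∞) q (unitBall d)) :
    Set.EqOn ((eulerOp ε)^[i] fun z => p z * q z)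
      (fun z => ∑ x ∈ Finset.HasAntidiagonal.antidiagonal i, (i.choose x.1 : ℂ) *
        ((eulerOp ε)^[x.1] p z * (eulerOp ε)^[x.2] q z)) (unitBall d) := by
  induction i with
  | zero => intro z _; simp
  | succ i ih =>
    have hle : ((i : ℕ) : WithTop ℕ∞) ≤ ((i + 1 : ℕ) : WithTop ℕ∞) := by norm_cast; omega
    intro z hz
    have hd : ∀ {r : CSpace d → ℂ}, ContDiffOn ℝ ((i + 1 : ℕ) : WithTop ℕ∞) r (unitBall d) →
        ∀ j ≤ i, DifferentiableAt ℝ ((eulerOp ε)^[j] r) z := by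
      intro r hr j hj
      refine ContDiffOn.differentiableAt_ball (k := i - j) (contDiffOn_eulerOp_iterate ?_) hz
      rwa [show i - j + 1 + j = i + 1 by omega]
    have hm : ∀ x ∈ Finset.HasAntidiagonal.antidiagonal i, x.1 ≤ i ∧ x.2 ≤ i := fun x hx => by
      rw [Finset.HasAntidiagonal.mem_antidiagonal] at hx; omega
    have hmul : ∀ x ∈ Finset.HasAntidiagonal.antidiagonal i, DifferentiableAt ℝ
        (fun w => (eulerOp ε)^[x.1] p w * (eulerOp ε)^[x.2] q w) z := fun x hx =>
      (hd hp _ (hm x hx).1).fun_mul (hd hq _ (hm x hx).2)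
    rw [Function.iterate_succ_apply', eulerOp_congr (ih (hp.of_le hle) (hq.of_le hle)) hz,
      eulerOp_sum _ fun x hx => (hmul x hx).const_mul _]
    have h1 := Finset.sum_antidiagonal_choose_succ_mul
      (fun a b => (eulerOp ε)^[a] p z * (eulerOp ε)^[b] q z) i
    simp only
    rw [h1, ← Finset.sum_add_distrib]
    refine Finset.sum_congr rfl fun x hx => ?_
    rw [eulerOp_const_mul _ (hmul x hx),
      eulerOp_mul (hd hp _ (hm x hx).1) (hd hq _ (hm x hx).2), Function.iterate_succ_apply',
      Function.iterate_succ_apply',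
      Nat.choose_symm_of_eq_add (Finset.HasAntidiagonal.mem_antidiagonal.1 hx).symm]
    ring

/-- Coefficients of degree above n vanish, so the triangle of the Leibniz rule can be filled up to a
square, whose indices run independently from 0 to n. -/
theorem sum_antidiagonal_triangle (n : ℕ) (F : ℕ → ℕ → ℂ)
    (h0 : ∀ a b, n < a + b → F a b = 0) :
    ∑ i ∈ Finset.range (n + 1), ∑ x ∈ Finset.HasAntidiagonal.antidiagonal i, F x.1 x.2
      = ∑ a ∈ Finset.range (n + 1), ∑ b ∈ Finset.range (n + 1), F a b := by
  classical
  rw [← Finset.sum_product', ← Finset.sum_filter_of_ne (p := fun x : ℕ × ℕ => x.1 + x.2 ≤ n)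
    (fun x _ hx => by by_contra h; exact hx (h0 _ _ (by omega))),
    ← Finset.sum_fiberwise_of_maps_to (g := fun x : ℕ × ℕ => x.1 + x.2)
      (t := Finset.range (n + 1)) (fun x hx => by simp at hx ⊢; omega)]
  refine Finset.sum_congr rfl fun i hi => Finset.sum_congr ?_ fun _ _ => rfl
  ext x
  simp only [Finset.HasAntidiagonal.mem_antidiagonal, Finset.mem_filter, Finset.mem_product,
    Finset.mem_range] at hi ⊢
  omega

theorem shiftProd_mul {ε : ℂ} (a : ℝ) {n : ℕ} {p q : CSpace d → ℂ}
    (hp : ContDiffOn ℝ (n : WithTop ℕ∞) p (unitBall d))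
    (hq : ContDiffOn ℝ (n : WithTop ℕ∞) q (unitBall d)) :
    Set.EqOn (shiftProd (eulerOp ε) a n fun z => p z * q z)
      (fun z => ∑ l ∈ Finset.range (n + 1), ∑ m ∈ Finset.range (n + 1),
        shiftCoef a n (l + m) * ((l + m).choose l : ℂ) *
          ((eulerOp ε)^[l] p z * (eulerOp ε)^[m] q z)) (unitBall d) := by
  intro z hz
  rw [eulerOp_shift_sum a (hp.mul hq) hz]
  simp only
  rw [← sum_antidiagonal_triangle n (fun l m => shiftCoef a n (l + m) * ((l + m).choose l : ℂ) *
          ((eulerOp ε)^[l] p z * (eulerOp ε)^[m] q z))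
    fun l m h => by rw [shiftCoef_eq_zero a h]; ring]
  refine Finset.sum_congr rfl fun i hi => ?_
  have hle : ((i : ℕ) : WithTop ℕ∞) ≤ ((n : ℕ) : WithTop ℕ∞) := by
    have := Finset.mem_range.1 hi
    norm_cast; omega
  rw [eulerOp_iterate_mul (hp.of_le hle) (hq.of_le hle) hz, Finset.mul_sum]
  refine Finset.sum_congr rfl fun x hx => ?_
  rw [Finset.HasAntidiagonal.mem_antidiagonal.1 hx]
  ring

/-- A factor killed by D is a constant for D and passes through every I + D/(a+n). The sum is needed
because the N-stage leaves a sum of products, each with its own factor N^m g that is constant for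
N̄. -/
theorem shiftProd_sum_mul {ε : ℂ} (a : ℝ) {n : ℕ} {ι : Type*} (s : Finset ι)
    {u q : ι → CSpace d → ℂ} (hu : ∀ i ∈ s, ∀ z ∈ unitBall d, DifferentiableAt ℝ (u i) z)
    (hu0 : ∀ i ∈ s, Set.EqOn (eulerOp ε (u i)) 0 (unitBall d))
    (hq : ∀ i ∈ s, ContDiffOn ℝ (n : WithTop ℕ∞) (q i) (unitBall d)) :
    Set.EqOn (shiftProd (eulerOp ε) a n fun z => ∑ i ∈ s, u i z * q i z)
      (fun z => ∑ i ∈ s, u i z * shiftProd (eulerOp ε) a n (q i) z) (unitBall d) := by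
  induction n with
  | zero => exact fun _ _ => rfl
  | succ n ih =>
    have ih' := ih fun i hi => (hq i hi).of_le (by norm_cast; omega)
    intro z hz
    have hd : ∀ i ∈ s, DifferentiableAt ℝ (shiftProd (eulerOp ε) a n (q i)) z := fun i hi =>
      ContDiffOn.differentiableAt_ball (k := 0)
        (contDiffOn_shiftProd a (by rw [zero_add, add_comm 1 n]; exact hq i hi)) hz
    simp only [shiftProd]
    rw [ih' hz, eulerOp_congr ih' hz, eulerOp_sum _ fun i hi => (hu i hi z hz).fun_mul (hd i hi),
      Finset.sum_div, ← Finset.sum_add_distrib]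
    refine Finset.sum_congr rfl fun i hi => ?_
    rw [eulerOp_mul (hu i hi z hz) (hd i hi), hu0 i hi hz]
    simp only [Pi.zero_apply]
    ring

/-- Coefficients of the expansion of `C[f̄ φ g]`. -/
def mixCoef (a b : ℝ) (s t j k l m : ℕ) : ℂ :=
  shiftCoef b t (j + k) * ((j + k).choose j : ℂ) *
    (shiftCoef a s (l + m) * ((l + m).choose l : ℂ))

theorem numOp_iterate_eq (k : ℕ) (f : CSpace d → ℂ) :
    numOp^[k] f = (eulerOp (-Complex.I))^[k] f := by rw [numOp_eq']

theorem numOpBar_iterate_eq (k : ℕ) (f : CSpace d → ℂ) :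
    numOpBar^[k] f = (eulerOp Complex.I)^[k] f := by rw [numOpBar_eq']

/-- For N the factor f̄ is a constant, for N̄ each N^m g is one; so N differentiates only φ and g,
and afterwards N̄ only f̄ and N^l φ. The numbers s and t of factors are kept free because the
integration by parts passes through all the intermediate products. -/
theorem mixed_expansion (a b : ℝ) {s t : ℕ} {φ f g : CSpace d → ℂ}
    (hφ : ContDiffOn ℝ ((s + t : ℕ) : WithTop ℕ∞) φ (unitBall d))
    (hf : DifferentiableOn ℂ f (unitBall d)) (hg : DifferentiableOn ℂ g (unitBall d)) :
    Set.EqOn (shiftProd numOpBar b t (shiftProd numOp a s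
        fun w => starRingEnd ℂ (f w) * φ w * g w))
      (fun z => ∑ j ∈ Finset.range (t + 1), ∑ k ∈ Finset.range (t + 1),
        ∑ l ∈ Finset.range (s + 1), ∑ m ∈ Finset.range (s + 1), mixCoef a b s t j k l m *
          (starRingEnd ℂ (numOp^[j] f z) * (numOpBar^[k] (numOp^[l] φ) z * numOp^[m] g z)))
      (unitBall d) := by
  have hfc : ContDiffOn ℝ (t : WithTop ℕ∞) (fun z => starRingEnd ℂ (f z)) (unitBall d) :=
    contDiffOn_conj (contDiffOn_holo hf t)
  have hφs : ContDiffOn ℝ (s : WithTop ℕ∞) φ (unitBall d) :=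
    hφ.of_le (by norm_cast; omega)
  have h1 : Set.EqOn (shiftProd (eulerOp (-Complex.I)) a s
        fun w => starRingEnd ℂ (f w) * φ w * g w)
      (fun z => ∑ x ∈ Finset.range (s + 1) ×ˢ Finset.range (s + 1),
        (shiftCoef a s (x.1 + x.2) * ((x.1 + x.2).choose x.1 : ℂ)) * numOp^[x.2] g z *
          (starRingEnd ℂ (f z) * numOp^[x.1] φ z)) (unitBall d) := by
    intro z hz
    -- A sum with a single term: it pulls f̄ out of the N-stage.
    have h2 := shiftProd_sum_mul (ε := -Complex.I) a (n := s) (Finset.univ : Finset Unit)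
      (u := fun _ w => starRingEnd ℂ (f w)) (q := fun _ w => φ w * g w)
      (fun _ _ z hz => ContDiffOn.differentiableAt_ball (k := 0)
        (contDiffOn_conj (contDiffOn_holo hf 1)) hz)
      (fun _ _ => numOp_conj_holo hf) (fun _ _ => hφs.mul (contDiffOn_holo hg s)) hz
    simp only [Finset.univ_unique, Finset.sum_singleton] at h2
    simp only [mul_assoc] at h2 ⊢
    rw [h2, shiftProd_mul a hφs (contDiffOn_holo hg s) hz]
    simp only
    rw [← Finset.sum_product', Finset.mul_sum]
    refine Finset.sum_congr rfl fun x _ => ?_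
    rw [numOp_iterate_eq, numOp_iterate_eq]
    ring
  intro z hz
  rw [numOpBar_eq', numOp_eq', shiftProd_congr b t h1 hz]
  -- The coefficients of the N-stage are absorbed into the holomorphic factor, so each summand is a
  -- constant for N̄ times f̄ N^l φ.
  have hG : ∀ x ∈ Finset.range (s + 1) ×ˢ Finset.range (s + 1), DifferentiableOn ℂ
      (fun z => (shiftCoef a s (x.1 + x.2) * ((x.1 + x.2).choose x.1 : ℂ)) * numOp^[x.2] g z)
      (unitBall d) := fun x _ => (differentiableOn_numOp_iterate hg _).const_mul _
  have hφx : ∀ x ∈ Finset.range (s + 1) ×ˢ Finset.range (s + 1),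
      ContDiffOn ℝ (t : WithTop ℕ∞) (numOp^[x.1] φ) (unitBall d) := by
    intro x hx
    rw [numOp_iterate_eq]
    refine contDiffOn_eulerOp_iterate (hφ.of_le ?_)
    have := Finset.mem_range.1 (Finset.mem_product.1 hx).1
    norm_cast; omega
  rw [shiftProd_sum_mul b _ (fun x hx z hz => ((hG x hx).differentiableAt
      (isOpen_unitBall.mem_nhds hz)).restrictScalars ℝ) (fun x hx => numOpBar_holo (hG x hx))
      (fun x hx => hfc.mul (hφx x hx)) hz]
  simp only
  have h3 : ∀ x ∈ Finset.range (s + 1) ×ˢ Finset.range (s + 1),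
      shiftCoef a s (x.1 + x.2) * ((x.1 + x.2).choose x.1 : ℂ) * numOp^[x.2] g z *
        shiftProd (eulerOp Complex.I) b t (fun w => starRingEnd ℂ (f w) * numOp^[x.1] φ w) z
      = ∑ y ∈ Finset.range (t + 1) ×ˢ Finset.range (t + 1),
        mixCoef a b s t y.1 y.2 x.1 x.2 * (starRingEnd ℂ (numOp^[y.1] f z) *
          (numOpBar^[y.2] (numOp^[x.1] φ) z * numOp^[x.2] g z)) := by
    intro x hx
    rw [shiftProd_mul b hfc (hφx x hx) hz]
    simp only
    rw [← Finset.sum_product', Finset.mul_sum]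
    refine Finset.sum_congr rfl fun y _ => ?_
    rw [numOpBar_iterate_conj, numOpBar_iterate_eq, mixCoef]
    ring
  rw [Finset.sum_congr rfl h3, Finset.sum_comm]
  simp only [Finset.sum_product, numOpBar_eq', numOp_eq']

/-! ### Integration by parts against radial weights -/

theorem integral_clm_mul_fderiv {F : CSpace d → ℂ} (hF : ContDiff ℝ 1 F)
    (hc : HasCompactSupport F) (l : CSpace d →L[ℝ] ℂ) (v : CSpace d) :
    Integrable (fun z => l z * fderiv ℝ F z v) ∧
      ∫ z, l z * fderiv ℝ F z v = - (l v * ∫ z, F z) := by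
  have hFc : Continuous F := hF.continuous
  have hF' : Continuous fun z => fderiv ℝ F z v :=
    (hF.continuous_fderiv one_ne_zero).clm_apply continuous_const
  have hc' : HasCompactSupport fun z => fderiv ℝ F z v := hc.fderiv_apply (𝕜 := ℝ) v
  have h1 : Integrable (fun z => l z * fderiv ℝ F z v) :=
    (l.continuous.mul hF').integrable_of_hasCompactSupport hc'.mul_left
  refine ⟨h1, ?_⟩
  rw [integral_mul_fderiv_eq_neg_fderiv_mul_of_integrable (v := v) _ h1
    ((l.continuous.mul hFc).integrable_of_hasCompactSupport hc.mul_left)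
    (fun z _ => l.differentiableAt) (fun z _ => hF.differentiable one_ne_zero z)]
  · simp only [ContinuousLinearMap.fderiv, integral_const_mul]
  · simp only [ContinuousLinearMap.fderiv]
    exact (hFc.integrable_of_hasCompactSupport hc).const_mul _

/-- The coordinate `z ↦ Re z_j` with values in `ℂ`. -/
def reCoord (j : Fin d) : CSpace d →L[ℝ] ℂ :=
  Complex.ofRealCLM ∘L Complex.reCLM ∘L ((EuclideanSpace.proj j : CSpace d →L[ℂ] ℂ).restrictScalars ℝ)

/-- The coordinate `z ↦ Im z_j` with values in `ℂ`. -/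
def imCoord (j : Fin d) : CSpace d →L[ℝ] ℂ :=
  Complex.ofRealCLM ∘L Complex.imCLM ∘L ((EuclideanSpace.proj j : CSpace d →L[ℂ] ℂ).restrictScalars ℝ)

theorem reCoord_apply (j : Fin d) (z : CSpace d) : reCoord j z = ((z j).re : ℂ) := rfl

theorem imCoord_apply (j : Fin d) (z : CSpace d) : imCoord j z = ((z j).im : ℂ) := rfl

/-- The field z has real divergence 2d and the field iz has divergence 0, so half their combination
contributes -d whatever ε is. -/
theorem integral_eulerOp {F : CSpace d → ℂ} (hF : ContDiff ℝ 1 F) (hc : HasCompactSupport F)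
    (ε : ℂ) : ∫ z, eulerOp ε F z = - (d * ∫ z, F z) := by
  have key := fun l v => integral_clm_mul_fderiv hF hc l v
  have h1 : ∀ z, fderiv ℝ F z z = ∑ j,
      (reCoord j z * fderiv ℝ F z (EuclideanSpace.single j 1)
        + imCoord j z * fderiv ℝ F z (EuclideanSpace.single j Complex.I)) := fun z => by
    rw [apply_eq_sum_re_im]; rfl
  have h2 : ∀ z, fderiv ℝ F z (Complex.I • z) = ∑ j,
      (- (imCoord j z * fderiv ℝ F z (EuclideanSpace.single j 1))
        + reCoord j z * fderiv ℝ F z (EuclideanSpace.single j Complex.I)) := fun z => by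
    rw [apply_eq_sum_re_im]
    simp [reCoord_apply, imCoord_apply]
  have i1 : ∀ j ∈ Finset.univ, Integrable (fun z =>
      (reCoord j z * fderiv ℝ F z (EuclideanSpace.single j 1)
        + imCoord j z * fderiv ℝ F z (EuclideanSpace.single j Complex.I))) :=
    fun j _ => (key _ _).1.add (key _ _).1
  have i2 : ∀ j ∈ Finset.univ, Integrable (fun z =>
      (- (imCoord j z * fderiv ℝ F z (EuclideanSpace.single j 1))
        + reCoord j z * fderiv ℝ F z (EuclideanSpace.single j Complex.I))) :=
    fun j _ => (key _ _).1.neg.add (key _ _).1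
  have e1 : ∫ z, fderiv ℝ F z z = - (2 * d * ∫ z, F z) := by
    simp only [h1]
    rw [integral_finsetSum _ i1]
    have : ∀ j : Fin d, ∫ z, (reCoord j z * fderiv ℝ F z (EuclideanSpace.single j 1)
        + imCoord j z * fderiv ℝ F z (EuclideanSpace.single j Complex.I))
        = - (2 * ∫ z, F z) := fun j => by
      rw [integral_add (key _ _).1 (key _ _).1, (key _ _).2, (key _ _).2, reCoord_apply,
        imCoord_apply]
      simp
      ring
    simp only [this, Finset.sum_const, Finset.card_univ, Fintype.card_fin, nsmul_eq_mul]
    ring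
  have e2 : ∫ z, fderiv ℝ F z (Complex.I • z) = 0 := by
    simp only [h2]
    rw [integral_finsetSum _ i2]
    refine Finset.sum_eq_zero fun j _ => ?_
    rw [integral_add (key _ _).1.fun_neg (key _ _).1, integral_neg, (key _ _).2, (key _ _).2,
      reCoord_apply, imCoord_apply]
    simp
  have I1 : Integrable fun z => fderiv ℝ F z z := by
    simp only [h1]; exact integrable_finsetSum _ i1
  have I2 : Integrable fun z => fderiv ℝ F z (Complex.I • z) := by
    simp only [h2]; exact integrable_finsetSum _ i2
  simp only [eulerOp]
  rw [integral_const_mul, integral_add I1 (I2.const_mul ε), integral_const_mul, e1, e2]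
  ring

theorem hasFDerivAt_one_sub_norm_sq (z : CSpace d) :
    HasFDerivAt (fun w : CSpace d => 1 - ‖w‖ ^ 2) (-(2 • innerSL ℝ z)) z := by
  have := (hasStrictFDerivAt_norm_sq z).hasFDerivAt.const_sub 1
  exact this

/-- The vector iz is orthogonal to z, hence tangent to the sphere through z, and the ε-term
vanishes: N and N̄ agree on radial functions. -/
theorem eulerOp_radial {ε : ℂ} {h : ℝ → ℝ} {h' : ℝ} {z : CSpace d}
    (hh : HasDerivAt h h' (1 - ‖z‖ ^ 2)) :
    eulerOp ε (fun w => ((h (1 - ‖w‖ ^ 2) : ℝ) : ℂ)) z = ((-(‖z‖ ^ 2 * h') : ℝ) : ℂ) := by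
  have h1 := hh.comp_hasFDerivAt z (hasFDerivAt_one_sub_norm_sq z)
  have h2 := (Complex.ofRealCLM.hasFDerivAt (x := h (1 - ‖z‖ ^ 2))).comp z h1
  have h3 : fderiv ℝ (fun w : CSpace d => ((h (1 - ‖w‖ ^ 2) : ℝ) : ℂ)) z = _ := h2.fderiv
  have h4 : inner ℝ z (Complex.I • z) = 0 := by
    rw [PiLp.inner_apply]
    refine Finset.sum_eq_zero fun j _ => ?_
    simp only [PiLp.smul_apply, smul_eq_mul, Complex.inner, Complex.mul_re, Complex.mul_im,
      Complex.conj_re, Complex.conj_im, Complex.I_re, Complex.I_im]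
    ring
  rw [eulerOp, h3]
  simp only [ContinuousLinearMap.comp_apply, smul_apply, neg_apply, innerSL_apply_apply, h4,
    real_inner_self_eq_norm_sq]
  simp
  ring

/-- The derivative of the transition lives on [0, 1], where |x + 1| ≤ 2. The second bound is meant
for x = n y - 1: it controls n y times the derivative, the term created by a cutoff at scale 1/n,
uniformly in n. -/
theorem exists_deriv_smoothTransition_bound :
    ∃ M : ℝ, 0 ≤ M ∧ ∀ x, |deriv Real.smoothTransition x| ≤ M ∧
      |x + 1| * |deriv Real.smoothTransition x| ≤ 2 * M := by
  have hc : Continuous (deriv Real.smoothTransition) :=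
    (Real.smoothTransition.contDiff (n := 1)).continuous_deriv le_rfl
  obtain ⟨M, hM⟩ := isCompact_Icc.exists_bound_of_continuousOn (s := Set.Icc (0 : ℝ) 1)
    hc.continuousOn
  have h0 : ∀ x, x < 0 → deriv Real.smoothTransition x = 0 := fun x hx => by
    have : Real.smoothTransition =ᶠ[𝓝 x] fun _ => (0 : ℝ) := by
      filter_upwards [gt_mem_nhds hx] with y hy using Real.smoothTransition.zero_of_nonpos hy.le
    rw [this.deriv_eq, deriv_const]
  have h1 : ∀ x, 1 < x → deriv Real.smoothTransition x = 0 := fun x hx => by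
    have : Real.smoothTransition =ᶠ[𝓝 x] fun _ => (1 : ℝ) := by
      filter_upwards [lt_mem_nhds hx] with y hy using Real.smoothTransition.one_of_one_le hy.le
    rw [this.deriv_eq, deriv_const]
  have hM0 : 0 ≤ M := (norm_nonneg _).trans (hM 0 (by simp))
  refine ⟨M, hM0, fun x => ?_⟩
  rcases lt_or_ge x 0 with h | h
  · simp [h0 x h, hM0]
  rcases lt_or_ge 1 x with h' | h'
  · simp [h1 x h', hM0]
  have := hM x ⟨h, h'⟩
  rw [Real.norm_eq_abs] at this
  refine ⟨this, ?_⟩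
  have h2 : |x + 1| ≤ 2 := by rw [abs_of_nonneg] <;> linarith
  exact mul_le_mul h2 this (abs_nonneg _) (by norm_num)

/-- The radial weight with cutoff at distance of order `1/n` from the sphere. -/
def cutWeight (n : ℕ) (t x : ℝ) : ℝ := Real.smoothTransition (n * x - 1) * x ^ t

theorem cutWeight_eq_zero {n : ℕ} (t : ℝ) {x : ℝ} (h : n * x ≤ 1) : cutWeight n t x = 0 := by
  rw [cutWeight, Real.smoothTransition.zero_of_nonpos (by linarith), zero_mul]

theorem hasDerivAt_cutWeight (n : ℕ) (t : ℝ) {x : ℝ} (hx : 0 < x) :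
    HasDerivAt (cutWeight n (t + 1))
      (n * deriv Real.smoothTransition (n * x - 1) * x ^ (t + 1)
        + Real.smoothTransition (n * x - 1) * ((t + 1) * x ^ t)) x := by
  have h1 : HasDerivAt (fun x : ℝ => n * x - 1) (n : ℝ) x := by
    simpa using ((hasDerivAt_id x).const_mul (n : ℝ)).sub_const 1
  have h2 : HasDerivAt Real.smoothTransition (deriv Real.smoothTransition (n * x - 1))
      (n * x - 1) :=
    ((Real.smoothTransition.contDiff (n := 1)).differentiable one_ne_zero _).hasDerivAt
  have h3 := h2.comp x h1
  have h4 := Real.hasDerivAt_rpow_const (p := t + 1) (Or.inl hx.ne')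
  rw [add_sub_cancel_right] at h4
  have h5 := h3.mul h4
  rwa [mul_comm (deriv Real.smoothTransition (n * x - 1))] at h5

theorem contDiffAt_cutWeight (n : ℕ) (t : ℝ) {x : ℝ} (hx : 0 < x) :
    ContDiffAt ℝ 1 (cutWeight n t) x := by
  have h1 : ContDiffAt ℝ 1 (fun x : ℝ => Real.smoothTransition (n * x - 1)) x :=
    (Real.smoothTransition.contDiff (n := 1)).contDiffAt.comp x
      (((contDiff_const.mul contDiff_id).sub contDiff_const).contDiffAt)
  exact h1.mul (Real.contDiffAt_rpow_const_of_ne hx.ne')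

theorem one_sub_norm_sq_pos_iff (z : CSpace d) : 0 < 1 - ‖z‖ ^ 2 ↔ z ∈ unitBall d := by
  refine ⟨fun h => ?_, density_pos⟩
  rw [mem_ball_zero_iff]
  nlinarith [norm_nonneg z]

/-- The factor produced by integrating by parts against the truncated radial weight. -/
def cutFactor (d n : ℕ) (t x : ℝ) : ℝ :=
  - d * x * Real.smoothTransition (n * x - 1)
    + (t + 1) * (1 - x) * Real.smoothTransition (n * x - 1)
    + (1 - x) * (n * x * deriv Real.smoothTransition (n * x - 1))

/-- Write ρ = 1 - |z|² and let χ be the cutoff. `integral_eulerOp` applies to the compactly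
supported function ψ χ ρ^{t+1}; the product rule separates the derivative of ψ from that of the
weight, which is -|z|² times its derivative in ρ. With |z|² = 1 - ρ the terms containing ψ collect
to ψ ρ^t times `cutFactor`. -/
theorem integral_cut {ψ : CSpace d → ℂ} (hψ : ContDiffOn ℝ 1 ψ (unitBall d)) (ε : ℂ) (t : ℝ)
    {n : ℕ} (hn : 1 ≤ n) :
    ∫ z in unitBall d, ((eulerOp ε ψ z * (((1 - ‖z‖ ^ 2) ^ (t + 1) : ℝ) : ℂ)) *
        (Real.smoothTransition (n * (1 - ‖z‖ ^ 2) - 1) : ℝ)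
      - (ψ z * (((1 - ‖z‖ ^ 2) ^ t : ℝ) : ℂ)) * (cutFactor d n t (1 - ‖z‖ ^ 2) : ℝ)) = 0 := by
  have hn0 : (0 : ℝ) < n := by exact_mod_cast hn
  set F : CSpace d → ℂ := fun z => ψ z * ((cutWeight n (t + 1) (1 - ‖z‖ ^ 2) : ℝ) : ℂ) with hF
  have hzero : ∀ z, n * (1 - ‖z‖ ^ 2) ≤ 1 → F z = 0 := fun z hz => by
    simp [hF, cutWeight_eq_zero _ hz]
  -- Off the ball n(1 - |z|²) ≤ 0 < 1, so the cutoff vanishes in a whole neighbourhood. Hence F is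
  -- C¹ everywhere although ψ is regular only inside the ball.
  have hzero' : ∀ z ∉ unitBall d, F =ᶠ[𝓝 z] fun _ => 0 := fun z hz => by
    have h1 : (n : ℝ) * (1 - ‖z‖ ^ 2) < 1 := by
      have := mt (one_sub_norm_sq_pos_iff z).1 hz
      nlinarith
    have h2 : Continuous fun z : CSpace d => (n : ℝ) * (1 - ‖z‖ ^ 2) := by fun_prop
    filter_upwards [h2.continuousAt.eventually (gt_mem_nhds h1)] with w hw using hzero w hw.le
  have hw : ∀ z ∈ unitBall d, ContDiffAt ℝ 1
      (fun w : CSpace d => ((cutWeight n (t + 1) (1 - ‖w‖ ^ 2) : ℝ) : ℂ)) z := fun z hz =>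
    Complex.ofRealCLM.contDiff.contDiffAt.comp z
      ((contDiffAt_cutWeight n (t + 1) (density_pos hz)).comp z
        (contDiff_const.sub (contDiff_norm_sq ℝ)).contDiffAt)
  have hψ' : ∀ z ∈ unitBall d, ContDiffAt ℝ 1 ψ z := fun z hz =>
    hψ.contDiffAt (isOpen_unitBall.mem_nhds hz)
  have hFc : ContDiff ℝ 1 F := by
    rw [contDiff_iff_contDiffAt]
    intro z
    by_cases hz : z ∈ unitBall d
    · exact (hψ' z hz).mul (hw z hz)
    · exact contDiffAt_const.congr_of_eventuallyEq (hzero' z hz)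
  have hsupp : HasCompactSupport F := by
    refine HasCompactSupport.of_support_subset_isCompact (isCompact_closedBall (0 : CSpace d) 1)
      fun z hz => ?_
    by_contra h
    refine hz ((hzero' z fun h' => h (Metric.ball_subset_closedBall h')).self_of_nhds)
  have hI := integral_eulerOp hFc hsupp ε
  have hout : ∀ z, z ∉ unitBall d → eulerOp ε F z = 0 := fun z hz => by
    simp [eulerOp, (hzero' z hz).fderiv_eq]
  have hout' : ∀ z, z ∉ unitBall d → F z = 0 := fun z hz => (hzero' z hz).self_of_nhds
  have hFi : Integrable (eulerOp ε F) := by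
    have h1 : Continuous (fderiv ℝ F) := hFc.continuous_fderiv one_ne_zero
    have h2 : Continuous (eulerOp ε F) := by unfold eulerOp; fun_prop
    refine h2.integrable_of_hasCompactSupport
      (HasCompactSupport.of_support_subset_isCompact (isCompact_closedBall (0 : CSpace d) 1)
      fun z hz => ?_)
    by_contra h
    exact hz (hout z fun h' => h (Metric.ball_subset_closedBall h'))
  have hFi' : Integrable F := hFc.continuous.integrable_of_hasCompactSupport hsupp
  rw [← setIntegral_eq_integral_of_forall_compl_eq_zero hout,
    ← setIntegral_eq_integral_of_forall_compl_eq_zero hout', ← integral_const_mul,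
    ← add_eq_zero_iff_eq_neg, ← integral_add hFi.integrableOn
      (hFi'.const_mul _).integrableOn] at hI
  rw [← hI]
  refine setIntegral_congr_fun measurableSet_ball fun z hz => ?_
  have heq : eulerOp ε F z = _ := eulerOp_mul ((hψ' z hz).differentiableAt one_ne_zero)
      ((hw z hz).differentiableAt one_ne_zero)
  rw [heq, eulerOp_radial (hasDerivAt_cutWeight n t (density_pos hz))]
  simp only [cutWeight, cutFactor, hF, Real.rpow_add_one (density_pos hz).ne']
  push_cast
  ring

theorem abs_smoothTransition_le (x : ℝ) : |Real.smoothTransition x| ≤ 1 := by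
  rw [abs_of_nonneg (Real.smoothTransition.nonneg x)]
  exact Real.smoothTransition.le_one x

/-- Uniformity in n is what dominated convergence needs. The only term that could grow is n x times
the derivative of the transition, bounded by `exists_deriv_smoothTransition_bound`. -/
theorem exists_cutFactor_bound (d : ℕ) (t : ℝ) :
    ∃ K : ℝ, ∀ (n : ℕ) (x : ℝ), 0 ≤ x → x ≤ 1 → |cutFactor d n t x| ≤ K := by
  obtain ⟨M, hM0, hM⟩ := exists_deriv_smoothTransition_bound
  refine ⟨d + |t + 1| + 2 * M, fun n x h0 h1 => ?_⟩
  have hS := abs_smoothTransition_le (n * x - 1)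
  have hD := (hM (n * x - 1)).2
  rw [sub_add_cancel] at hD
  have hx : |x| ≤ 1 := by rw [abs_of_nonneg h0]; exact h1
  have hx' : |1 - x| ≤ 1 := by rw [abs_of_nonneg] <;> linarith
  rw [cutFactor]
  refine (abs_add_three _ _ _).trans ?_
  simp only [abs_mul, abs_neg, Nat.abs_cast] at hD ⊢
  have hd : (0 : ℝ) ≤ d := by positivity
  have e1 : (d : ℝ) * |x| * |Real.smoothTransition (n * x - 1)| ≤ d := by
    calc _ ≤ (d : ℝ) * 1 * 1 := by gcongr
      _ = d := by ring
  have e2 : |t + 1| * |1 - x| * |Real.smoothTransition (n * x - 1)| ≤ |t + 1| := by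
    calc _ ≤ |t + 1| * 1 * 1 := by gcongr
      _ = _ := by ring
  have e3 : |1 - x| * (n * |x| * |deriv Real.smoothTransition (n * x - 1)|) ≤ 2 * M := by
    calc _ ≤ 1 * (2 * M) := by gcongr
      _ = _ := by ring
  linarith

theorem eventually_mul_gt {x : ℝ} (hx : 0 < x) : ∀ᶠ n : ℕ in atTop, 1 < (n : ℝ) * x - 1 := by
  have : Tendsto (fun n : ℕ => (n : ℝ) * x) atTop atTop :=
    tendsto_natCast_atTop_atTop.atTop_mul_const hx
  filter_upwards [this.eventually_gt_atTop 2] with n hn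
  linarith

theorem eventually_smoothTransition {x : ℝ} (hx : 0 < x) :
    ∀ᶠ n : ℕ in atTop, Real.smoothTransition (n * x - 1) = 1 := by
  filter_upwards [eventually_mul_gt hx] with n hn using
    Real.smoothTransition.one_of_one_le hn.le

theorem eventually_cutFactor (d : ℕ) (t : ℝ) {x : ℝ} (hx : 0 < x) :
    ∀ᶠ n : ℕ in atTop, cutFactor d n t x = - d * x + (t + 1) * (1 - x) := by
  filter_upwards [eventually_mul_gt hx] with n hn
  have h1 : deriv Real.smoothTransition (n * x - 1) = 0 := by
    have : Real.smoothTransition =ᶠ[𝓝 (n * x - 1)] fun _ => (1 : ℝ) := by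
      filter_upwards [lt_mem_nhds hn] with y hy using Real.smoothTransition.one_of_one_le hy.le
    rw [this.deriv_eq, deriv_const]
  rw [cutFactor, h1, Real.smoothTransition.one_of_one_le hn.le]
  ring

theorem continuous_cutFactor (d n : ℕ) (t : ℝ) : Continuous (cutFactor d n t) := by
  have h1 : Continuous (deriv Real.smoothTransition) :=
    (Real.smoothTransition.contDiff (n := 1)).continuous_deriv le_rfl
  have h2 := Real.smoothTransition.continuous
  unfold cutFactor
  fun_prop

/-- The cutoff is removed: at a fixed point of the ball it is eventually 1 with derivative 0, and
the two integrands are dominated by multiples of the functions assumed integrable. No boundary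
values of ψ enter. -/
theorem integral_eulerOp_weight {ψ : CSpace d → ℂ} (hψ : ContDiffOn ℝ 1 ψ (unitBall d)) (ε : ℂ)
    (t : ℝ) (h1 : IntegrableOn (fun z => ψ z * (((1 - ‖z‖ ^ 2) ^ t : ℝ) : ℂ)) (unitBall d))
    (h2 : IntegrableOn (fun z => eulerOp ε ψ z * (((1 - ‖z‖ ^ 2) ^ (t + 1) : ℝ) : ℂ))
      (unitBall d)) :
    ∫ z in unitBall d, eulerOp ε ψ z * (((1 - ‖z‖ ^ 2) ^ (t + 1) : ℝ) : ℂ)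
      = ∫ z in unitBall d, (ψ z * (((1 - ‖z‖ ^ 2) ^ t : ℝ) : ℂ)) *
        ((- d * (1 - ‖z‖ ^ 2) + (t + 1) * (1 - (1 - ‖z‖ ^ 2)) : ℝ) : ℂ) := by
  obtain ⟨K, hK⟩ := exists_cutFactor_bound d t
  have hmem : ∀ᵐ z ∂(volume.restrict (unitBall d)), z ∈ unitBall d :=
    ae_restrict_mem measurableSet_ball
  have hδ : ∀ z ∈ unitBall d, 0 ≤ 1 - ‖z‖ ^ 2 ∧ 1 - ‖z‖ ^ 2 ≤ 1 := fun z hz =>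
    ⟨(density_pos hz).le, by nlinarith [sq_nonneg ‖z‖]⟩
  have hS := Real.smoothTransition.continuous
  have b1 : ∀ n : ℕ, ∀ᵐ z ∂(volume.restrict (unitBall d)),
      ‖((Real.smoothTransition (n * (1 - ‖z‖ ^ 2) - 1) : ℝ) : ℂ)‖ ≤ 1 := fun n => by
    filter_upwards with z
    rw [Complex.norm_real]
    exact abs_smoothTransition_le _
  have b2 : ∀ n : ℕ, ∀ᵐ z ∂(volume.restrict (unitBall d)),
      ‖((cutFactor d n t (1 - ‖z‖ ^ 2) : ℝ) : ℂ)‖ ≤ K := fun n => by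
    filter_upwards [hmem] with z hz
    rw [Complex.norm_real]
    exact hK n _ (hδ z hz).1 (hδ z hz).2
  have m1 : ∀ n : ℕ, AEStronglyMeasurable (fun z : CSpace d =>
      ((Real.smoothTransition (n * (1 - ‖z‖ ^ 2) - 1) : ℝ) : ℂ))
      (volume.restrict (unitBall d)) := fun n => by
    refine Continuous.aestronglyMeasurable ?_
    fun_prop
  have m2 : ∀ n : ℕ, AEStronglyMeasurable (fun z : CSpace d =>
      ((cutFactor d n t (1 - ‖z‖ ^ 2) : ℝ) : ℂ)) (volume.restrict (unitBall d)) := fun n => by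
    have := continuous_cutFactor d n t
    refine Continuous.aestronglyMeasurable ?_
    fun_prop
  have i1 := fun n => Integrable.mul_bdd h2 (m1 n) (b1 n)
  have i2 := fun n => Integrable.mul_bdd h1 (m2 n) (b2 n)
  have hcut : ∀ᶠ n : ℕ in atTop, (∫ z in unitBall d,
      (eulerOp ε ψ z * (((1 - ‖z‖ ^ 2) ^ (t + 1) : ℝ) : ℂ)) *
        (Real.smoothTransition (n * (1 - ‖z‖ ^ 2) - 1) : ℝ))
      = ∫ z in unitBall d,
        (ψ z * (((1 - ‖z‖ ^ 2) ^ t : ℝ) : ℂ)) * (cutFactor d n t (1 - ‖z‖ ^ 2) : ℝ) := by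
    filter_upwards [eventually_ge_atTop 1] with n hn
    have := integral_cut hψ ε t hn
    rwa [integral_sub (i1 n) (i2 n), sub_eq_zero] at this
  have L1 : Tendsto (fun n : ℕ => ∫ z in unitBall d,
      (eulerOp ε ψ z * (((1 - ‖z‖ ^ 2) ^ (t + 1) : ℝ) : ℂ)) *
        (Real.smoothTransition (n * (1 - ‖z‖ ^ 2) - 1) : ℝ)) atTop
      (𝓝 (∫ z in unitBall d, eulerOp ε ψ z * (((1 - ‖z‖ ^ 2) ^ (t + 1) : ℝ) : ℂ))) := by
    refine tendsto_integral_of_dominated_convergence _ (fun n => (i1 n).aestronglyMeasurable)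
      h2.norm (fun n => ?_) ?_
    · filter_upwards [b1 n] with z hz
      rw [norm_mul]
      exact mul_le_of_le_one_right (norm_nonneg _) hz
    · filter_upwards [hmem] with z hz
      refine tendsto_const_nhds.congr' ?_
      filter_upwards [eventually_smoothTransition (density_pos hz)] with n hn
      rw [hn, Complex.ofReal_one, mul_one]
  have L2 : Tendsto (fun n : ℕ => ∫ z in unitBall d,
        (ψ z * (((1 - ‖z‖ ^ 2) ^ t : ℝ) : ℂ)) * (cutFactor d n t (1 - ‖z‖ ^ 2) : ℝ)) atTop
      (𝓝 (∫ z in unitBall d, (ψ z * (((1 - ‖z‖ ^ 2) ^ t : ℝ) : ℂ)) *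
        ((- d * (1 - ‖z‖ ^ 2) + (t + 1) * (1 - (1 - ‖z‖ ^ 2)) : ℝ) : ℂ))) := by
    refine tendsto_integral_of_dominated_convergence _ (fun n => (i2 n).aestronglyMeasurable)
      (h1.norm.mul_const K) (fun n => ?_) ?_
    · filter_upwards [b2 n] with z hz
      rw [norm_mul]
      gcongr
    · filter_upwards [hmem] with z hz
      refine tendsto_const_nhds.congr' ?_
      filter_upwards [eventually_cutFactor d t (density_pos hz)] with n hn
      rw [hn]
  exact tendsto_nhds_unique (L1.congr' hcut) L2

/-! ### The measures μ_s and raising the weight by one -/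

theorem normConst_pos {s : ℝ} (hs : (d : ℝ) < s) : 0 < normConst d s := by
  have h0 : (0 : ℝ) < s := lt_of_le_of_lt (Nat.cast_nonneg d) hs
  exact div_pos (Real.Gamma_pos_of_pos h0)
    (mul_pos (pow_pos Real.pi_pos d) (Real.Gamma_pos_of_pos (sub_pos.2 hs)))

/-- From s to s + 1 the constant gains s/(s - d), exactly what one integration by parts loses. -/
theorem normConst_add_one {s : ℝ} (hs : (d : ℝ) < s) :
    normConst d (s + 1) * (s - d) = normConst d s * s := by
  have h0 : (0 : ℝ) < s := lt_of_le_of_lt (Nat.cast_nonneg d) hs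
  have h1 : 0 < s - d := sub_pos.2 hs
  have h2 := Real.Gamma_pos_of_pos h1
  rw [normConst, normConst, Real.Gamma_add_one h0.ne', show s + 1 - d = (s - d) + 1 by ring,
    Real.Gamma_add_one h1.ne']
  field_simp

theorem tau_eq (d : ℕ) : tau d = (volume.restrict (unitBall d)).withDensity
    fun z => ((((1 - ‖z‖ ^ 2) ^ (-((d : ℝ) + 1))).toNNReal : NNReal) : ENNReal) := rfl

theorem rpow_mul_rpow_density {z : CSpace d} (hz : z ∈ unitBall d) (s : ℝ) :
    (1 - ‖z‖ ^ 2) ^ (-((d : ℝ) + 1)) * (1 - ‖z‖ ^ 2) ^ s = (1 - ‖z‖ ^ 2) ^ (s - d - 1) := by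
  rw [← Real.rpow_add (density_pos hz)]
  ring_nf

theorem ae_restrict_mem_ball : ∀ᵐ z ∂(volume.restrict (unitBall d)), z ∈ unitBall d :=
  ae_restrict_mem measurableSet_ball

theorem integrable_tau_iff {F : CSpace d → ℂ} (s : ℝ) :
    Integrable (fun z => F z * (((1 - ‖z‖ ^ 2) ^ s : ℝ) : ℂ)) (tau d) ↔
      IntegrableOn (fun z => F z * (((1 - ‖z‖ ^ 2) ^ (s - d - 1) : ℝ) : ℂ)) (unitBall d) := by
  rw [tau_eq, integrable_withDensity_iff_integrable_smul (by fun_prop)]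
  refine integrable_congr ?_
  filter_upwards [ae_restrict_mem_ball] with z hz
  have h := (density_pos hz)
  rw [NNReal.smul_def, Real.coe_toNNReal _ (by positivity), ← rpow_mul_rpow_density hz s,
    Complex.real_smul, Complex.ofReal_mul]
  ring

theorem integral_tau (F : CSpace d → ℂ) (s : ℝ) :
    ∫ z, F z * (((1 - ‖z‖ ^ 2) ^ s : ℝ) : ℂ) ∂(tau d) =
      ∫ z in unitBall d, F z * (((1 - ‖z‖ ^ 2) ^ (s - d - 1) : ℝ) : ℂ) := by
  rw [tau_eq, integral_withDensity_eq_integral_smul (by fun_prop)]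
  refine integral_congr_ae ?_
  filter_upwards [ae_restrict_mem_ball] with z hz
  have h := (density_pos hz)
  rw [NNReal.smul_def, Real.coe_toNNReal _ (by positivity), ← rpow_mul_rpow_density hz s,
    Complex.real_smul, Complex.ofReal_mul]
  ring

theorem mu_eq (d : ℕ) (s : ℝ) : mu d s = (volume.restrict (unitBall d)).withDensity
    fun z => (((normConst d s * (1 - ‖z‖ ^ 2) ^ (s - d - 1)).toNNReal : NNReal) : ENNReal) := by
  rw [mu, tau, ← withDensity_mul _ (measurable_tauDensity d) (measurable_muDensity d s)]
  refine withDensity_congr_ae ?_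
  filter_upwards [ae_restrict_mem_ball] with z hz
  have h := (density_pos hz)
  rw [Pi.mul_apply, ← ENNReal.ofReal_mul (by positivity), mul_left_comm,
    rpow_mul_rpow_density hz]
  rfl

theorem integrable_mu_iff {F : CSpace d → ℂ} {s : ℝ} (hs : (d : ℝ) < s) :
    Integrable F (mu d s) ↔
      IntegrableOn (fun z => F z * (((1 - ‖z‖ ^ 2) ^ (s - d - 1) : ℝ) : ℂ)) (unitBall d) := by
  rw [mu_eq, integrable_withDensity_iff_integrable_smul (by fun_prop), IntegrableOn]
  have hc := normConst_pos hs
  have hc' : (normConst d s : ℂ) ≠ 0 := by exact_mod_cast hc.ne'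
  rw [← integrable_const_mul_iff (isUnit_iff_ne_zero.2 hc')
    (fun z => F z * (((1 - ‖z‖ ^ 2) ^ (s - d - 1) : ℝ) : ℂ))]
  refine integrable_congr ?_
  filter_upwards [ae_restrict_mem_ball] with z hz
  have h := (density_pos hz)
  rw [NNReal.smul_def, Real.coe_toNNReal _ (by positivity), Complex.real_smul, Complex.ofReal_mul]
  ring

theorem integral_mu (F : CSpace d → ℂ) {s : ℝ} (hs : (d : ℝ) < s) :
    ∫ z, F z ∂(mu d s) = (normConst d s : ℂ) *
      ∫ z in unitBall d, F z * (((1 - ‖z‖ ^ 2) ^ (s - d - 1) : ℝ) : ℂ) := by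
  rw [mu_eq, integral_withDensity_eq_integral_smul (by fun_prop), ← integral_const_mul]
  have hc := normConst_pos hs
  refine integral_congr_ae ?_
  filter_upwards [ae_restrict_mem_ball] with z hz
  have h := (density_pos hz)
  rw [NNReal.smul_def, Real.coe_toNNReal _ (by positivity), Complex.real_smul, Complex.ofReal_mul]
  ring

theorem lintegral_mu (F : CSpace d → ENNReal) {s : ℝ} :
    ∫⁻ z, F z ∂(mu d s) =
      ∫⁻ z in unitBall d, ENNReal.ofReal (normConst d s * (1 - ‖z‖ ^ 2) ^ (s - d - 1)) * F z := by
  rw [mu_eq, lintegral_withDensity_eq_lintegral_mul_non_measurable₀ _ (by fun_prop)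
    (by simp)]
  rfl

/-- One step of integration by parts, raising the weight by one. -/
theorem integral_step {ψ : CSpace d → ℂ} (hψ : ContDiffOn ℝ 1 ψ (unitBall d)) (ε : ℂ) {s : ℝ}
    (hs : (d : ℝ) < s) (h1 : Integrable ψ (mu d s))
    (h2 : Integrable (fun z => ψ z + eulerOp ε ψ z / (s : ℂ)) (mu d (s + 1))) :
    ∫ z, ψ z ∂(mu d s) = ∫ z, (ψ z + eulerOp ε ψ z / (s : ℂ)) ∂(mu d (s + 1)) := by
  have h0 : (0 : ℝ) < s := lt_of_le_of_lt (Nat.cast_nonneg d) hs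
  have hs' : (d : ℝ) < s + 1 := by linarith
  have hs0 : (s : ℂ) ≠ 0 := by exact_mod_cast h0.ne'
  rw [integral_mu _ hs, integral_mu _ hs']
  rw [integrable_mu_iff hs] at h1
  rw [integrable_mu_iff hs'] at h2
  set t : ℝ := s - d - 1 with ht
  have ht' : s + 1 - d - 1 = t + 1 := by rw [ht]; ring
  rw [ht'] at h2 ⊢
  have hpow : ∀ z ∈ unitBall d, (1 - ‖z‖ ^ 2) ^ (t + 1) = (1 - ‖z‖ ^ 2) ^ t * (1 - ‖z‖ ^ 2) :=
    fun z hz => Real.rpow_add_one (density_pos hz).ne' _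
  have h3 : IntegrableOn (fun z => ψ z * (((1 - ‖z‖ ^ 2) ^ (t + 1) : ℝ) : ℂ)) (unitBall d) := by
    have := Integrable.mul_bdd (c := 1) (g := fun z : CSpace d => ((1 - ‖z‖ ^ 2 : ℝ) : ℂ)) h1
      (Continuous.aestronglyMeasurable (by fun_prop)) (by
        filter_upwards [ae_restrict_mem_ball] with z hz
        rw [Complex.norm_real, Real.norm_of_nonneg (density_pos hz).le]
        nlinarith [sq_nonneg ‖z‖])
    refine this.congr ?_
    filter_upwards [ae_restrict_mem_ball] with z hz
    rw [hpow z hz]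
    push_cast
    ring
  -- The derivative term alone is integrable, being s times the difference between the assumed
  -- combination and ψ ρ^{t+1}.
  have h4 : IntegrableOn (fun z => eulerOp ε ψ z * (((1 - ‖z‖ ^ 2) ^ (t + 1) : ℝ) : ℂ))
      (unitBall d) := by
    refine ((h2.sub h3).const_mul (s : ℂ)).congr ?_
    filter_upwards with z
    simp only [Pi.sub_apply]
    field_simp
    ring
  have key := integral_eulerOp_weight hψ ε t h1 h4
  have e1 : ∫ z in unitBall d, (ψ z + eulerOp ε ψ z / (s : ℂ)) *
      (((1 - ‖z‖ ^ 2) ^ (t + 1) : ℝ) : ℂ)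
      = (∫ z in unitBall d, ψ z * (((1 - ‖z‖ ^ 2) ^ (t + 1) : ℝ) : ℂ)) + (s : ℂ)⁻¹ *
        ∫ z in unitBall d, eulerOp ε ψ z * (((1 - ‖z‖ ^ 2) ^ (t + 1) : ℝ) : ℂ) := by
    rw [← integral_const_mul, ← integral_add h3 (h4.const_mul _)]
    refine integral_congr_ae ?_
    filter_upwards with z
    ring
  -- Since t + 1 = s - d, the limiting factor is -dρ + (s - d)(1 - ρ) = (s - d) - sρ with ρ = 1 -
  -- |z|². After division by s its second part cancels the undifferentiated term of `e1`.
  have e2 : ∫ z in unitBall d, (ψ z * (((1 - ‖z‖ ^ 2) ^ t : ℝ) : ℂ)) *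
        ((- d * (1 - ‖z‖ ^ 2) + (t + 1) * (1 - (1 - ‖z‖ ^ 2)) : ℝ) : ℂ)
      = ((s - d : ℝ) : ℂ) * (∫ z in unitBall d, ψ z * (((1 - ‖z‖ ^ 2) ^ t : ℝ) : ℂ))
        - (s : ℂ) * ∫ z in unitBall d, ψ z * (((1 - ‖z‖ ^ 2) ^ (t + 1) : ℝ) : ℂ) := by
    rw [← integral_const_mul, ← integral_const_mul,
      ← integral_sub (h1.const_mul _) (h3.const_mul _)]
    refine setIntegral_congr_fun measurableSet_ball fun z hz => ?_
    rw [hpow z hz, ht]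
    push_cast
    ring
  rw [e1, key, e2]
  have hc : (normConst d (s + 1) : ℂ) * ((s - d : ℝ) : ℂ) = normConst d s * s := by
    exact_mod_cast normConst_add_one hs
  field_simp
  linear_combination (-(∫ z in unitBall d, ψ z * (((1 - ‖z‖ ^ 2) ^ t : ℝ) : ℂ))) * hc

/-- In polar coordinates 1 - r² = (1 - r)(1 + r): the power (1 - r)^t is integrable for t > -1, and
the remaining factors are bounded by 2^|t|. -/
theorem integrableOn_density_rpow (hd : 1 ≤ d) {t : ℝ} (ht : -1 < t) :
    IntegrableOn (fun z : CSpace d => (1 - ‖z‖ ^ 2) ^ t) (unitBall d) := by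
  have : Nonempty (Fin d) := ⟨⟨0, hd⟩⟩
  have : Nontrivial (CSpace d) := inferInstance
  rw [integrableOn_fun_norm_addHaar (volume : Measure (CSpace d))
    (f := fun r : ℝ => (1 - r ^ 2) ^ t)]
  have h1 : IntegrableOn (fun y : ℝ => (1 - y) ^ t) (Set.Ioo 0 1) := by
    have h := (intervalIntegral.intervalIntegrable_rpow' (a := 1) (b := 0) ht).comp_sub_left 1
    simp only [sub_self, sub_zero] at h
    rw [intervalIntegrable_iff_integrableOn_Ioo_of_le zero_le_one] at h
    exact h
  have hle : ∀ y ∈ Set.Ioo (0 : ℝ) 1, ‖y ^ (Module.finrank ℝ (CSpace d) - 1) * (1 + y) ^ t‖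
      ≤ 2 ^ |t| := by
    intro y hy
    have h2 : (1 + y) ^ t ≤ 2 ^ |t| := by
      calc (1 + y) ^ t ≤ (1 + y) ^ |t| :=
            Real.rpow_le_rpow_of_exponent_le (by linarith [hy.1]) (le_abs_self t)
        _ ≤ 2 ^ |t| := Real.rpow_le_rpow (by linarith [hy.1]) (by linarith [hy.2]) (abs_nonneg t)
    have h3 : y ^ (Module.finrank ℝ (CSpace d) - 1) ≤ 1 := pow_le_one₀ hy.1.le hy.2.le
    have h4 : 0 ≤ (1 + y) ^ t := Real.rpow_nonneg (by linarith [hy.1]) _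
    have h5 := hy.1
    rw [Real.norm_of_nonneg (by positivity)]
    nlinarith
  have := Integrable.mul_bdd (c := 2 ^ |t|) h1
    (g := fun y => y ^ (Module.finrank ℝ (CSpace d) - 1) * (1 + y) ^ t)
    (Measurable.aestronglyMeasurable (by fun_prop))
    ((ae_restrict_iff' measurableSet_Ioo).2 (Eventually.of_forall hle))
  refine this.congr ?_
  filter_upwards [ae_restrict_mem measurableSet_Ioo] with y hy
  rw [smul_eq_mul, show 1 - y ^ 2 = (1 - y) * (1 + y) by ring,
    Real.mul_rpow (by linarith [hy.2]) (by linarith [hy.1])]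
  ring

theorem isFiniteMeasure_mu (hd : 1 ≤ d) {s : ℝ} (hs : (d : ℝ) < s) :
    IsFiniteMeasure (mu d s) := by
  rw [← integrable_const_iff_isFiniteMeasure (c := (1 : ℂ)) one_ne_zero, integrable_mu_iff hs]
  simp only [one_mul]
  exact (integrableOn_density_rpow hd (t := s - d - 1) (by linarith)).ofReal

/-! ### Fourier coefficients on circles and homogeneous parts -/

/-- The substitution ζ = e^{iθ} turns a Fourier coefficient into a Cauchy integral. For functions
holomorphic on the disc, negative frequencies then vanish by Cauchy's theorem and the others are
Taylor coefficients. -/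
theorem fourierCoeffOn_circleMap (F : ℂ → ℂ) (k : ℤ) :
    fourierCoeffOn Real.two_pi_pos (fun θ => F (circleMap 0 1 θ)) k
      = (2 * Real.pi * Complex.I : ℂ)⁻¹ • ∮ ζ in C(0, 1), ζ ^ (-k - 1) • F ζ := by
  rw [fourierCoeffOn_eq_integral, circleIntegral, ← intervalIntegral.integral_smul,
    ← intervalIntegral.integral_smul]
  refine intervalIntegral.integral_congr fun θ _ => ?_
  rw [fourier_coe_apply, deriv_circleMap]
  have h0 : circleMap 0 1 θ ≠ 0 := circleMap_ne_center one_ne_zero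
  have hpi : (Real.pi : ℂ) ≠ 0 := by exact_mod_cast Real.pi_ne_zero
  have h1 : circleMap 0 1 θ ^ (-k - 1) * circleMap 0 1 θ = circleMap 0 1 θ ^ (-k) := by
    rw [← zpow_add_one₀ h0]
    ring_nf
  have h2 : Complex.exp (2 * Real.pi * Complex.I * ((-k : ℤ) : ℂ) * θ / ((2 * Real.pi - 0 : ℝ) : ℂ))
      = circleMap 0 1 θ ^ (-k) := by
    rw [circleMap]
    simp only [Complex.ofReal_one, one_mul, zero_add]
    rw [← Complex.exp_int_mul]
    congr 1
    push_cast
    field_simp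
    ring
  rw [h2, ← h1]
  simp only [smul_eq_mul, Complex.real_smul]
  push_cast
  have := Complex.I_ne_zero
  field_simp
  ring

theorem fourierCoeffOn_circleMap_neg {F : ℂ → ℂ} (hF : DifferentiableOn ℂ F (Metric.closedBall 0 1))
    {k : ℤ} (hk : k < 0) :
    fourierCoeffOn Real.two_pi_pos (fun θ => F (circleMap 0 1 θ)) k = 0 := by
  obtain ⟨j, hj⟩ := Int.eq_ofNat_of_zero_le (show 0 ≤ -k - 1 by omega)
  rw [fourierCoeffOn_circleMap, hj]
  have h : DifferentiableOn ℂ (fun ζ : ℂ => ζ ^ (j : ℤ) • F ζ) (Metric.closedBall 0 1) := by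
    simp only [zpow_natCast]
    exact (differentiableOn_id.pow j).smul hF
  rw [(h.mono Metric.closure_ball_subset_closedBall).diffContOnCl.circleIntegral_eq_zero
    zero_le_one, smul_zero]

theorem fourierCoeffOn_circleMap_natCast {F : ℂ → ℂ}
    (hF : DifferentiableOn ℂ F (Metric.closedBall 0 1)) (k : ℕ) :
    fourierCoeffOn Real.two_pi_pos (fun θ => F (circleMap 0 1 θ)) k
      = (k.factorial : ℂ)⁻¹ * iteratedFDeriv ℂ k F 0 fun _ => 1 := by
  have h := (DifferentiableOn.hasFPowerSeriesOnBall (R := 1) (c := 0) (f := F)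
    (by simpa using hF) one_pos).factorial_smul (y := (1 : ℂ)) k
  have hk : (k.factorial : ℂ) ≠ 0 := by exact_mod_cast k.factorial_ne_zero
  rw [← h, nsmul_eq_mul, inv_mul_cancel_left₀ hk, cauchyPowerSeries_apply,
    fourierCoeffOn_circleMap]
  congr 1
  refine circleIntegral.integral_congr zero_le_one fun ζ hζ => ?_
  have h0 : ζ ≠ 0 := by
    rintro rfl
    simp at hζ
  simp only [sub_zero, one_div, smul_eq_mul]
  rw [← mul_assoc, zpow_sub_one₀ h0, zpow_neg, zpow_natCast, inv_pow]

/-- The homogeneous part of degree `k` of a function holomorphic near the origin. -/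
def homPart (f : CSpace d → ℂ) (k : ℕ) (z : CSpace d) : ℂ :=
  (k.factorial : ℂ)⁻¹ * iteratedFDeriv ℂ k f 0 fun _ => z

theorem zero_mem_unitBall : (0 : CSpace d) ∈ unitBall d := by simp

theorem homPart_add {f g : CSpace d → ℂ} (hf : DifferentiableOn ℂ f (unitBall d))
    (hg : DifferentiableOn ℂ g (unitBall d)) (k : ℕ) (z : CSpace d) :
    homPart (f + g) k z = homPart f k z + homPart g k z := by
  have h0 := (isOpen_unitBall (d := d)).mem_nhds zero_mem_unitBall
  rw [homPart, homPart, homPart, iteratedFDeriv_add_apply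
    ((contDiffOn_holo_complex hf k).contDiffAt h0) ((contDiffOn_holo_complex hg k).contDiffAt h0),
    add_apply, mul_add]

theorem homPart_const_smul {f : CSpace d → ℂ} (hf : DifferentiableOn ℂ f (unitBall d)) (c : ℂ)
    (k : ℕ) (z : CSpace d) : homPart (c • f) k z = c * homPart f k z := by
  have h0 := (isOpen_unitBall (d := d)).mem_nhds zero_mem_unitBall
  rw [homPart, homPart, iteratedFDeriv_const_smul_apply
    ((contDiffOn_holo_complex hf k).contDiffAt h0), smul_apply,
    smul_eq_mul]
  ring

theorem homPart_smul (f : CSpace d → ℂ) (k : ℕ) (c : ℂ) (z : CSpace d) :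
    homPart f k (c • z) = c ^ k * homPart f k z := by
  rw [homPart, homPart, ContinuousMultilinearMap.map_smul_univ]
  simp
  ring

theorem differentiable_homPart (f : CSpace d → ℂ) (k : ℕ) : Differentiable ℂ (homPart f k) := by
  intro z
  have h1 : DifferentiableAt ℂ (iteratedFDeriv ℂ k f 0) (fun _ : Fin k => z) :=
    (ContinuousMultilinearMap.hasFDerivAt _ _).differentiableAt
  have h2 : DifferentiableAt ℂ (fun w : CSpace d => fun _ : Fin k => w) z := by fun_prop
  exact (DifferentiableAt.comp z h1 h2).const_mul _

/-- Euler's identity: differentiate t ↦ `homPart f k (t • z)`, which is t^k times its value at t =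
1. -/
theorem numOp_homPart (f : CSpace d → ℂ) (k : ℕ) (z : CSpace d) :
    numOp (homPart f k) z = k * homPart f k z := by
  rw [numOp_holo (differentiable_homPart f k z)]
  have h1 : HasDerivAt (fun t : ℂ => t • z) z 1 := by
    simpa using (hasDerivAt_id (1 : ℂ)).smul_const z
  have h2 : HasDerivAt (fun t : ℂ => homPart f k (t • z)) (fderiv ℂ (homPart f k) z z) 1 := by
    have := (differentiable_homPart f k ((1 : ℂ) • z)).hasFDerivAt.comp_hasDerivAt 1 h1
    rwa [one_smul] at this
  have h3 : HasDerivAt (fun t : ℂ => homPart f k (t • z)) (k * homPart f k z) 1 := by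
    simp only [homPart_smul]
    simpa using ((hasDerivAt_id (1 : ℂ)).pow k).mul_const (homPart f k z)
  exact h2.unique h3

theorem exists_homPart_bound (f : CSpace d → ℂ) (k : ℕ) :
    ∃ K : ℝ, 0 ≤ K ∧ ∀ z ∈ unitBall d, ‖homPart f k z‖ ≤ K := by
  refine ⟨‖(k.factorial : ℂ)⁻¹‖ * ‖iteratedFDeriv ℂ k f 0‖, by positivity, fun z hz => ?_⟩
  rw [mem_ball_zero_iff] at hz
  rw [homPart, norm_mul]
  gcongr
  refine (ContinuousMultilinearMap.le_opNorm _ _).trans ?_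
  refine mul_le_of_le_one_right (norm_nonneg _) ?_
  exact Finset.prod_le_one (fun _ _ => norm_nonneg _) fun _ _ => hz.le

theorem smul_mem_unitBall {z : CSpace d} (hz : z ∈ unitBall d) {ζ : ℂ} (hζ : ‖ζ‖ ≤ 1) :
    ζ • z ∈ unitBall d := by
  rw [mem_ball_zero_iff] at hz ⊢
  rw [norm_smul]
  nlinarith [norm_nonneg z]

/-- For |z| < 1 the slice ζ ↦ f(ζz) is holomorphic on the closed disc, and by the chain rule for the
linear map ζ ↦ ζz its Taylor coefficients are the homogeneous parts at z. The homogeneous expansion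
is thus a Fourier expansion on circles, and no power series in several variables is summed. -/
theorem fourierCoeffOn_eq_homPart {f : CSpace d → ℂ} (hf : DifferentiableOn ℂ f (unitBall d))
    {z : CSpace d} (hz : z ∈ unitBall d) :
    (∀ k : ℕ, fourierCoeffOn Real.two_pi_pos (fun θ => f (circleMap 0 1 θ • z)) k
      = homPart f k z) ∧
    ∀ k : ℤ, k < 0 →
      fourierCoeffOn Real.two_pi_pos (fun θ => f (circleMap 0 1 θ • z)) k = 0 := by
  have hF : DifferentiableOn ℂ (fun ζ : ℂ => f (ζ • z)) (Metric.closedBall 0 1) := by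
    refine hf.comp (f := fun ζ : ℂ => ζ • z) (by fun_prop) fun ζ hζ => ?_
    exact smul_mem_unitBall hz (by simpa using hζ)
  refine ⟨fun k => ?_, fun k hk => fourierCoeffOn_circleMap_neg hF hk⟩
  rw [fourierCoeffOn_circleMap_natCast hF k, homPart]
  congr 1
  let L : ℂ →L[ℂ] CSpace d := (ContinuousLinearMap.id ℂ ℂ).smulRight z
  have hL : (fun ζ : ℂ => f (ζ • z)) = f ∘ L := rfl
  have ho : IsOpen (L ⁻¹' unitBall d) := isOpen_unitBall.preimage L.continuous
  have h0 : L 0 ∈ unitBall d := by simp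
  have h0' : (0 : ℂ) ∈ L ⁻¹' unitBall d := h0
  have key := L.iteratedFDerivWithin_comp_right (contDiffOn_holo_complex hf k)
    isOpen_unitBall.uniqueDiffOn ho.uniqueDiffOn (x := 0) h0 (i := k) le_rfl
  rw [iteratedFDerivWithin_of_isOpen k ho h0', iteratedFDerivWithin_of_isOpen k isOpen_unitBall h0,
    ← hL, map_zero] at key
  rw [key]
  simp [L]

theorem continuous_circle_slice {f : CSpace d → ℂ} (hf : DifferentiableOn ℂ f (unitBall d))
    {z : CSpace d} (hz : z ∈ unitBall d) : Continuous fun θ : ℝ => f (circleMap 0 1 θ • z) := by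
  refine hf.continuousOn.comp_continuous ((continuous_circleMap 0 1).smul continuous_const)
    fun θ => smul_mem_unitBall hz (by simp)

/-- The derivative of θ ↦ f(e^{iθ}z) is i (Nf)(e^{iθ}z), and differentiation multiplies the k-th
Fourier coefficient by ik, the boundary term vanishing by periodicity. -/
theorem homPart_numOp {f : CSpace d → ℂ} (hf : DifferentiableOn ℂ f (unitBall d)) (k : ℕ)
    {z : CSpace d} (hz : z ∈ unitBall d) :
    homPart (numOp f) k z = k * homPart f k z := by
  -- The Fourier identity divides by k, so degree 0 is separate: Nf vanishes at the origin.
  rcases Nat.eq_zero_or_pos k with rfl | hk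
  · simp [homPart, numOp]
  rw [← (fourierCoeffOn_eq_homPart (differentiableOn_numOp hf) hz).1 k,
    ← (fourierCoeffOn_eq_homPart hf hz).1 k]
  have hmem : ∀ θ : ℝ, circleMap 0 1 θ • z ∈ unitBall d := fun θ =>
    smul_mem_unitBall hz (by simp)
  have hder : ∀ θ : ℝ, HasDerivAt (fun θ : ℝ => f (circleMap 0 1 θ • z))
      (Complex.I * numOp f (circleMap 0 1 θ • z)) θ := by
    intro θ
    have hd := hf.differentiableAt (isOpen_unitBall.mem_nhds (hmem θ))
    have h1 : HasDerivAt (fun θ : ℝ => circleMap 0 1 θ • z)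
        ((circleMap 0 1 θ * Complex.I) • z) θ := (hasDerivAt_circleMap 0 1 θ).smul_const z
    have h2 := (hd.hasFDerivAt.restrictScalars ℝ).comp_hasDerivAt θ h1
    rw [ContinuousLinearMap.coe_restrictScalars', mul_comm, mul_smul, map_smul,
      ← numOp_holo hd] at h2
    exact h2
  have hk0 : (k : ℤ) ≠ 0 := by exact_mod_cast hk.ne'
  have hcont := continuous_circle_slice (differentiableOn_numOp hf) hz
  have key := fourierCoeffOn_of_hasDerivAt Real.two_pi_pos (n := (k : ℤ)) hk0
    (fun θ _ => hder θ) ((continuous_const.mul hcont).intervalIntegrable _ _)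
  rw [fourierCoeffOn.const_mul] at key
  have hper : circleMap 0 1 (2 * Real.pi) = circleMap 0 1 0 := by
    simpa using periodic_circleMap 0 1 0
  rw [key, hper]
  have hpi : (Real.pi : ℂ) ≠ 0 := by exact_mod_cast Real.pi_ne_zero
  have hk1 : (k : ℂ) ≠ 0 := by exact_mod_cast hk.ne'
  have := Complex.I_ne_zero
  push_cast
  field_simp
  ring

/-- Parseval on the circle through z, where the negative frequencies are absent. -/
theorem hasSum_homPart {f : CSpace d → ℂ} (hf : DifferentiableOn ℂ f (unitBall d))
    {z : CSpace d} (hz : z ∈ unitBall d) :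
    HasSum (fun k : ℕ => ‖homPart f k z‖ ^ 2)
      ((2 * Real.pi)⁻¹ * ∫ θ in (0)..(2 * Real.pi), ‖f (circleMap 0 1 θ • z)‖ ^ 2) := by
  have hc := continuous_circle_slice hf hz
  have hL2 : MemLp (fun θ : ℝ => f (circleMap 0 1 θ • z)) 2
      (volume.restrict (Set.Ioc 0 (2 * Real.pi))) := by
    obtain ⟨C, hC⟩ := isCompact_Icc.exists_bound_of_continuousOn (s := Set.Icc 0 (2 * Real.pi))
      hc.continuousOn
    refine MemLp.of_bound hc.aestronglyMeasurable C ?_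
    filter_upwards [ae_restrict_mem measurableSet_Ioc] with θ hθ
    exact hC θ (Set.Ioc_subset_Icc_self hθ)
  have h := hasSum_sq_fourierCoeffOn Real.two_pi_pos hL2
  rw [sub_zero, smul_eq_mul] at h
  rw [← Function.Injective.hasSum_iff (g := fun k : ℕ => (k : ℤ)) Nat.cast_injective] at h
  · convert h using 2 with k
    simp only [Function.comp_apply, (fourierCoeffOn_eq_homPart hf hz).1]
  · intro k hk
    rw [(fourierCoeffOn_eq_homPart hf hz).2 k, norm_zero, zero_pow two_ne_zero]
    by_contra h'
    obtain ⟨j, rfl⟩ := Int.eq_ofNat_of_zero_le (not_lt.1 h')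
    exact hk ⟨j, rfl⟩

theorem tsum_enorm_homPart {f : CSpace d → ℂ} (hf : DifferentiableOn ℂ f (unitBall d))
    {z : CSpace d} (hz : z ∈ unitBall d) :
    ENNReal.ofReal (2 * Real.pi) * ∑' k : ℕ, ‖homPart f k z‖ₑ ^ 2
      = ∫⁻ θ in Set.Ioc 0 (2 * Real.pi), ‖f (circleMap 0 1 θ • z)‖ₑ ^ 2 := by
  have h := hasSum_homPart hf hz
  have hc := continuous_circle_slice hf hz
  have e : ∀ a : ℂ, ‖a‖ₑ ^ 2 = ENNReal.ofReal (‖a‖ ^ 2) := fun a => by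
    rw [← ofReal_norm, ENNReal.ofReal_pow (norm_nonneg _)]
  simp only [e]
  rw [← ENNReal.ofReal_tsum_of_nonneg (fun k => by positivity) h.summable, h.tsum_eq,
    ← ENNReal.ofReal_mul (by positivity), mul_inv_cancel_left₀ (by positivity),
    intervalIntegral.integral_of_le (by positivity),
    ofReal_integral_eq_lintegral_ofReal]
  · exact ((hc.norm.pow 2).integrableOn_Icc.mono_set Set.Ioc_subset_Icc_self)
  · exact Eventually.of_forall fun θ => by positivity

theorem mu_absolutelyContinuous (d : ℕ) (s : ℝ) : mu d s ≪ volume.restrict (unitBall d) := by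
  rw [mu_eq]
  exact withDensity_absolutelyContinuous _ _

theorem aestronglyMeasurable_mu {f : CSpace d → ℂ} (hf : ContinuousOn f (unitBall d)) (s : ℝ) :
    AEStronglyMeasurable f (mu d s) :=
  (hf.aestronglyMeasurable measurableSet_ball).mono_ac (mu_absolutelyContinuous d s)

theorem lintegral_mu_congr {F G : CSpace d → ENNReal} (s : ℝ) (h : Set.EqOn F G (unitBall d)) :
    ∫⁻ z, F z ∂(mu d s) = ∫⁻ z, G z ∂(mu d s) :=
  lintegral_congr_ae ((ae_mem_unitBall d s).mono fun _ hz => h hz)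

/-- Multiplication by a unimodular scalar is a real isometry preserving the ball, and the density of
μ_s is radial. -/
theorem lintegral_mu_rotate {G : CSpace d → ENNReal} (hG : Measurable G) (s : ℝ) {ζ : ℂ}
    (hζ : ‖ζ‖ = 1) : ∫⁻ z, G (ζ • z) ∂(mu d s) = ∫⁻ z, G z ∂(mu d s) := by
  have hne : ζ ≠ 0 := by rintro rfl; simp at hζ
  let L : CSpace d ≃ₗᵢ[ℝ] CSpace d :=
    { (LinearEquiv.smulOfNeZero ℂ (CSpace d) _ hne).restrictScalars ℝ with
      norm_map' := fun w => by
        change ‖ζ • w‖ = ‖w‖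
        rw [norm_smul, hζ, one_mul] }
  have hL : ∀ w, L w = ζ • w := fun w => rfl
  have hpre : L ⁻¹' unitBall d = unitBall d := by
    ext w
    simp
  have hm : Measurable fun z : CSpace d =>
      ENNReal.ofReal (normConst d s * (1 - ‖z‖ ^ 2) ^ (s - d - 1)) * G z := by fun_prop
  have key := L.measurePreserving.setLIntegral_comp_preimage (s := unitBall d)
    measurableSet_ball hm
  rw [hpre] at key
  simp only [hL, norm_smul, hζ, one_mul] at key
  rw [lintegral_mu, lintegral_mu, key]

/-! ### Parseval for the weighted norms and the graded energy -/

/-- The square of the `L²(μ_s)` norm of the homogeneous part of degree `k`. -/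
def homNormSq (f : CSpace d → ℂ) (s : ℝ) (k : ℕ) : ENNReal :=
  ∫⁻ z, ‖homPart f k z‖ₑ ^ 2 ∂(mu d s)

theorem sFinite_mu (d : ℕ) (s : ℝ) : SFinite (mu d s) := by
  rw [mu_eq]
  infer_instance

/-- Parseval's identity for the expansion in homogeneous parts. -/
theorem lintegral_enorm_sq_eq_tsum {f : CSpace d → ℂ} (hf : DifferentiableOn ℂ f (unitBall d))
    (s : ℝ) : ∫⁻ z, ‖f z‖ₑ ^ 2 ∂(mu d s) = ∑' k, homNormSq f s k := by
  classical
  have := sFinite_mu d s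
  -- Nothing is known of f outside the ball; extending by zero makes (z, θ) ↦ F(e^{iθ}z) measurable
  -- on the product, as Fubini requires.
  set F : CSpace d → ENNReal := fun w => ‖(unitBall d).piecewise f 0 w‖ₑ ^ 2 with hF
  have hFm : Measurable F :=
    ((hf.continuousOn.measurable_piecewise continuousOn_const measurableSet_ball).enorm).pow_const 2
  have hFf : ∀ w ∈ unitBall d, F w = ‖f w‖ₑ ^ 2 := fun w hw => by
    simp only [hF, Set.piecewise_eq_of_mem _ _ _ hw]
  have hpi : ENNReal.ofReal (2 * Real.pi) ≠ 0 := by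
    simp only [ne_eq, ENNReal.ofReal_eq_zero, not_le]; positivity
  have hpm : ∀ k, Measurable fun z => ‖homPart f k z‖ₑ ^ 2 := fun k =>
    ((differentiable_homPart f k).continuous.measurable.enorm).pow_const 2
  refine (ENNReal.mul_right_inj hpi ENNReal.ofReal_ne_top).1 ?_
  symm
  -- Parseval on each circle, then Fubini; by rotation invariance the inner integral no longer
  -- depends on θ.
  calc ENNReal.ofReal (2 * Real.pi) * ∑' k, homNormSq f s k
      = ∫⁻ z, ENNReal.ofReal (2 * Real.pi) * ∑' k : ℕ, ‖homPart f k z‖ₑ ^ 2 ∂(mu d s) := by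
        simp only [homNormSq]
        rw [← lintegral_tsum fun k => (hpm k).aemeasurable,
          lintegral_const_mul _ (Measurable.tsum hpm)]
    _ = ∫⁻ z, (∫⁻ θ in Set.Ioc 0 (2 * Real.pi), F (circleMap 0 1 θ • z)) ∂(mu d s) := by
        refine lintegral_mu_congr s fun z hz => ?_
        rw [tsum_enorm_homPart hf hz]
        refine lintegral_congr fun θ => ?_
        rw [hFf _ (smul_mem_unitBall hz (by simp))]
    _ = ∫⁻ θ in Set.Ioc 0 (2 * Real.pi), ∫⁻ z, F (circleMap 0 1 θ • z) ∂(mu d s) := by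
        refine lintegral_lintegral_swap (Measurable.aemeasurable ?_)
        have hcont : Continuous (fun p : CSpace d × ℝ => circleMap 0 1 p.2 • p.1) :=
          ((continuous_circleMap 0 1).comp continuous_snd).smul continuous_fst
        exact hFm.comp hcont.measurable
    _ = ∫⁻ θ in Set.Ioc 0 (2 * Real.pi), ∫⁻ z, F z ∂(mu d s) := by
        refine lintegral_congr fun θ => lintegral_mu_rotate hFm s (by simp)
    _ = ENNReal.ofReal (2 * Real.pi) * ∫⁻ z, ‖f z‖ₑ ^ 2 ∂(mu d s) := by
        rw [setLIntegral_const, Real.volume_Ioc, sub_zero, mul_comm, lintegral_mu_congr s hFf]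

theorem enorm_sq_eq (a : ℂ) : ‖a‖ₑ ^ 2 = ENNReal.ofReal (‖a‖ ^ 2) := by
  rw [← ofReal_norm, ENNReal.ofReal_pow (norm_nonneg _)]

theorem integrable_mu_of_bounded (hd : 1 ≤ d) {s : ℝ} (hs : (d : ℝ) < s) {F : CSpace d → ℂ}
    (hF : ContinuousOn F (unitBall d)) {K : ℝ} (hK : ∀ z ∈ unitBall d, ‖F z‖ ≤ K) :
    Integrable F (mu d s) := by
  have := isFiniteMeasure_mu hd hs
  exact Integrable.of_bound (aestronglyMeasurable_mu hF s) K
    ((ae_mem_unitBall d s).mono hK)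

/-- If p is homogeneous of degree k, then N(p̄p) = k p̄p because N kills p̄, so one integration by
parts multiplies by 1 + k/s. Integrability is free: p is bounded on the ball and μ_s is finite. -/
theorem homNormSq_step (hd : 1 ≤ d) {s : ℝ} (hs : (d : ℝ) < s) (f : CSpace d → ℂ) (k : ℕ) :
    homNormSq f s k = ENNReal.ofReal (1 + k / s) * homNormSq f (s + 1) k := by
  have h0 : (0 : ℝ) < s := lt_of_le_of_lt (Nat.cast_nonneg d) hs
  have hs' : (d : ℝ) < s + 1 := by linarith
  set p := homPart f k with hp
  have hpd : DifferentiableOn ℂ p (unitBall d) := (differentiable_homPart f k).differentiableOn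
  have hpc : Continuous p := (differentiable_homPart f k).continuous
  obtain ⟨K, hK0, hK⟩ := exists_homPart_bound f k
  set ψ : CSpace d → ℂ := fun z => starRingEnd ℂ (p z) * p z with hψ
  have hψ1 : ContDiffOn ℝ 1 ψ (unitBall d) := by
    have := contDiffOn_holo hpd 1
    have h2 := (contDiffOn_conj this).mul this
    simpa using h2
  have hψ2 : ∀ z ∈ unitBall d, eulerOp (-Complex.I) ψ z = k * ψ z := by
    intro z hz
    have h1 : DifferentiableAt ℝ p z := (differentiable_homPart f k z).restrictScalars ℝ
    have h2 : DifferentiableAt ℝ (fun w => starRingEnd ℂ (p w)) z :=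
      Complex.conjCLE.differentiableAt.comp z h1
    rw [hψ, eulerOp_mul h2 h1, numOp_conj_holo hpd hz, ← numOp_eq, numOp_homPart]
    simp only [Pi.zero_apply]
    ring
  have hψ3 : ∀ z, ψ z = ((‖p z‖ ^ 2 : ℝ) : ℂ) := fun z => by
    rw [hψ]; simp only [Complex.conj_mul', Complex.ofReal_pow]
  have hψc : Continuous ψ := (Complex.continuous_conj.comp hpc).mul hpc
  have hψb : ∀ z ∈ unitBall d, ‖ψ z‖ ≤ K ^ 2 := fun z hz => by
    rw [hψ3, Complex.norm_real, norm_pow, norm_norm]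
    exact pow_le_pow_left₀ (norm_nonneg _) (hK z hz) 2
  have i1 : ∀ {s : ℝ}, (d : ℝ) < s → Integrable ψ (mu d s) := fun hs =>
    integrable_mu_of_bounded hd hs hψc.continuousOn hψb
  have e1 : ∀ᵐ z ∂(mu d (s + 1)), ψ z + eulerOp (-Complex.I) ψ z / (s : ℂ)
      = ((1 + k / s : ℝ) : ℂ) * ψ z := by
    filter_upwards [ae_mem_unitBall d (s + 1)] with z hz
    rw [hψ2 z hz]
    push_cast
    ring
  have key := integral_step hψ1 (-Complex.I) hs (i1 hs)
    (((i1 hs').const_mul _).congr (e1.mono fun _ h => h.symm))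
  rw [integral_congr_ae e1, integral_const_mul] at key
  simp only [hψ3, integral_complex_ofReal] at key
  have key' : ∫ z, ‖p z‖ ^ 2 ∂(mu d s) = (1 + k / s) * ∫ z, ‖p z‖ ^ 2 ∂(mu d (s + 1)) := by
    exact_mod_cast key
  have hreal : ∀ {s : ℝ}, (d : ℝ) < s →
      homNormSq f s k = ENNReal.ofReal (∫ z, ‖p z‖ ^ 2 ∂(mu d s)) := fun {s} hs => by
    rw [ofReal_integral_eq_lintegral_ofReal]
    · simp only [homNormSq, enorm_sq_eq, hp]
    · refine (i1 hs).norm.congr (Eventually.of_forall fun z => ?_)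
      simp only [hψ3, Complex.norm_real, norm_pow, norm_norm]
    · exact Eventually.of_forall fun z => by positivity
  rw [hreal hs, hreal hs', key', ENNReal.ofReal_mul (by positivity)]

/-- The graded energy `∑ₖ (1+k)^q ‖f_k‖²_{L²(μ_s)}`. -/
def homEnergy (f : CSpace d → ℂ) (s : ℝ) (q : ℕ) : ENNReal :=
  ∑' k : ℕ, (1 + (k : ENNReal)) ^ q * homNormSq f s k

theorem one_add_natCast_ennreal (k : ℕ) : (1 + (k : ENNReal)) = ENNReal.ofReal (1 + k) := by
  rw [ENNReal.ofReal_add zero_le_one (Nat.cast_nonneg k), ENNReal.ofReal_one,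
    ENNReal.ofReal_natCast]

/-- The factor 1 + k/s is comparable with 1 + k, so raising the weight by one is balanced by one
more power of 1 + k. The constant 1 + s + 1/s serves both directions. -/
theorem homEnergy_succ_le (hd : 1 ≤ d) {s : ℝ} (hs : (d : ℝ) < s) (q : ℕ) :
    ∃ C : ENNReal, C ≠ ⊤ ∧ ∀ f : CSpace d → ℂ,
      homEnergy f (s + 1) (q + 1) ≤ C * homEnergy f s q ∧
      homEnergy f s q ≤ C * homEnergy f (s + 1) (q + 1) := by
  have h0 : (0 : ℝ) < s := lt_of_le_of_lt (Nat.cast_nonneg d) hs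
  refine ⟨ENNReal.ofReal (1 + s + s⁻¹), ENNReal.ofReal_ne_top, fun f => ⟨?_, ?_⟩⟩
  · rw [homEnergy, homEnergy, ← ENNReal.tsum_mul_left]
    refine ENNReal.tsum_le_tsum fun k => ?_
    have hk : (0 : ℝ) ≤ k := Nat.cast_nonneg k
    have h1 : (1 + (k : ENNReal)) ≤ ENNReal.ofReal (1 + s + s⁻¹) * ENNReal.ofReal (1 + k / s) := by
      rw [one_add_natCast_ennreal, ← ENNReal.ofReal_mul (by positivity)]
      gcongr
      have h2 : (1 + s + s⁻¹) * (1 + k / s) = 1 + s + s⁻¹ + k + (1 + s⁻¹) * (k / s) := by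
        field_simp; ring
      rw [h2]
      have h3 : 0 < s⁻¹ := by positivity
      have h4 : 0 ≤ (1 + s⁻¹) * (k / s) := by positivity
      linarith
    rw [homNormSq_step hd hs, pow_succ]
    calc _ ≤ (1 + (k : ENNReal)) ^ q * (ENNReal.ofReal (1 + s + s⁻¹) * ENNReal.ofReal (1 + k / s))
          * homNormSq f (s + 1) k := by gcongr
      _ = _ := by ring
  · rw [homEnergy, homEnergy, ← ENNReal.tsum_mul_left]
    refine ENNReal.tsum_le_tsum fun k => ?_
    have hk : (0 : ℝ) ≤ k := Nat.cast_nonneg k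
    have h1 : ENNReal.ofReal (1 + k / s) ≤ ENNReal.ofReal (1 + s + s⁻¹) * (1 + (k : ENNReal)) := by
      rw [one_add_natCast_ennreal, ← ENNReal.ofReal_mul (by positivity)]
      gcongr
      have h1 : 0 < s⁻¹ := by positivity
      have h2 : (k : ℝ) / s = s⁻¹ * k := by field_simp
      rw [h2]
      nlinarith [mul_nonneg h0.le hk]
    rw [homNormSq_step hd hs, pow_succ]
    calc _ ≤ (1 + (k : ENNReal)) ^ q * ((ENNReal.ofReal (1 + s + s⁻¹) * (1 + (k : ENNReal)))
          * homNormSq f (s + 1) k) := by gcongr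
      _ = _ := by ring

theorem homEnergy_add_le (hd : 1 ≤ d) {s : ℝ} (hs : (d : ℝ) < s) (q p : ℕ) :
    ∃ C : ENNReal, C ≠ ⊤ ∧ ∀ f : CSpace d → ℂ,
      homEnergy f (s + p) (q + p) ≤ C * homEnergy f s q ∧
      homEnergy f s q ≤ C * homEnergy f (s + p) (q + p) := by
  induction p with
  | zero => exact ⟨1, ENNReal.one_ne_top, fun f => by simp⟩
  | succ p ih =>
    obtain ⟨C, hC, h⟩ := ih
    have hsp : (d : ℝ) < s + p := by have : (0 : ℝ) ≤ p := Nat.cast_nonneg p; linarith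
    obtain ⟨C', hC', h'⟩ := homEnergy_succ_le hd hsp (q + p)
    refine ⟨C * C', ENNReal.mul_ne_top hC hC', fun f => ?_⟩
    rw [Nat.cast_succ, ← add_assoc, ← add_assoc]
    constructor
    · refine (h' f).1.trans ?_
      rw [mul_comm C, mul_assoc]
      gcongr
      exact (h f).1
    · refine (h f).2.trans ?_
      rw [mul_assoc]
      gcongr
      exact (h' f).2

theorem homEnergy_mono (f : CSpace d → ℂ) (s : ℝ) {q q' : ℕ} (h : q ≤ q') :
    homEnergy f s q ≤ homEnergy f s q' := by
  refine ENNReal.tsum_le_tsum fun k => ?_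
  gcongr
  simp

/-! ### Operators acting as multipliers on homogeneous parts -/

/-- `h` arises from `f` by multiplying the homogeneous part of degree `k` by `c k`. -/
def IsHomMult (f h : CSpace d → ℂ) (c : ℕ → ℂ) : Prop :=
  DifferentiableOn ℂ h (unitBall d) ∧
    ∀ k, ∀ z ∈ unitBall d, homPart h k z = c k * homPart f k z

theorem IsHomMult.lintegral {f h : CSpace d → ℂ} {c : ℕ → ℂ} (hh : IsHomMult f h c) (s : ℝ) :
    ∫⁻ z, ‖h z‖ₑ ^ 2 ∂(mu d s) = ∑' k, ‖c k‖ₑ ^ 2 * homNormSq f s k := by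
  rw [lintegral_enorm_sq_eq_tsum hh.1]
  refine tsum_congr fun k => ?_
  rw [homNormSq, homNormSq, ← lintegral_const_mul _
    (((differentiable_homPart f k).continuous.measurable.enorm).pow_const 2)]
  refine lintegral_mu_congr s fun z hz => ?_
  rw [hh.2 k z hz, enorm_mul, mul_pow]

theorem IsHomMult.refl {f : CSpace d → ℂ} (hf : DifferentiableOn ℂ f (unitBall d)) :
    IsHomMult f f fun _ => 1 := ⟨hf, fun k z _ => by rw [one_mul]⟩

theorem IsHomMult.add {f g h : CSpace d → ℂ} {a b : ℕ → ℂ} (hg : IsHomMult f g a)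
    (hh : IsHomMult f h b) : IsHomMult f (g + h) (a + b) :=
  ⟨hg.1.add hh.1, fun k z hz => by
    rw [homPart_add hg.1 hh.1, hg.2 k z hz, hh.2 k z hz, Pi.add_apply, add_mul]⟩

theorem IsHomMult.const_smul {f g : CSpace d → ℂ} {a : ℕ → ℂ} (hg : IsHomMult f g a) (c : ℂ) :
    IsHomMult f (c • g) (c • a) :=
  ⟨hg.1.const_smul c, fun k z hz => by
    rw [homPart_const_smul hg.1, hg.2 k z hz, Pi.smul_apply, smul_eq_mul, mul_assoc]⟩

theorem IsHomMult.numOp {f g : CSpace d → ℂ} {a : ℕ → ℂ} (hg : IsHomMult f g a) :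
    IsHomMult f (numOp g) fun k => k * a k :=
  ⟨differentiableOn_numOp hg.1, fun k z hz => by
    rw [homPart_numOp hg.1 k hz, hg.2 k z hz, mul_assoc]⟩

theorem isHomMult_iterate {f : CSpace d → ℂ} (hf : DifferentiableOn ℂ f (unitBall d)) (j : ℕ) :
    IsHomMult f (GenBergman.numOp^[j] f) fun k => (k : ℂ) ^ j := by
  induction j with
  | zero => simpa using IsHomMult.refl hf
  | succ j ih =>
    rw [Function.iterate_succ_apply']
    convert ih.numOp using 2
    ring

/-- The symbol `∏_{i<m} (1 + k/(a+i))` of `shiftProd numOp a m`. -/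
def shiftSymbol (a : ℝ) (m k : ℕ) : ℝ := ∏ i ∈ Finset.range m, (1 + k / (a + i))

theorem isHomMult_shiftProd {f : CSpace d → ℂ} (hf : DifferentiableOn ℂ f (unitBall d)) (a : ℝ)
    (m : ℕ) : IsHomMult f (shiftProd GenBergman.numOp a m f) fun k => (shiftSymbol a m k : ℂ) := by
  induction m with
  | zero => simpa [shiftSymbol, shiftProd] using IsHomMult.refl hf
  | succ m ih =>
    have h := ih.add (ih.numOp.const_smul (((a + m : ℝ) : ℂ)⁻¹))
    convert h using 1
    · funext z
      simp only [shiftProd, Pi.add_apply, Pi.smul_apply, smul_eq_mul]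
      ring
    · funext k
      simp only [shiftSymbol, Finset.prod_range_succ, Pi.add_apply, Pi.smul_apply, smul_eq_mul]
      push_cast
      ring

theorem lintegral_iterate_le {f : CSpace d → ℂ} (hf : DifferentiableOn ℂ f (unitBall d)) (s : ℝ)
    (j : ℕ) : ∫⁻ z, ‖numOp^[j] f z‖ₑ ^ 2 ∂(mu d s) ≤ homEnergy f s (2 * j) := by
  rw [(isHomMult_iterate hf j).lintegral]
  refine ENNReal.tsum_le_tsum fun k => ?_
  have h : ‖(k : ℂ) ^ j‖ₑ ^ 2 ≤ (1 + (k : ENNReal)) ^ (2 * j) := by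
    rw [enorm_pow, ← pow_mul, mul_comm j, ← ofReal_norm, Complex.norm_natCast,
      ENNReal.ofReal_natCast]
    exact pow_le_pow_left' le_add_self _
  gcongr

/-- Termwise this is (1+k)^{2j} ≤ 4^j (1 + k^{2j}), from 1 + k ≤ 2k for k ≥ 1. So f and N^j f alone
control the energy, hence every intermediate N^i f. -/
theorem homEnergy_le_lintegral {f : CSpace d → ℂ} (hf : DifferentiableOn ℂ f (unitBall d)) (s : ℝ)
    (j : ℕ) : homEnergy f s (2 * j) ≤ 4 ^ j * (∫⁻ z, ‖f z‖ₑ ^ 2 ∂(mu d s)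
      + ∫⁻ z, ‖numOp^[j] f z‖ₑ ^ 2 ∂(mu d s)) := by
  rw [(isHomMult_iterate hf j).lintegral, (IsHomMult.refl hf).lintegral, ← ENNReal.tsum_add,
    ← ENNReal.tsum_mul_left]
  refine ENNReal.tsum_le_tsum fun k => ?_
  rw [← add_mul, ← mul_assoc]
  gcongr
  rw [enorm_pow, ← ofReal_norm (k : ℂ), Complex.norm_natCast, ENNReal.ofReal_natCast, ← pow_mul,
    mul_comm j]
  simp only [enorm_one, one_pow]
  norm_cast
  rcases Nat.eq_zero_or_pos k with rfl | hk
  · calc (1 + 0) ^ (2 * j) = 1 * 1 := by simp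
      _ ≤ 4 ^ j * (1 + 0 ^ (2 * j)) := Nat.mul_le_mul (Nat.one_le_pow _ _ (by norm_num)) (Nat.le_add_right _ _)
  · calc (1 + k) ^ (2 * j) ≤ (2 * k) ^ (2 * j) := Nat.pow_le_pow_left (by omega) _
      _ = 4 ^ j * k ^ (2 * j) := by rw [mul_pow, pow_mul 2]; norm_num
      _ ≤ _ := Nat.mul_le_mul_left _ (by omega)

theorem homEnergy_zero {f : CSpace d → ℂ} (hf : DifferentiableOn ℂ f (unitBall d)) (s : ℝ) :
    homEnergy f s 0 = ∫⁻ z, ‖f z‖ₑ ^ 2 ∂(mu d s) := by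
  simp [homEnergy, lintegral_enorm_sq_eq_tsum hf]

theorem memLp_mu_iff {f : CSpace d → ℂ} (hf : ContinuousOn f (unitBall d)) (s : ℝ) :
    MemLp f 2 (mu d s) ↔ ∫⁻ z, ‖f z‖ₑ ^ 2 ∂(mu d s) < ⊤ := by
  rw [MemLp, and_iff_right (aestronglyMeasurable_mu hf s),
    eLpNorm_lt_top_iff_lintegral_rpow_enorm_lt_top two_ne_zero ENNReal.ofNat_ne_top]
  simp

/-- Weight and exponent both change by 2(n - m), so `homEnergy_add_le` compares the two levels. This
is why the choice of m in H(𝔹^d, λ) is immaterial up to equivalent norms; for λ > d, level 0 is the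
Bergman space. -/
theorem homEnergy_transfer (hd : 1 ≤ d) (lam : ℝ) {m n : ℕ} (hm : (d : ℝ) < lam + 2 * m)
    (hn : (d : ℝ) < lam + 2 * n) :
    ∃ C : ENNReal, C ≠ ⊤ ∧ ∀ f : CSpace d → ℂ,
      homEnergy f (lam + 2 * n) (2 * n) ≤ C * homEnergy f (lam + 2 * m) (2 * m) := by
  rcases le_total m n with h | h
  · obtain ⟨C, hC, hf⟩ := homEnergy_add_le hd hm (2 * m) (2 * (n - m))
    refine ⟨C, hC, fun f => ?_⟩
    have := (hf f).1
    rwa [show lam + 2 * m + ((2 * (n - m) : ℕ) : ℝ) = lam + 2 * n by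
        push_cast [Nat.cast_sub h]; ring, show 2 * m + 2 * (n - m) = 2 * n by omega] at this
  · obtain ⟨C, hC, hf⟩ := homEnergy_add_le hd hn (2 * n) (2 * (m - n))
    refine ⟨C, hC, fun f => ?_⟩
    have := (hf f).2
    rwa [show lam + 2 * n + ((2 * (m - n) : ℕ) : ℝ) = lam + 2 * m by
        push_cast [Nat.cast_sub h]; ring, show 2 * n + 2 * (m - n) = 2 * m by omega] at this

theorem memLp_iterate_of_homEnergy {f : CSpace d → ℂ} (hf : DifferentiableOn ℂ f (unitBall d))
    {s : ℝ} {n j : ℕ} (hj : j ≤ n) (h : homEnergy f s (2 * n) < ⊤) :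
    MemLp (numOp^[j] f) 2 (mu d s) := by
  rw [memLp_mu_iff (differentiableOn_numOp_iterate hf j).continuousOn]
  exact ((lintegral_iterate_le hf s j).trans (homEnergy_mono f s (by omega))).trans_lt h

/-! ### Integrability of the terms and the identity at weight λ + 2n -/

/-- With the square root of the weight absorbed into the function, functions from spaces with
different weights can be paired in the same unweighted L². -/
theorem memLp_weight {F : CSpace d → ℂ} (hF : ContinuousOn F (unitBall d)) {a : ℝ}
    (ha : (d : ℝ) < a) (h : MemLp F 2 (mu d a)) :
    MemLp (fun z => F z * (((1 - ‖z‖ ^ 2) ^ ((a - d - 1) / 2) : ℝ) : ℂ)) 2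
      (volume.restrict (unitBall d)) := by
  have hm : AEStronglyMeasurable (fun z => F z * (((1 - ‖z‖ ^ 2) ^ ((a - d - 1) / 2) : ℝ) : ℂ))
      (volume.restrict (unitBall d)) :=
    (hF.aestronglyMeasurable measurableSet_ball).mul (Measurable.aestronglyMeasurable (by fun_prop))
  rw [memLp_two_iff_integrable_sq_norm hm]
  have h1 : Integrable (fun z => ((‖F z‖ ^ 2 : ℝ) : ℂ)) (mu d a) :=
    ((memLp_two_iff_integrable_sq_norm h.aestronglyMeasurable).1 h).ofReal
  have h2 := ((integrable_mu_iff ha).1 h1).norm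
  refine h2.congr ?_
  filter_upwards [ae_restrict_mem_ball] with z hz
  have h0 := density_pos hz
  have hp : ((1 - ‖z‖ ^ 2) ^ ((a - d - 1) / 2)) ^ 2 = (1 - ‖z‖ ^ 2) ^ (a - d - 1) := by
    rw [pow_two, ← Real.rpow_add h0, add_halves]
  rw [norm_mul, norm_mul, Complex.norm_real, Complex.norm_real, Complex.norm_real, mul_pow,
    Real.norm_of_nonneg (sq_nonneg _), Real.norm_of_nonneg (Real.rpow_nonneg h0.le _),
    Real.norm_of_nonneg (Real.rpow_nonneg h0.le _), hp]

/-- Cauchy–Schwarz with unequal weights: the geometric mean of the weights of parameters a and b is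
the weight of parameter (a + b)/2. -/
theorem integrable_mu_mul {F G Φ : CSpace d → ℂ} (hF : ContinuousOn F (unitBall d))
    (hG : ContinuousOn G (unitBall d)) (hΦ : ContinuousOn Φ (unitBall d)) {M : ℝ}
    (hM : ∀ z ∈ unitBall d, ‖Φ z‖ ≤ M) {a b : ℝ} (ha : (d : ℝ) < a) (hb : (d : ℝ) < b)
    (hFa : MemLp F 2 (mu d a)) (hGb : MemLp G 2 (mu d b)) :
    Integrable (fun z => starRingEnd ℂ (F z) * (Φ z * G z)) (mu d ((a + b) / 2)) := by
  rw [integrable_mu_iff (by linarith)]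
  have h1 := (memLp_weight hF ha hFa).star.integrable_mul (memLp_weight hG hb hGb)
  have h2 := h1.bdd_mul (c := M) (hΦ.aestronglyMeasurable measurableSet_ball) (by
    filter_upwards [ae_restrict_mem_ball] with z hz using hM z hz)
  refine h2.congr ?_
  filter_upwards [ae_restrict_mem_ball] with z hz
  have hp : (1 - ‖z‖ ^ 2) ^ ((a + b) / 2 - d - 1)
      = (1 - ‖z‖ ^ 2) ^ ((a - d - 1) / 2) * (1 - ‖z‖ ^ 2) ^ ((b - d - 1) / 2) := by
    rw [← Real.rpow_add (density_pos hz)]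
    ring_nf
  rw [hp]
  simp only [Pi.mul_apply, Pi.star_apply, star_mul', RCLike.star_def, Complex.conj_ofReal]
  push_cast
  ring

section Symbol

variable {n : ℕ} {φ : CSpace d → ℂ}
  (hφ : ContDiffOn ℝ ((2 * n : ℕ) : WithTop ℕ∞) φ (unitBall d))
  (hbdd : ∀ k ≤ n, ∀ l ≤ n, ∃ M : ℝ, ∀ z ∈ unitBall d, ‖numOpBar^[k] (numOp^[l] φ) z‖ ≤ M)

include hφ

theorem continuousOn_symbol {k l : ℕ} (hk : k ≤ n) (hl : l ≤ n) :
    ContinuousOn (numOpBar^[k] (numOp^[l] φ)) (unitBall d) := by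
  rw [numOpBar_iterate_eq, numOp_iterate_eq]
  have h1 : ContDiffOn ℝ ((0 + k : ℕ) : WithTop ℕ∞) ((eulerOp (-Complex.I))^[l] φ) (unitBall d) :=
    contDiffOn_eulerOp_iterate (hφ.of_le (by norm_cast; omega))
  exact (contDiffOn_eulerOp_iterate h1).continuousOn

include hbdd

theorem integrable_term {f g : CSpace d → ℂ} (hf : DifferentiableOn ℂ f (unitBall d))
    (hg : DifferentiableOn ℂ g (unitBall d)) {a b : ℝ} (ha : (d : ℝ) < a) (hb : (d : ℝ) < b)
    {j k l m : ℕ} (hk : k ≤ n) (hl : l ≤ n) (hfj : MemLp (numOp^[j] f) 2 (mu d a))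
    (hgm : MemLp (numOp^[m] g) 2 (mu d b)) :
    Integrable (fun z => starRingEnd ℂ (numOp^[j] f z) *
      (numOpBar^[k] (numOp^[l] φ) z * numOp^[m] g z)) (mu d ((a + b) / 2)) := by
  obtain ⟨M, hM⟩ := hbdd k hk l hl
  exact integrable_mu_mul (differentiableOn_numOp_iterate hf j).continuousOn
    (differentiableOn_numOp_iterate hg m).continuousOn (continuousOn_symbol hφ hk hl) hM ha hb
    hfj hgm

theorem memLp_symbol_mul {g : CSpace d → ℂ} (hg : DifferentiableOn ℂ g (unitBall d)) {b : ℝ}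
    {k l m : ℕ} (hk : k ≤ n) (hl : l ≤ n) (hgm : MemLp (numOp^[m] g) 2 (mu d b)) :
    MemLp (fun z => numOpBar^[k] (numOp^[l] φ) z * numOp^[m] g z) 2 (mu d b) := by
  obtain ⟨M, hM⟩ := hbdd k hk l hl
  have hc := continuousOn_symbol hφ hk hl
  refine MemLp.of_le_mul (c := M) hgm (aestronglyMeasurable_mu
    (hc.mul (differentiableOn_numOp_iterate hg m).continuousOn) b) ?_
  filter_upwards [ae_mem_unitBall d b] with z hz
  rw [norm_mul]
  gcongr
  exact hM z hz

/-- After s factors with N and t with N̄, f carries at most t derivatives and is measured at λ + 2t,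
while g carries at most s and is measured at λ + 2s. The mean of the two is λ + s + t, the weight
reached at that stage. -/
theorem integral_mixed (a b : ℝ) {f g : CSpace d → ℂ} (hf : DifferentiableOn ℂ f (unitBall d))
    (hg : DifferentiableOn ℂ g (unitBall d)) {lam : ℝ} {s t : ℕ} (hs : s ≤ n) (ht : t ≤ n)
    (hls : (d : ℝ) < lam + 2 * s) (hlt : (d : ℝ) < lam + 2 * t)
    (hfj : ∀ j ≤ t, MemLp (numOp^[j] f) 2 (mu d (lam + 2 * t)))
    (hgm : ∀ m ≤ s, MemLp (numOp^[m] g) 2 (mu d (lam + 2 * s))) :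
    Integrable (shiftProd numOpBar b t (shiftProd numOp a s
        fun w => starRingEnd ℂ (f w) * φ w * g w)) (mu d (lam + s + t)) ∧
    ∫ z, shiftProd numOpBar b t (shiftProd numOp a s
        fun w => starRingEnd ℂ (f w) * φ w * g w) z ∂(mu d (lam + s + t)) =
      ∑ j ∈ Finset.range (t + 1), ∑ k ∈ Finset.range (t + 1),
        ∑ l ∈ Finset.range (s + 1), ∑ m ∈ Finset.range (s + 1), mixCoef a b s t j k l m *
          ∫ z, (starRingEnd ℂ (numOp^[j] f z) * (numOpBar^[k] (numOp^[l] φ) z * numOp^[m] g z))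
            ∂(mu d (lam + s + t)) := by
  have hφ' : ContDiffOn ℝ ((s + t : ℕ) : WithTop ℕ∞) φ (unitBall d) :=
    hφ.of_le (by norm_cast; omega)
  have hexp := ae_eq_of_eqOn (lam + s + t) (mixed_expansion a b hφ' hf hg)
  have hi : ∀ j ∈ Finset.range (t + 1), ∀ k ∈ Finset.range (t + 1), ∀ l ∈ Finset.range (s + 1),
      ∀ m ∈ Finset.range (s + 1), Integrable (fun z => mixCoef a b s t j k l m *
        (starRingEnd ℂ (numOp^[j] f z) * (numOpBar^[k] (numOp^[l] φ) z * numOp^[m] g z)))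
        (mu d (lam + s + t)) := by
    intro j hj k hk l hl m hm
    rw [Finset.mem_range] at hj hk hl hm
    have := integrable_term hφ hbdd hf hg hlt hls (k := k) (l := l) (by omega) (by omega)
      (hfj j (by omega)) (hgm m (by omega))
    rw [show (lam + 2 * t + (lam + 2 * s)) / 2 = lam + s + t by ring] at this
    exact this.const_mul _
  have i3 := fun j hj k hk l hl => integrable_finsetSum _ (hi j hj k hk l hl)
  have i2 := fun j hj k hk => integrable_finsetSum _ (i3 j hj k hk)
  have i1 := fun j hj => integrable_finsetSum _ (i2 j hj)
  refine ⟨(integrable_finsetSum _ i1).congr hexp.symm, ?_⟩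
  rw [integral_congr_ae hexp, integral_finsetSum _ i1]
  refine Finset.sum_congr rfl fun j hj => ?_
  rw [integral_finsetSum _ (i2 j hj)]
  refine Finset.sum_congr rfl fun k hk => ?_
  rw [integral_finsetSum _ (i3 j hj k hk)]
  refine Finset.sum_congr rfl fun l hl => ?_
  rw [integral_finsetSum _ (hi j hj k hk l hl)]
  refine Finset.sum_congr rfl fun m hm => ?_
  rw [integral_const_mul]

omit hbdd in
theorem contDiffOn_shiftProd_product {f g : CSpace d → ℂ} (hf : DifferentiableOn ℂ f (unitBall d))
    (hg : DifferentiableOn ℂ g (unitBall d)) :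
    ContDiffOn ℝ ((2 * n : ℕ) : WithTop ℕ∞) (fun w => starRingEnd ℂ (f w) * φ w * g w)
      (unitBall d) :=
  ((contDiffOn_conj (contDiffOn_holo hf _)).mul hφ).mul (contDiffOn_holo hg _)

/-- Raising the weight from `λ` to `λ + 2n`. -/
theorem integral_product_eq (hd : 1 ≤ d) {lam : ℝ} (hlam : (d : ℝ) < lam) {f g : CSpace d → ℂ}
    (hf : DifferentiableOn ℂ f (unitBall d)) (hg : DifferentiableOn ℂ g (unitBall d))
    (hfL : homEnergy f lam 0 < ⊤) (hgL : homEnergy g lam 0 < ⊤) :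
    ∫ z, starRingEnd ℂ (f z) * φ z * g z ∂(mu d lam)
      = ∫ z, opC lam n (fun w => starRingEnd ℂ (f w) * φ w * g w) z ∂(mu d (lam + 2 * n)) := by
  have hlev : ∀ t : ℕ, (d : ℝ) < lam + 2 * t := fun t => by
    have : (0 : ℝ) ≤ t := Nat.cast_nonneg t
    linarith
  -- Finite energy at level 0 is transferred to level t, which allows t derivatives at weight λ +
  -- 2t.
  have hmem : ∀ {h : CSpace d → ℂ}, DifferentiableOn ℂ h (unitBall d) → homEnergy h lam 0 < ⊤ →
      ∀ t j : ℕ, j ≤ t → MemLp (numOp^[j] h) 2 (mu d (lam + 2 * t)) := by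
    intro h hh hE t j hj
    obtain ⟨C, hC, hCE⟩ := homEnergy_transfer hd lam (hlev 0) (hlev t)
    refine memLp_iterate_of_homEnergy hh hj ((hCE h).trans_lt ?_)
    simpa using ENNReal.mul_lt_top hC.lt_top hE
  have hint : ∀ s ≤ n, ∀ t ≤ n, ∀ b : ℝ, Integrable (shiftProd numOpBar b t
      (shiftProd numOp lam s fun w => starRingEnd ℂ (f w) * φ w * g w)) (mu d (lam + s + t)) :=
    fun s hs t ht b => (integral_mixed hφ hbdd lam b hf hg hs ht (hlev s) (hlev t)
      (fun j hj => hmem hf hfL t j hj) (fun m hm => hmem hg hgL s m hm)).1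
  have hprod := contDiffOn_shiftProd_product hφ hf hg
  set F : CSpace d → ℂ := fun w => starRingEnd ℂ (f w) * φ w * g w with hF
  -- The factor I + N/(λ+s) is the integration by parts at weight λ + s; hence the increasing
  -- denominators in C.
  have c1 : ∀ s ≤ n, ∫ z, F z ∂(mu d lam) = ∫ z, shiftProd numOp lam s F z ∂(mu d (lam + s)) := by
    intro s
    induction s with
    | zero => intro _; simp [shiftProd]
    | succ s ih =>
      intro hs
      have hls : (d : ℝ) < lam + s := by have : (0 : ℝ) ≤ s := Nat.cast_nonneg s; linarith
      rw [ih (by omega)]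
      -- With t = 0 there is no N̄-factor, so the value 0 given to b plays no role.
      have e0 := hint s (by omega) 0 (by omega) 0
      have e1 := hint (s + 1) hs 0 (by omega) 0
      simp only [shiftProd, Nat.cast_zero, add_zero, numOp_eq', Nat.cast_succ, ← add_assoc]
        at e0 e1 ⊢
      refine integral_step ?_ _ hls e0 e1
      have := contDiffOn_shiftProd (ε := -Complex.I) lam (n := s) (k := 1)
        (hprod.of_le (by norm_cast; omega))
      simpa using this
  -- The steps from weight λ + n up to λ + 2n are made with N̄ instead.
  have c2 : ∀ t ≤ n, ∫ z, F z ∂(mu d lam) = ∫ z, shiftProd numOpBar (lam + n) t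
      (shiftProd numOp lam n F) z ∂(mu d (lam + n + t)) := by
    intro t
    induction t with
    | zero => intro _; simpa [shiftProd] using c1 n le_rfl
    | succ t ih =>
      intro ht
      have hls : (d : ℝ) < lam + n + t := by
        have : (0 : ℝ) ≤ t := Nat.cast_nonneg t
        have : (0 : ℝ) ≤ n := Nat.cast_nonneg n
        linarith
      rw [ih (by omega)]
      have e0 := hint n le_rfl t (by omega) (lam + n)
      have e1 := hint n le_rfl (t + 1) ht (lam + n)
      simp only [shiftProd, numOpBar_eq', Nat.cast_succ, ← add_assoc] at e0 e1 ⊢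
      refine integral_step ?_ _ hls e0 e1
      have h1 : ContDiffOn ℝ ((1 + t : ℕ) : WithTop ℕ∞) (shiftProd numOp lam n F) (unitBall d) := by
        rw [numOp_eq']
        exact contDiffOn_shiftProd lam (hprod.of_le (by norm_cast; omega))
      have := contDiffOn_shiftProd (ε := Complex.I) (lam + n) (n := t) (k := 1) h1
      simpa using this
  rw [c2 n le_rfl, show lam + n + n = lam + 2 * n by ring]
  rfl

/-- Absolute convergence of the form and its expansion, at a level where all the derivatives
are square integrable. -/
theorem toeplitzForm_expansion {f g : CSpace d → ℂ}
    (hf : DifferentiableOn ℂ f (unitBall d)) (hg : DifferentiableOn ℂ g (unitBall d)) {lam : ℝ}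
    (hln : (d : ℝ) < lam + 2 * n)
    (hfj : ∀ j ≤ n, MemLp (numOp^[j] f) 2 (mu d (lam + 2 * n)))
    (hgm : ∀ m ≤ n, MemLp (numOp^[m] g) 2 (mu d (lam + 2 * n))) :
    Integrable (fun z => opC lam n (fun w => starRingEnd ℂ (f w) * φ w * g w) z *
      (((1 - ‖z‖ ^ 2) ^ (lam + 2 * n) : ℝ) : ℂ)) (tau d) ∧
    toeplitzForm d lam n φ f g
      = ∫ z, opC lam n (fun w => starRingEnd ℂ (f w) * φ w * g w) z ∂(mu d (lam + 2 * n)) ∧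
    toeplitzForm d lam n φ f g =
      ∑ j ∈ Finset.range (n + 1), ∑ k ∈ Finset.range (n + 1),
        ∑ l ∈ Finset.range (n + 1), ∑ m ∈ Finset.range (n + 1),
          mixCoef lam (lam + n) n n j k l m *
          ∫ z, (starRingEnd ℂ (numOp^[j] f z) * (numOpBar^[k] (numOp^[l] φ) z * numOp^[m] g z))
            ∂(mu d (lam + 2 * n)) := by
  have h := integral_mixed hφ hbdd lam (lam + n) hf hg le_rfl le_rfl hln hln hfj hgm
  rw [show lam + n + n = lam + 2 * n by ring] at h
  have e : toeplitzForm d lam n φ f g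
      = ∫ z, opC lam n (fun w => starRingEnd ℂ (f w) * φ w * g w) z ∂(mu d (lam + 2 * n)) := by
    rw [toeplitzForm, integral_tau, integral_mu _ hln]
  refine ⟨?_, e, e.trans h.2⟩
  rw [integrable_tau_iff, ← integrable_mu_iff hln]
  exact h.1

end Symbol

/-! ### The Toeplitz operator on the Bergman space -/

theorem memLp_top_of_bounded {φ : CSpace d → ℂ} (hφ : ContinuousOn φ (unitBall d)) {M : ℝ}
    (hM : ∀ z ∈ unitBall d, ‖φ z‖ ≤ M) (s : ℝ) : MemLp φ ⊤ (mu d s) :=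
  memLp_top_of_bound (aestronglyMeasurable_mu hφ s) M ((ae_mem_unitBall d s).mono hM)

theorem L2_inner_eq {s : ℝ} {u v : Lp ℂ 2 (mu d s)} {f g : CSpace d → ℂ} (hu : u =ᵐ[mu d s] f)
    (hv : v =ᵐ[mu d s] g) : inner ℂ u v = ∫ z, starRingEnd ℂ (f z) * g z ∂(mu d s) := by
  rw [L2.inner_def]
  refine integral_congr_ae ?_
  filter_upwards [hu, hv] with z h1 h2
  rw [h1, h2, RCLike.inner_apply, mul_comm]

/-- The adjoint of the projection is the inclusion, so pairing with a holomorphic u removes the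
projection. -/
theorem inner_toeplitz {s : ℝ} {φ : CSpace d → ℂ} (hφ : MemLp φ ⊤ (mu d s)) (u v : bergman d s)
    {f g : CSpace d → ℂ} (hu : (u : Lp ℂ 2 (mu d s)) =ᵐ[mu d s] f)
    (hv : (v : Lp ℂ 2 (mu d s)) =ᵐ[mu d s] g) :
    inner ℂ u (toeplitz d s (hφ.toLp φ) v)
      = ∫ z, starRingEnd ℂ (f z) * φ z * g z ∂(mu d s) := by
  rw [toeplitz, ContinuousLinearMap.comp_apply, ← ContinuousLinearMap.adjoint_inner_left,
    Submodule.adjoint_orthogonalProjectionOnto, ContinuousLinearMap.comp_apply]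
  have h1 : (ContinuousLinearMap.mul ℂ ℂ).holderL (mu d s) ⊤ 2 2 (hφ.toLp φ)
      ((bergman d s).subtypeL v) =ᵐ[mu d s] fun z => φ z * g z := by
    have h := (ContinuousLinearMap.mul ℂ ℂ).coeFn_holder (r := 2) (hφ.toLp φ)
      (v : Lp ℂ 2 (mu d s))
    refine EventuallyEq.trans h ?_
    filter_upwards [hφ.coeFn_toLp, hv] with z h2 h3
    rw [h2, h3]
    rfl
  rw [L2_inner_eq (u := (bergman d s).subtypeL u) hu h1]
  simp only [mul_assoc]

theorem homEnergy_zero_lt_top {s : ℝ} {f : CSpace d → ℂ} (hf : DifferentiableOn ℂ f (unitBall d))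
    {u : Lp ℂ 2 (mu d s)} (hu : u =ᵐ[mu d s] f) : homEnergy f s 0 < ⊤ := by
  rw [homEnergy_zero hf, ← memLp_mu_iff hf.continuousOn]
  exact (memLp_congr_ae hu).1 (Lp.memLp u)

/-- Membership in the Bergman space is finite energy at level 0. Transferred to level n, it puts N^j
f in L²(μ_{λ+2n}) for j ≤ n, so both the weight raising and the expansion apply. -/
theorem toeplitz_bergman (hd : 1 ≤ d) {n : ℕ} {lam : ℝ} (hlam : (d : ℝ) < lam)
    {φ : CSpace d → ℂ} (hφ : ContDiffOn ℝ ((2 * n : ℕ) : WithTop ℕ∞) φ (unitBall d))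
    (hbdd : ∀ k ≤ n, ∀ l ≤ n, ∃ M : ℝ, ∀ z ∈ unitBall d, ‖numOpBar^[k] (numOp^[l] φ) z‖ ≤ M) :
    ∃ hφ' : MemLp φ ⊤ (mu d lam),
      ∀ (u v : bergman d lam) (f g : CSpace d → ℂ),
        DifferentiableOn ℂ f (unitBall d) → DifferentiableOn ℂ g (unitBall d) →
        (u : Lp ℂ 2 (mu d lam)) =ᵐ[mu d lam] f →
        (v : Lp ℂ 2 (mu d lam)) =ᵐ[mu d lam] g →
        Integrable (fun z => opC lam n (fun w => starRingEnd ℂ (f w) * φ w * g w) z *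
          (((1 - ‖z‖ ^ 2) ^ (lam + 2 * n) : ℝ) : ℂ)) (tau d) ∧
        inner ℂ u (toeplitz d lam (hφ'.toLp φ) v) = toeplitzForm d lam n φ f g ∧
        (∀ j ≤ n, MemLp (numOp^[j] f) 2 (mu d (lam + 2 * n))) ∧
        (∀ k ≤ n, ∀ l ≤ n, ∀ m ≤ n,
          MemLp (fun z => numOpBar^[k] (numOp^[l] φ) z * numOp^[m] g z) 2
            (mu d (lam + 2 * n))) ∧
        inner ℂ u (toeplitz d lam (hφ'.toLp φ) v) =
          ∑ j ∈ Finset.range (n + 1), ∑ k ∈ Finset.range (n + 1),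
            ∑ l ∈ Finset.range (n + 1), ∑ m ∈ Finset.range (n + 1),
              mixCoef lam (lam + n) n n j k l m * ∫ z, starRingEnd ℂ (numOp^[j] f z) *
                (numOpBar^[k] (numOp^[l] φ) z * numOp^[m] g z) ∂(mu d (lam + 2 * n)) := by
  obtain ⟨M, hM⟩ := hbdd 0 (Nat.zero_le n) 0 (Nat.zero_le n)
  refine ⟨memLp_top_of_bounded hφ.continuousOn hM lam, fun u v f g hf hg hu hv => ?_⟩
  have hlev : (d : ℝ) < lam + 2 * n := by
    have : (0 : ℝ) ≤ n := Nat.cast_nonneg n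
    linarith
  have hmem : ∀ {h : CSpace d → ℂ}, DifferentiableOn ℂ h (unitBall d) → homEnergy h lam 0 < ⊤ →
      ∀ j ≤ n, MemLp (numOp^[j] h) 2 (mu d (lam + 2 * n)) := by
    intro h hh hE j hj
    obtain ⟨C, hC, hCE⟩ := homEnergy_transfer hd lam (m := 0) (n := n) (by simpa using hlam) hlev
    refine memLp_iterate_of_homEnergy hh hj ((hCE h).trans_lt ?_)
    simpa using ENNReal.mul_lt_top hC.lt_top hE
  have hfE := homEnergy_zero_lt_top hf hu
  have hgE := homEnergy_zero_lt_top hg hv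
  obtain ⟨h1, h2, h3⟩ := toeplitzForm_expansion hφ hbdd hf hg hlev (hmem hf hfE) (hmem hg hgE)
  have h4 : inner ℂ u (toeplitz d lam ((memLp_top_of_bounded hφ.continuousOn hM lam).toLp φ) v)
      = toeplitzForm d lam n φ f g := by
    rw [inner_toeplitz _ u v hu hv, h2]
    exact integral_product_eq hφ hbdd hd hlam hf hg hfE hgE
  exact ⟨h1, h4, hmem hf hfE, fun k hk l hl m hm =>
    memLp_symbol_mul hφ hbdd hg hk hl (hmem hg hgE m hm), h4.trans h3⟩

/-! ### The inner product of H(𝔹^d, λ) and its energy -/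

theorem norm_toLp_sq {s : ℝ} {h : CSpace d → ℂ} (hh : MemLp h 2 (mu d s)) :
    ‖hh.toLp h‖ ^ 2 = (∫⁻ z, ‖h z‖ₑ ^ 2 ∂(mu d s)).toReal := by
  rw [Lp.norm_toLp, ← ENNReal.toReal_pow]
  congr 1
  have := eLpNorm_nnreal_pow_eq_lintegral (μ := mu d s) (f := h) (p := 2) two_ne_zero
  simpa using this

theorem IsHomMult.hasSum_norm_sq {f h : CSpace d → ℂ} {c : ℕ → ℂ} (hh : IsHomMult f h c) {s : ℝ}
    (hm : MemLp h 2 (mu d s)) :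
    HasSum (fun k => ‖c k‖ ^ 2 * (homNormSq f s k).toReal) (‖hm.toLp h‖ ^ 2) := by
  have hfin := (memLp_mu_iff hh.1.continuousOn s).1 hm
  rw [norm_toLp_sq, hh.lintegral]
  rw [hh.lintegral] at hfin
  rw [ENNReal.tsum_toReal_eq (ENNReal.ne_top_of_tsum_ne_top hfin.ne)]
  have := ENNReal.hasSum_toReal hfin.ne
  simpa using this

theorem shiftSymbol_pos {a : ℝ} (ha : 0 < a) (m k : ℕ) : 0 < shiftSymbol a m k :=
  Finset.prod_pos fun i _ => by positivity

/-- Each factor 1 + k/(a+i) lies between constant multiples of 1 + k. Together with `le_shiftSymbol`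
this says that A and B have exact order m. -/
theorem shiftSymbol_le {a : ℝ} (ha : 0 < a) (m k : ℕ) :
    shiftSymbol a m k ≤ (1 + a⁻¹) ^ m * (1 + k) ^ m := by
  rw [shiftSymbol, ← mul_pow]
  refine (Finset.prod_le_prod (g := fun _ => (1 + a⁻¹) * (1 + (k : ℝ)))
    (fun i _ => by positivity) fun i _ => ?_).trans_eq (by simp)
  have h1 : (k : ℝ) / (a + i) ≤ k / a := by gcongr; simp
  have h2 : (k : ℝ) / a = a⁻¹ * k := by field_simp
  have h3 : 0 < a⁻¹ := by positivity
  have h4 : (0 : ℝ) ≤ k := Nat.cast_nonneg k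
  nlinarith

theorem le_shiftSymbol {a : ℝ} (ha : 0 < a) (m k : ℕ) :
    (1 + k : ℝ) ^ m ≤ (1 + a + m) ^ m * shiftSymbol a m k := by
  have h : ∏ _i ∈ Finset.range m, (1 + k : ℝ)
      ≤ ∏ i ∈ Finset.range m, (1 + a + m) * (1 + k / (a + i)) := by
    refine Finset.prod_le_prod (fun _ _ => by positivity) fun i hi => ?_
    have hi' : (i : ℝ) ≤ m := by exact_mod_cast (Finset.mem_range.1 hi).le
    have h0 : 0 < a + i := by positivity
    have h1 : (k : ℝ) ≤ (1 + a + m) * (k / (a + i)) := by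
      rw [← mul_div_assoc, le_div_iff₀ h0]
      have : (0 : ℝ) ≤ k := Nat.cast_nonneg k
      nlinarith
    have : (0 : ℝ) ≤ m := Nat.cast_nonneg m
    linarith
  rw [Finset.prod_mul_distrib] at h
  simpa [shiftSymbol] using h

theorem IsHomMult.memLp {f h : CSpace d → ℂ} {c : ℕ → ℂ} (hh : IsHomMult f h c) {s : ℝ} {m : ℕ}
    (hE : homEnergy f s (2 * m) < ⊤) {C : ℝ} (hc : ∀ k : ℕ, ‖c k‖ ≤ C * (1 + k) ^ m) :
    MemLp h 2 (mu d s) := by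
  rw [memLp_mu_iff hh.1.continuousOn, hh.lintegral]
  refine lt_of_le_of_lt ?_ (ENNReal.mul_lt_top (a := ENNReal.ofReal C ^ 2)
    (ENNReal.pow_lt_top ENNReal.ofReal_lt_top) hE)
  rw [homEnergy, ← ENNReal.tsum_mul_left]
  refine ENNReal.tsum_le_tsum fun k => ?_
  have h1 : ‖c k‖ₑ ≤ ENNReal.ofReal C * (1 + (k : ENNReal)) ^ m := by
    rw [← ofReal_norm, one_add_natCast_ennreal, ← ENNReal.ofReal_pow (by positivity),
      ← ENNReal.ofReal_mul' (by positivity)]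
    exact ENNReal.ofReal_le_ofReal (hc k)
  calc ‖c k‖ₑ ^ 2 * homNormSq f s k
      ≤ (ENNReal.ofReal C * (1 + (k : ENNReal)) ^ m) ^ 2 * homNormSq f s k := by gcongr
    _ = _ := by ring

/-- Polarisation of the norm identity for the multipliers a + cb with c = ±1, ±i. Since a and b are
real, |a + ib| = |a - ib|, so the imaginary part cancels. -/
theorem hasSum_inner_of_isHomMult {f u v : CSpace d → ℂ} {a b : ℕ → ℝ}
    (hu : IsHomMult f u fun k => (a k : ℂ)) (hv : IsHomMult f v fun k => (b k : ℂ)) {s : ℝ}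
    (hmu : MemLp u 2 (mu d s)) (hmv : MemLp v 2 (mu d s)) :
    ∃ R : ℝ, HasSum (fun k => a k * b k * (homNormSq f s k).toReal) R ∧
      inner ℂ (hmu.toLp u) (hmv.toLp v) = (R : ℂ) := by
  set x := hmu.toLp u with hx
  set y := hmv.toLp v with hy
  have key : ∀ c : ℂ, HasSum (fun k => ‖(a k : ℂ) + c * b k‖ ^ 2 * (homNormSq f s k).toReal)
      (‖x + c • y‖ ^ 2) := fun c =>
    (hu.add (hv.const_smul c)).hasSum_norm_sq (hmu.add (hmv.const_smul c))
  have hI : ‖x + (-Complex.I) • y‖ ^ 2 = ‖x + Complex.I • y‖ ^ 2 := by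
    refine (key _).unique ?_
    have e : ∀ k, ‖(a k : ℂ) + -Complex.I * b k‖ ^ 2 = ‖(a k : ℂ) + Complex.I * b k‖ ^ 2 := by
      intro k
      rw [Complex.sq_norm, Complex.sq_norm, Complex.normSq_apply, Complex.normSq_apply]
      simp
    simp only [e]
    exact key Complex.I
  refine ⟨(‖x + (1 : ℂ) • y‖ ^ 2 - ‖x + (-1 : ℂ) • y‖ ^ 2) / 4, ?_, ?_⟩
  · have h := ((key 1).sub (key (-1))).div_const 4
    refine h.congr_fun fun k => ?_
    have e1 : (a k : ℂ) + 1 * b k = ((a k + b k : ℝ) : ℂ) := by push_cast; ring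
    have e2 : (a k : ℂ) + -1 * b k = ((a k - b k : ℝ) : ℂ) := by push_cast; ring
    rw [e1, e2, Complex.norm_real, Complex.norm_real, Real.norm_eq_abs, Real.norm_eq_abs, sq_abs,
      sq_abs]
    ring
  · rw [inner_eq_sum_norm_sq_div_four]
    have e1 : x + y = x + (1 : ℂ) • y := by rw [one_smul]
    have e2 : x - y = x + (-1 : ℂ) • y := by rw [neg_one_smul, sub_eq_add_neg]
    have e3 : x - (RCLike.I : ℂ) • y = x + (-Complex.I) • y := by
      rw [neg_smul, ← sub_eq_add_neg]; rfl
    have e4 : x + (RCLike.I : ℂ) • y = x + Complex.I • y := rfl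
    have hI' : ((‖x + (-Complex.I) • y‖ : ℝ) : ℂ) ^ 2 = ((‖x + Complex.I • y‖ : ℝ) : ℂ) ^ 2 := by
      exact_mod_cast hI
    rw [e1, e2, e3, e4]
    simp only [Complex.coe_algebraMap] at *
    rw [hI']
    push_cast
    ring

theorem eqOn_shiftProd_numOp {f : CSpace d → ℂ} (hf : DifferentiableOn ℂ f (unitBall d)) (a : ℝ)
    (m : ℕ) : Set.EqOn (shiftProd numOp a m f)
      (fun z => ∑ i ∈ Finset.range (m + 1), shiftCoef a m i * numOp^[i] f z) (unitBall d) := by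
  rw [numOp_eq']
  exact eulerOp_shift_sum a (contDiffOn_holo hf m)

theorem shiftProd_numOp_add {f g : CSpace d → ℂ} (hf : DifferentiableOn ℂ f (unitBall d))
    (hg : DifferentiableOn ℂ g (unitBall d)) (a : ℝ) (m : ℕ) :
    Set.EqOn (shiftProd numOp a m (f + g)) (shiftProd numOp a m f + shiftProd numOp a m g)
      (unitBall d) := by
  intro z hz
  rw [Pi.add_apply, eqOn_shiftProd_numOp hf a m hz, eqOn_shiftProd_numOp hg a m hz,
    eqOn_shiftProd_numOp (hf.add hg) a m hz]
  simp only
  rw [← Finset.sum_add_distrib]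
  refine Finset.sum_congr rfl fun i _ => ?_
  rw [numOp_iterate_add hf hg i hz, Pi.add_apply, mul_add]

theorem shiftProd_numOp_smul {f : CSpace d → ℂ} (hf : DifferentiableOn ℂ f (unitBall d)) (c : ℂ)
    (a : ℝ) (m : ℕ) :
    Set.EqOn (shiftProd numOp a m (c • f)) (c • shiftProd numOp a m f) (unitBall d) := by
  intro z hz
  rw [Pi.smul_apply, eqOn_shiftProd_numOp hf a m hz, eqOn_shiftProd_numOp (hf.const_smul c) a m hz,
    smul_eq_mul, Finset.mul_sum]
  refine Finset.sum_congr rfl fun i _ => ?_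
  rw [numOp_iterate_smul hf c i hz, Pi.smul_apply, smul_eq_mul]
  ring

/-- The linear map from `H(𝔹^d, λ)` to `L²(μ_s)` induced by an operator which is linear on
holomorphic functions. -/
def sobLin (lam : ℝ) (m : ℕ) (s : ℝ) (D : (CSpace d → ℂ) → CSpace d → ℂ)
    (hadd : ∀ f g : CSpace d → ℂ, DifferentiableOn ℂ f (unitBall d) →
      DifferentiableOn ℂ g (unitBall d) → Set.EqOn (D (f + g)) (D f + D g) (unitBall d))
    (hsmul : ∀ (c : ℂ) (f : CSpace d → ℂ), DifferentiableOn ℂ f (unitBall d) →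
      Set.EqOn (D (c • f)) (c • D f) (unitBall d))
    (hmem : ∀ f : sobolev d lam m, MemLp (D f) 2 (mu d s)) :
    sobolev d lam m →ₗ[ℂ] Lp ℂ 2 (mu d s) where
  toFun f := (hmem f).toLp (D f)
  map_add' f g := by
    rw [← MemLp.toLp_add, MemLp.toLp_eq_toLp_iff]
    exact ae_eq_of_eqOn s (hadd f g f.2.1 g.2.1)
  map_smul' c f := by
    rw [RingHom.id_apply, ← MemLp.toLp_const_smul, MemLp.toLp_eq_toLp_iff]
    exact ae_eq_of_eqOn s (hsmul c f f.2.1)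

theorem sobolev_homEnergy_lt_top {lam : ℝ} {m : ℕ} (f : sobolev d lam m) :
    homEnergy (f : CSpace d → ℂ) (lam + 2 * m) (2 * m) < ⊤ := by
  refine (homEnergy_le_lintegral f.2.1 _ m).trans_lt (ENNReal.mul_lt_top (by simp) ?_)
  refine ENNReal.add_lt_top.2 ⟨?_, ?_⟩
  · exact (memLp_mu_iff f.2.1.continuousOn _).1 (f.2.2.2 0 (Nat.zero_le m))
  · exact (memLp_mu_iff (differentiableOn_numOp_iterate f.2.1 m).continuousOn _).1
      (f.2.2.2 m le_rfl)

theorem norm_shiftSymbol_le {a : ℝ} (ha : 0 < a) (m k : ℕ) :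
    ‖(shiftSymbol a m k : ℂ)‖ ≤ (1 + a⁻¹) ^ m * (1 + k) ^ m := by
  rw [Complex.norm_real, Real.norm_of_nonneg (shiftSymbol_pos ha m k).le]
  exact shiftSymbol_le ha m k

theorem memLp_shiftProd {lam : ℝ} {m : ℕ} (f : sobolev d lam m) {a : ℝ} (ha : 0 < a) :
    MemLp (shiftProd numOp a m f) 2 (mu d (lam + 2 * m)) :=
  (isHomMult_shiftProd f.2.1 a m).memLp (sobolev_homEnergy_lt_top f)
    (norm_shiftSymbol_le ha m)

/-- `f ↦ ∏_{i<m} (I + N/(a+i)) f` as a linear map into `L²(μ_{λ+2m})`. -/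
def sobShift (d : ℕ) (lam : ℝ) (m : ℕ) {a : ℝ} (ha : 0 < a) :
    sobolev d lam m →ₗ[ℂ] Lp ℂ 2 (mu d (lam + 2 * m)) :=
  sobLin lam m _ (shiftProd numOp a m) (fun _ _ hf hg => shiftProd_numOp_add hf hg a m)
    (fun c _ hf => shiftProd_numOp_smul hf c a m) fun f => memLp_shiftProd f ha

theorem sobInner_eq_inner {lam : ℝ} (hlam : 0 < lam) {m : ℕ} (hlm : 0 < lam + m)
    (f g : sobolev d lam m) :
    sobInner d lam m f g = inner ℂ (sobShift d lam m hlm f) (sobShift d lam m hlam g) :=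
  (L2_inner_eq (memLp_shiftProd f hlm).coeFn_toLp (memLp_shiftProd g hlam).coeFn_toLp).symm

/-- The real number `∑ₖ (1+k)^{2m} ‖f_k‖²_{L²(μ_{λ+2m})}`. -/
def sobEnergy (lam : ℝ) (m : ℕ) (f : CSpace d → ℂ) : ℝ :=
  (homEnergy f (lam + 2 * m) (2 * m)).toReal

theorem hasSum_sobEnergy {lam : ℝ} {m : ℕ} (f : sobolev d lam m) :
    HasSum (fun k : ℕ => (1 + k : ℝ) ^ (2 * m) *
        (homNormSq (f : CSpace d → ℂ) (lam + 2 * m) k).toReal)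
      (sobEnergy lam m (f : CSpace d → ℂ)) := by
  have hfin := (sobolev_homEnergy_lt_top f).ne
  rw [homEnergy] at hfin
  have := ENNReal.hasSum_toReal hfin
  rw [← ENNReal.tsum_toReal_eq (ENNReal.ne_top_of_tsum_ne_top hfin)] at this
  rw [sobEnergy, homEnergy]
  convert this using 2 with k
  rw [ENNReal.toReal_mul, ENNReal.toReal_pow, one_add_natCast_ennreal,
    ENNReal.toReal_ofReal (by positivity)]

/-- By `hasSum_inner_of_isHomMult`, ⟨f, f⟩ is the sum of ‖f_k‖² times the symbols of A and B, both
positive and comparable with (1+k)^m. Reality and positivity thus survive although A and B differ.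
-/
theorem sobInner_self (d : ℕ) {lam : ℝ} (hlam : 0 < lam) (m : ℕ) :
    ∃ C : ℝ, 0 < C ∧ ∀ f : sobolev d lam m, (sobInner d lam m f f).im = 0 ∧
      sobEnergy lam m (f : CSpace d → ℂ) ≤ C * (sobInner d lam m f f).re ∧
      (sobInner d lam m f f).re ≤ C * sobEnergy lam m (f : CSpace d → ℂ) := by
  have hlm : 0 < lam + m := by positivity
  -- Products of the constants in `le_shiftSymbol` (C₁) and in `shiftSymbol_le` (C₂), taken at a = λ
  -- + m and a = λ.
  set C₁ : ℝ := (1 + (lam + m) + m) ^ m * (1 + lam + m) ^ m with hC₁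
  set C₂ : ℝ := (1 + (lam + m)⁻¹) ^ m * (1 + lam⁻¹) ^ m with hC₂
  have h1 : 0 < C₁ := by positivity
  have h2 : 0 < C₂ := by positivity
  refine ⟨C₁ + C₂, by positivity, fun f => ?_⟩
  obtain ⟨R, hR, hin⟩ := hasSum_inner_of_isHomMult (isHomMult_shiftProd f.2.1 (lam + m) m)
    (isHomMult_shiftProd f.2.1 lam m) (memLp_shiftProd f hlm) (memLp_shiftProd f hlam)
  have hE := hasSum_sobEnergy f
  have e : sobInner d lam m f f = (R : ℂ) := (sobInner_eq_inner hlam hlm f f).trans hin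
  have hp : ∀ k : ℕ, 0 < shiftSymbol (lam + m) m k * shiftSymbol lam m k := fun k =>
    mul_pos (shiftSymbol_pos hlm m k) (shiftSymbol_pos hlam m k)
  have hX : ∀ k, 0 ≤ (homNormSq (f : CSpace d → ℂ) (lam + 2 * m) k).toReal := fun k =>
    ENNReal.toReal_nonneg
  have hR0 : 0 ≤ R := hR.nonneg fun k => mul_nonneg (hp k).le (hX k)
  have hE0 : 0 ≤ sobEnergy lam m (f : CSpace d → ℂ) := ENNReal.toReal_nonneg
  have b1 : sobEnergy lam m (f : CSpace d → ℂ) ≤ C₁ * R := by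
    refine hasSum_le (fun k => ?_) hE (hR.mul_left C₁)
    rw [← mul_assoc]
    refine mul_le_mul_of_nonneg_right ?_ (hX k)
    have := mul_le_mul (le_shiftSymbol hlm m k) (le_shiftSymbol hlam m k) (by positivity)
      (mul_nonneg (by positivity) (shiftSymbol_pos hlm m k).le)
    calc (1 + k : ℝ) ^ (2 * m) = (1 + k) ^ m * (1 + k) ^ m := by ring
      _ ≤ _ := this
      _ = _ := by rw [hC₁]; ring
  have b2 : R ≤ C₂ * sobEnergy lam m (f : CSpace d → ℂ) := by
    refine hasSum_le (fun k => ?_) hR (hE.mul_left C₂)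
    rw [← mul_assoc]
    refine mul_le_mul_of_nonneg_right ?_ (hX k)
    have := mul_le_mul (shiftSymbol_le hlm m k) (shiftSymbol_le hlam m k)
      (shiftSymbol_pos hlam m k).le (by positivity)
    calc _ ≤ _ := this
      _ = _ := by rw [hC₂]; ring
  rw [e]
  refine ⟨Complex.ofReal_im R, ?_, ?_⟩
  · rw [Complex.ofReal_re]; nlinarith
  · rw [Complex.ofReal_re]; nlinarith

theorem sobInner_re_nonneg {lam : ℝ} (hlam : 0 < lam) {m : ℕ} (f : sobolev d lam m) :
    0 ≤ (sobInner d lam m f f).re := by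
  obtain ⟨C, hC, h⟩ := sobInner_self d hlam m
  have h0 : 0 ≤ sobEnergy lam m (f : CSpace d → ℂ) := ENNReal.toReal_nonneg
  exact nonneg_of_mul_nonneg_right (h0.trans (h f).2.1) hC

/-- The maps `f ↦ N^j f`, `j ≤ n`, are bounded from `H(𝔹^d, λ)` to `L²(μ_{λ+2n})`. -/
theorem exists_iterate_maps (hd : 1 ≤ d) {lam : ℝ} (hlam : 0 < lam) {m n : ℕ}
    (hm : (d : ℝ) < lam + 2 * m) (hn : (d : ℝ) < lam + 2 * n) :
    ∃ (D : ℕ → sobolev d lam m →ₗ[ℂ] Lp ℂ 2 (mu d (lam + 2 * n))) (C : ℝ), 0 ≤ C ∧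
      (∀ j ≤ n, ∀ f : sobolev d lam m,
        D j f =ᵐ[mu d (lam + 2 * n)] numOp^[j] (f : CSpace d → ℂ)) ∧
      ∀ j f, ‖D j f‖ ≤ C * sobNorm d lam m f := by
  obtain ⟨C₁, hC₁, hE⟩ := homEnergy_transfer hd lam hm hn
  obtain ⟨C₂, hC₂, hS⟩ := sobInner_self d hlam m
  have hmem : ∀ j ≤ n, ∀ f : sobolev d lam m,
      MemLp (numOp^[j] (f : CSpace d → ℂ)) 2 (mu d (lam + 2 * n)) := fun j hj f =>
    memLp_iterate_of_homEnergy f.2.1 hj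
      ((hE _).trans_lt (ENNReal.mul_lt_top hC₁.lt_top (sobolev_homEnergy_lt_top f)))
  -- For j > n the map is 0, so that the norm bound holds for all j without a side condition.
  refine ⟨fun j => if hj : j ≤ n then sobLin lam m _ (numOp^[j])
    (fun _ _ hf hg => numOp_iterate_add hf hg j) (fun c _ hf => numOp_iterate_smul hf c j)
    (hmem j hj) else 0, √(C₁.toReal * C₂), Real.sqrt_nonneg _, fun j hj f => ?_, fun j f => ?_⟩
  · simp only [dif_pos hj]
    exact (hmem j hj f).coeFn_toLp
  · rw [sobNorm, ← Real.sqrt_mul (by positivity)]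
    refine Real.le_sqrt_of_sq_le ?_
    have h0 := sobInner_re_nonneg hlam f
    by_cases hj : j ≤ n
    · simp only [dif_pos hj]
      have h1 : ‖(hmem j hj f).toLp _‖ ^ 2
          ≤ (C₁ * homEnergy (f : CSpace d → ℂ) (lam + 2 * m) (2 * m)).toReal := by
        rw [norm_toLp_sq]
        refine ENNReal.toReal_mono
          (ENNReal.mul_ne_top hC₁ (sobolev_homEnergy_lt_top f).ne) ?_
        exact (lintegral_iterate_le f.2.1 _ j).trans
          ((homEnergy_mono _ _ (by omega)).trans (hE _))
      refine h1.trans ?_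
      rw [ENNReal.toReal_mul, mul_assoc]
      exact mul_le_mul_of_nonneg_left (hS f).2.1 ENNReal.toReal_nonneg
    · simp only [dif_neg hj, LinearMap.zero_apply, norm_zero]
      rw [zero_pow two_ne_zero]
      positivity

/-! ### Definiteness, symmetry and completeness of H(𝔹^d, λ) -/

/-- Convergence in `L²(μ_s)` of holomorphic functions implies pointwise convergence of the
functions and of their images under `N`. -/
theorem tendsto_holo_of_tendsto_Lp {s : ℝ} (hs : (d : ℝ) < s) {f : ℕ → CSpace d → ℂ}
    {h : CSpace d → ℂ} {u : ℕ → Lp ℂ 2 (mu d s)} {v : Lp ℂ 2 (mu d s)}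
    (hf : ∀ p, DifferentiableOn ℂ (f p) (unitBall d)) (hh : DifferentiableOn ℂ h (unitBall d))
    (hu : ∀ p, u p =ᵐ[mu d s] f p) (hv : v =ᵐ[mu d s] h) (huv : Tendsto u atTop (𝓝 v))
    {z : CSpace d} (hz : z ∈ unitBall d) :
    Tendsto (fun p => f p z) atTop (𝓝 (h z)) ∧
      Tendsto (fun p => numOp (f p) z) atTop (𝓝 (numOp h z)) := by
  obtain ⟨r, hr, C, hC, hrb, hbd⟩ := exists_pointwise_bound (normConst_pos hs) hz
  have hb : ∀ p, ∀ w ∈ Metric.ball z r, ‖f p w - h w‖ ≤ C * ‖u p - v‖ := fun p w hw =>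
    hbd (f p - h) (u p - v) ((hf p).sub hh) (by
      filter_upwards [Lp.coeFn_sub (u p) v, hu p, hv] with x h1 h2 h3
      rw [h1, Pi.sub_apply, h2, h3, Pi.sub_apply]) w hw
  have hlim : Tendsto (fun p => ‖u p - v‖) atTop (𝓝 0) :=
    tendsto_iff_norm_sub_tendsto_zero.1 huv
  have hzm := Metric.mem_ball_self (x := z) hr
  refine ⟨?_, ?_⟩
  · refine tendsto_iff_norm_sub_tendsto_zero.2 (squeeze_zero (fun _ => norm_nonneg _)
      (fun p => hb p z hzm) ?_)
    simpa using hlim.const_mul C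
  · have hn : ∀ p, ‖numOp (f p) z - numOp h z‖ ≤ (2 * C / r * ‖z‖) * ‖u p - v‖ := by
      intro p
      have d1 := (hf p).differentiableAt (isOpen_unitBall.mem_nhds hz)
      have d2 := hh.differentiableAt (isOpen_unitBall.mem_nhds hz)
      rw [numOp_holo d1, numOp_holo d2, ← sub_apply, ← fderiv_sub d1 d2]
      -- Cauchy's estimate on the ball of radius r, where the difference deviates from its value at
      -- the centre by at most 2C‖u p - v‖.
      have hfd : ‖fderiv ℂ (f p - h) z‖ ≤ (2 * (C * ‖u p - v‖)) / r := by
        refine Complex.norm_fderiv_le_div_of_mapsTo_ball (((hf p).sub hh).mono hrb) ?_ hr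
        intro w hw
        rw [Metric.mem_closedBall, dist_eq_norm]
        have h1 := hb p w hw
        have h2 := hb p z hzm
        have h3 := norm_sub_le (f p w - h w) (f p z - h z)
        simp only [Pi.sub_apply]
        linarith
      calc _ ≤ ‖fderiv ℂ (f p - h) z‖ * ‖z‖ := ContinuousLinearMap.le_opNorm _ _
        _ ≤ (2 * (C * ‖u p - v‖)) / r * ‖z‖ := by gcongr
        _ = _ := by ring
    refine tendsto_iff_norm_sub_tendsto_zero.2 (squeeze_zero (fun _ => norm_nonneg _) hn ?_)
    simpa using hlim.const_mul (2 * C / r * ‖z‖)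

/-- A null vector vanishes in L²(μ_{λ+2m}), hence on the ball by the pointwise bound; outside the
ball elements are zero by convention. -/
theorem sobolev_eq_zero (hd : 1 ≤ d) {lam : ℝ} (hlam : 0 < lam) {m : ℕ}
    (hm : (d : ℝ) < lam + 2 * m) {f : sobolev d lam m} (h : (sobInner d lam m f f).re = 0) :
    f = 0 := by
  obtain ⟨D, C, _, hD, hC⟩ := exists_iterate_maps hd hlam hm hm
  have h0 : D 0 f = 0 := by
    have := hC 0 f
    rw [sobNorm, h, Real.sqrt_zero, mul_zero] at this
    exact norm_le_zero_iff.1 this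
  ext z
  by_cases hz : z ∈ unitBall d
  · obtain ⟨r, hr, C', _, _, hbd⟩ := exists_pointwise_bound (normConst_pos hm) hz
    have h1 := hbd f (D 0 f) f.2.1 (hD 0 (Nat.zero_le m) f) z (Metric.mem_ball_self hr)
    rw [h0, norm_zero, mul_zero] at h1
    exact norm_le_zero_iff.1 h1
  · exact f.2.2.1 z hz

/-- Symmetry is not visible in ⟨Af, Bg⟩ when A and B differ. It follows by polarisation from the
reality of ⟨h, h⟩ for h = f + g and h = f + ig. -/
theorem sobInner_conj_symm {lam : ℝ} (hlam : 0 < lam) {m : ℕ} (f g : sobolev d lam m) :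
    starRingEnd ℂ (sobInner d lam m g f) = sobInner d lam m f g := by
  have hlm : 0 < lam + m := by positivity
  obtain ⟨_, _, hS⟩ := sobInner_self d hlam m
  have e := fun x y : sobolev d lam m => sobInner_eq_inner hlam hlm x y
  have h1 := (hS (f + g)).1
  have h2 := (hS (f + Complex.I • g)).1
  have h3 := (hS f).1
  have h4 := (hS g).1
  rw [e] at h1 h2 h3 h4
  simp only [map_add, map_smul, inner_add_left, inner_add_right, inner_smul_left,
    inner_smul_right, Complex.add_im, h3, h4, Complex.conj_I, Complex.mul_im, Complex.mul_re,
    Complex.add_re, Complex.neg_re, Complex.neg_im, Complex.I_re, Complex.I_im] at h1 h2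
  rw [e, e]
  refine Complex.ext ?_ ?_
  · rw [Complex.conj_re]; linarith
  · rw [Complex.conj_im]; linarith

/-- The inner product space structure of `H(𝔹^d, λ)`. -/
@[reducible]
def sobCore (hd : 1 ≤ d) {lam : ℝ} (hlam : 0 < lam) {m : ℕ} (hm : (d : ℝ) < lam + 2 * m) :
    InnerProductSpace.Core ℂ (sobolev d lam m) where
  inner f g := sobInner d lam m f g
  conj_inner_symm f g := sobInner_conj_symm hlam f g
  re_inner_nonneg f := sobInner_re_nonneg hlam f
  add_left f g h := by
    have hlm : 0 < lam + m := by positivity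
    have e := fun x y : sobolev d lam m => sobInner_eq_inner hlam hlm x y
    rw [e, e, e, map_add, inner_add_left]
  smul_left f g c := by
    have hlm : 0 < lam + m := by positivity
    have e := fun x y : sobolev d lam m => sobInner_eq_inner hlam hlm x y
    rw [e, e, map_smul, inner_smul_left]
  definite f hf := sobolev_eq_zero hd hlam hm (by rw [hf, Complex.zero_re])

theorem sobEnergy_le_of_ae {lam : ℝ} {m : ℕ} (f : sobolev d lam m)
    {u v : Lp ℂ 2 (mu d (lam + 2 * m))} (hu : u =ᵐ[mu d (lam + 2 * m)] (f : CSpace d → ℂ))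
    (hv : v =ᵐ[mu d (lam + 2 * m)] numOp^[m] (f : CSpace d → ℂ)) :
    sobEnergy lam m (f : CSpace d → ℂ) ≤ 4 ^ m * (‖u‖ ^ 2 + ‖v‖ ^ 2) := by
  have m0 : MemLp (f : CSpace d → ℂ) 2 (mu d (lam + 2 * m)) := f.2.2.2 0 (Nat.zero_le m)
  have m1 := f.2.2.2 m le_rfl
  have e0 : u = m0.toLp _ := Lp.ext (hu.trans m0.coeFn_toLp.symm)
  have e1 : v = m1.toLp _ := Lp.ext (hv.trans m1.coeFn_toLp.symm)
  have f0 := ((memLp_mu_iff f.2.1.continuousOn _).1 m0).ne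
  have f1 := ((memLp_mu_iff (differentiableOn_numOp_iterate f.2.1 m).continuousOn _).1 m1).ne
  rw [e0, e1, norm_toLp_sq, norm_toLp_sq, ← ENNReal.toReal_add f0 f1]
  have h := ENNReal.toReal_mono (ENNReal.mul_ne_top (by simp) (ENNReal.add_ne_top.2 ⟨f0, f1⟩))
    (homEnergy_le_lintegral f.2.1 (lam + 2 * m) m)
  simpa only [sobEnergy, ENNReal.toReal_mul, ENNReal.toReal_pow, ENNReal.toReal_ofNat] using h

/-- `H(𝔹^d, λ)` is complete. -/
theorem sobolev_complete (hd : 1 ≤ d) {lam : ℝ} (hlam : 0 < lam) {m : ℕ}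
    (hm : (d : ℝ) < lam + 2 * m) (x : ℕ → sobolev d lam m)
    (hx : ∀ ε > 0, ∃ N, ∀ p ≥ N, ∀ q ≥ N, sobNorm d lam m (x p - x q : sobolev d lam m) < ε) :
    ∃ y : sobolev d lam m,
      Tendsto (fun p => sobNorm d lam m (x p - y : sobolev d lam m)) atTop (𝓝 0) := by
  obtain ⟨D, C, hC0, hD, hC⟩ := exists_iterate_maps hd hlam hm hm
  have hcau : ∀ j, CauchySeq fun p => D j (x p) := by
    intro j
    refine Metric.cauchySeq_iff.2 fun ε hε => ?_
    obtain ⟨N, hN⟩ := hx (ε / (C + 1)) (by positivity)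
    refine ⟨N, fun p hp q hq => ?_⟩
    have h1 := hN p hp q hq
    rw [lt_div_iff₀' (by positivity)] at h1
    rw [dist_eq_norm, ← map_sub]
    have h2 : 0 ≤ sobNorm d lam m (x p - x q : sobolev d lam m) := Real.sqrt_nonneg _
    linarith [hC j (x p - x q)]
  have hlim : ∀ j, ∃ (v : Lp ℂ 2 (mu d (lam + 2 * m))) (h : CSpace d → ℂ),
      Tendsto (fun p => D j (x p)) atTop (𝓝 v) ∧ (j ≤ m → DifferentiableOn ℂ h (unitBall d) ∧
        v =ᵐ[mu d (lam + 2 * m)] h) := by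
    intro j
    obtain ⟨v, hv⟩ := cauchySeq_tendsto_of_complete (hcau j)
    by_cases hj : j ≤ m
    -- The holomorphic subspace is closed in L², so the limit of N^j x_p has a holomorphic
    -- representative.
    · have : v ∈ bergman d (lam + 2 * m) := (isClosed_bergman d _).mem_of_tendsto hv
        (Eventually.of_forall fun p => ⟨_, differentiableOn_numOp_iterate (x p).2.1 j,
          hD j hj (x p)⟩)
      obtain ⟨h, hh, hvh⟩ := this
      exact ⟨v, h, hv, fun _ => ⟨hh, hvh⟩⟩
    · exact ⟨v, 0, hv, fun h => absurd h hj⟩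
  choose v h hv hh using hlim
  have hpt := fun j (hj : j ≤ m) z (hz : z ∈ unitBall d) => tendsto_holo_of_tendsto_Lp hm
    (fun p => differentiableOn_numOp_iterate (x p).2.1 j) (hh j hj).1 (fun p => hD j hj (x p))
    (hh j hj).2 (hv j) hz
  set f : CSpace d → ℂ := (unitBall d).indicator (h 0) with hf
  have hf0 : Set.EqOn f (h 0) (unitBall d) := fun z hz => Set.indicator_of_mem hz _
  -- Closedness of N: x_p-derivatives of orders j and j + 1 converge pointwise on the ball, and
  -- convergence at order j already forces the limit at order j + 1 to be N of the limit.
  have hit : ∀ j ≤ m, Set.EqOn (numOp^[j] f) (h j) (unitBall d) := by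
    intro j
    induction j with
    | zero => exact fun _ => hf0
    | succ j ih =>
      intro hj z hz
      rw [Function.iterate_succ_apply', numOp_congr (ih (by omega)) hz]
      have h1 := (hpt j (by omega) z hz).2
      have h2 := (hpt (j + 1) hj z hz).1
      simp only [Function.iterate_succ_apply'] at h2
      exact tendsto_nhds_unique h1 h2
  have hae : ∀ j ≤ m, v j =ᵐ[mu d (lam + 2 * m)] numOp^[j] f := fun j hj =>
    (hh j hj).2.trans (ae_eq_of_eqOn _ (hit j hj)).symm
  let y : sobolev d lam m := ⟨f, ((hh 0 (Nat.zero_le m)).1.congr hf0),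
    fun z hz => Set.indicator_of_notMem hz _,
    fun j hj => (memLp_congr_ae (hae j hj)).1 (Lp.memLp _)⟩
  have hy : ∀ j ≤ m, D j y = v j := fun j hj => Lp.ext ((hD j hj y).trans (hae j hj).symm)
  refine ⟨y, ?_⟩
  obtain ⟨K, hK, hS⟩ := sobInner_self d hlam m
  -- Orders 0 and m suffice, since they control the whole energy.
  have hle : ∀ p, sobNorm d lam m (x p - y : sobolev d lam m) ≤
      √(K * (4 ^ m * (‖D 0 (x p) - v 0‖ ^ 2 + ‖D m (x p) - v m‖ ^ 2))) := by
    intro p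
    refine Real.sqrt_le_sqrt ((hS _).2.2.trans (mul_le_mul_of_nonneg_left ?_ hK.le))
    rw [← hy 0 (Nat.zero_le m), ← hy m le_rfl, ← map_sub, ← map_sub]
    exact sobEnergy_le_of_ae _ (hD 0 (Nat.zero_le m) _) (hD m le_rfl _)
  refine squeeze_zero (fun _ => Real.sqrt_nonneg _) hle ?_
  have l0 := tendsto_iff_norm_sub_tendsto_zero.1 (hv 0)
  have l1 := tendsto_iff_norm_sub_tendsto_zero.1 (hv m)
  have := ((((l0.pow 2).add (l1.pow 2)).const_mul ((4 : ℝ) ^ m)).const_mul K).sqrt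
  simpa using this

/-! ### The operator defined by the Toeplitz form -/

/-- By Riesz, S(x, y) = ⟨Bx, y⟩ with B bounded, and T is the adjoint of B. The hypotheses are
phrased through √re⟨x, x⟩, which is by definition the norm attached to the core. -/
theorem exists_operator_of_form {V : Type*} [AddCommGroup V] [Module ℂ V]
    (c : InnerProductSpace.Core ℂ V)
    (hcomp : ∀ x : ℕ → V,
      (∀ ε > 0, ∃ N, ∀ p ≥ N, ∀ q ≥ N, √(c.inner (x p - x q) (x p - x q)).re < ε) →
      ∃ y, Tendsto (fun p => √(c.inner (x p - y) (x p - y)).re) atTop (𝓝 0))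
    (S : V →ₗ⋆[ℂ] V →ₗ[ℂ] ℂ) {K : ℝ}
    (hS : ∀ x y, ‖S x y‖ ≤ K * √(c.inner x x).re * √(c.inner y y).re) :
    ∃ T : V →ₗ[ℂ] V, (∃ M : ℝ, ∀ x, √(c.inner (T x) (T x)).re ≤ M * √(c.inner x x).re) ∧
      ∀ x y, c.inner x (T y) = S x y := by
  let _ : NormedAddCommGroup V := @InnerProductSpace.Core.toNormedAddCommGroup ℂ V _ _ _ c
  let _ : InnerProductSpace ℂ V := InnerProductSpace.ofCore c.toCore
  have hn : ∀ x : V, ‖x‖ = √(c.inner x x).re := fun x => rfl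
  have : CompleteSpace V := by
    refine Metric.complete_of_cauchySeq_tendsto fun x hx => ?_
    obtain ⟨y, hy⟩ := hcomp x fun ε hε => by
      obtain ⟨N, hN⟩ := Metric.cauchySeq_iff.1 hx ε hε
      refine ⟨N, fun p hp q hq => ?_⟩
      rw [← hn, ← dist_eq_norm]
      exact hN p hp q hq
    exact ⟨y, tendsto_iff_norm_sub_tendsto_zero.2 hy⟩
  let B : V →L⋆[ℂ] V →L[ℂ] ℂ := S.mkContinuous₂ K hS
  let T : V →L[ℂ] V := ContinuousLinearMap.adjoint (InnerProductSpace.continuousLinearMapOfBilin B)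
  refine ⟨T, ⟨‖T‖, fun x => T.le_opNorm x⟩, fun x y => ?_⟩
  have : inner ℂ x (T y) = S x y := by
    rw [ContinuousLinearMap.adjoint_inner_right,
      InnerProductSpace.continuousLinearMapOfBilin_apply]
    rfl
  exact this

/-- Multiplication by a bounded continuous function on the ball. -/
theorem exists_mul_map {s : ℝ} {ψ : CSpace d → ℂ} (hψ : ContinuousOn ψ (unitBall d))
    (hb : ∃ M : ℝ, ∀ z ∈ unitBall d, ‖ψ z‖ ≤ M) :
    ∃ Φ : Lp ℂ 2 (mu d s) →L[ℂ] Lp ℂ 2 (mu d s), ∀ (u : Lp ℂ 2 (mu d s)) (g : CSpace d → ℂ),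
      u =ᵐ[mu d s] g → Φ u =ᵐ[mu d s] fun z => ψ z * g z := by
  obtain ⟨M, hM⟩ := hb
  have hm := memLp_top_of_bounded hψ hM s
  refine ⟨(ContinuousLinearMap.mul ℂ ℂ).holderL (mu d s) ⊤ 2 2 (hm.toLp ψ), fun u g hu => ?_⟩
  refine EventuallyEq.trans ((ContinuousLinearMap.mul ℂ ℂ).coeFn_holder (r := 2) (hm.toLp ψ) u) ?_
  filter_upwards [hm.coeFn_toLp, hu] with z h2 h3
  rw [h2, h3]
  rfl

/-- The Toeplitz form is a bounded sesquilinear form on `H(𝔹^d, λ)`. -/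
theorem toeplitzForm_sesquilinear (hd : 1 ≤ d) {lam : ℝ} (hlam : 0 < lam) {m n : ℕ}
    (hm : (d : ℝ) < lam + 2 * m) (hn : (d : ℝ) < lam + 2 * n) {φ : CSpace d → ℂ}
    (hφ : ContDiffOn ℝ ((2 * n : ℕ) : WithTop ℕ∞) φ (unitBall d))
    (hbdd : ∀ k ≤ n, ∀ l ≤ n, ∃ M : ℝ, ∀ z ∈ unitBall d, ‖numOpBar^[k] (numOp^[l] φ) z‖ ≤ M) :
    ∃ (S : sobolev d lam m →ₗ⋆[ℂ] sobolev d lam m →ₗ[ℂ] ℂ) (K : ℝ),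
      (∀ f g, S f g = toeplitzForm d lam n φ f g) ∧
      ∀ f g, ‖S f g‖ ≤ K * sobNorm d lam m f * sobNorm d lam m g := by
  obtain ⟨D, C, hC0, hD, hC⟩ := exists_iterate_maps hd hlam hm hn
  have hΦ : ∀ k l, ∃ Φ : Lp ℂ 2 (mu d (lam + 2 * n)) →L[ℂ] Lp ℂ 2 (mu d (lam + 2 * n)),
      k ≤ n → l ≤ n → ∀ (u : Lp ℂ 2 (mu d (lam + 2 * n))) (g : CSpace d → ℂ),
        u =ᵐ[mu d (lam + 2 * n)] g →
        Φ u =ᵐ[mu d (lam + 2 * n)] fun z => numOpBar^[k] (numOp^[l] φ) z * g z := by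
    intro k l
    by_cases h : k ≤ n ∧ l ≤ n
    · obtain ⟨Φ, hΦ⟩ := exists_mul_map (s := lam + 2 * n) (continuousOn_symbol hφ h.1 h.2)
        (hbdd k h.1 l h.2)
      exact ⟨Φ, fun _ _ => hΦ⟩
    · exact ⟨0, fun h1 h2 => absurd ⟨h1, h2⟩ h⟩
  choose Φ hΦ using hΦ
  set A := mixCoef lam (lam + n) n n with hA
  set R := Finset.range (n + 1) with hR
  -- The form is a finite sum of inner products of bounded linear maps applied to f and g;
  -- sesquilinearity and the bound are read off from this.
  have key : ∀ f g : sobolev d lam m, toeplitzForm d lam n φ f g =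
      ∑ j ∈ R, ∑ k ∈ R, ∑ l ∈ R, ∑ i ∈ R, A j k l i * inner ℂ (D j f) (Φ k l (D i g)) := by
    intro f g
    have hmem : ∀ (f : sobolev d lam m), ∀ j ≤ n,
        MemLp (numOp^[j] (f : CSpace d → ℂ)) 2 (mu d (lam + 2 * n)) := fun f j hj =>
      (memLp_congr_ae (hD j hj f)).1 (Lp.memLp _)
    rw [(toeplitzForm_expansion hφ hbdd f.2.1 g.2.1 hn (hmem f) (hmem g)).2.2]
    refine Finset.sum_congr rfl fun j hj => Finset.sum_congr rfl fun k hk =>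
      Finset.sum_congr rfl fun l hl => Finset.sum_congr rfl fun i hi => ?_
    rw [Finset.mem_range, Nat.lt_succ_iff] at hj hk hl hi
    rw [L2_inner_eq (hD j hj f) (hΦ k l hk hl _ _ (hD i hi g))]
  refine ⟨LinearMap.mk₂'ₛₗ (starRingEnd ℂ) (RingHom.id ℂ)
    (fun f g => toeplitzForm d lam n φ f g) ?_ ?_ ?_ ?_,
    ∑ j ∈ R, ∑ k ∈ R, ∑ l ∈ R, ∑ i ∈ R, ‖A j k l i‖ * (C * ‖Φ k l‖ * C), fun _ _ => rfl, ?_⟩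
  · intro f f' g
    simp only [key, map_add, inner_add_left, mul_add, Finset.sum_add_distrib]
  · intro c f g
    simp only [key, map_smul, inner_smul_left, smul_eq_mul, Finset.mul_sum]
    refine Finset.sum_congr rfl fun _ _ => Finset.sum_congr rfl fun _ _ =>
      Finset.sum_congr rfl fun _ _ => Finset.sum_congr rfl fun _ _ => ?_
    ring
  · intro f g g'
    simp only [key, map_add, inner_add_right, mul_add, Finset.sum_add_distrib]
  · intro c f g
    simp only [key, map_smul, inner_smul_right, smul_eq_mul, Finset.mul_sum, RingHom.id_apply]
    refine Finset.sum_congr rfl fun _ _ => Finset.sum_congr rfl fun _ _ =>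
      Finset.sum_congr rfl fun _ _ => Finset.sum_congr rfl fun _ _ => ?_
    ring
  · intro f g
    change ‖toeplitzForm d lam n φ f g‖ ≤ _
    rw [key]
    simp only [Finset.sum_mul]
    refine norm_sum_le_of_le _ fun j _ => norm_sum_le_of_le _ fun k _ =>
      norm_sum_le_of_le _ fun l _ => norm_sum_le_of_le _ fun i _ => ?_
    rw [norm_mul]
    have h0 : 0 ≤ sobNorm d lam m f := Real.sqrt_nonneg _
    calc ‖A j k l i‖ * ‖inner ℂ (D j f) (Φ k l (D i g))‖
        ≤ ‖A j k l i‖ * (‖D j f‖ * ‖Φ k l (D i g)‖) := by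
          gcongr
          exact norm_inner_le_norm _ _
      _ ≤ ‖A j k l i‖ * ((C * sobNorm d lam m f) * (‖Φ k l‖ * (C * sobNorm d lam m g))) := by
          gcongr
          · exact hC j f
          · exact (Φ k l).le_opNorm_of_le (hC i g)
      _ = _ := by ring

/-- Existence is Riesz representation of a bounded form on a complete space. For uniqueness, the
difference of two solutions at g is paired with itself and definiteness applies; this determines T
among all linear maps. -/
theorem toeplitz_sobolev (hd : 1 ≤ d) {lam : ℝ} (hlam : 0 < lam) {m n : ℕ}
    (hm : (d : ℝ) < lam + 2 * m) (hn : (d : ℝ) < lam + 2 * n) {φ : CSpace d → ℂ}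
    (hφ : ContDiffOn ℝ ((2 * n : ℕ) : WithTop ℕ∞) φ (unitBall d))
    (hbdd : ∀ k ≤ n, ∀ l ≤ n, ∃ M : ℝ, ∀ z ∈ unitBall d, ‖numOpBar^[k] (numOp^[l] φ) z‖ ≤ M) :
    ∃! T : sobolev d lam m →ₗ[ℂ] sobolev d lam m,
      (∃ M : ℝ, ∀ f : sobolev d lam m, sobNorm d lam m (T f) ≤ M * sobNorm d lam m f) ∧
      ∀ f g : sobolev d lam m, sobInner d lam m f (T g) = toeplitzForm d lam n φ f g := by
  obtain ⟨S, K, hS, hK⟩ := toeplitzForm_sesquilinear hd hlam hm hn hφ hbdd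
  obtain ⟨T, hT, hTS⟩ := exists_operator_of_form (sobCore hd hlam hm)
    (sobolev_complete hd hlam hm) S hK
  refine ⟨T, ⟨hT, fun f g => (hTS f g).trans (hS f g)⟩, ?_⟩
  rintro T' ⟨-, hT'⟩
  refine LinearMap.ext fun g => sub_eq_zero.1 (sobolev_eq_zero hd hlam hm ?_)
  have hlm : 0 < lam + m := by positivity
  have e : ∀ f : sobolev d lam m, sobInner d lam m f (T' g) = sobInner d lam m f (T g) := fun f =>
    (hT' f g).trans ((hTS f g).trans (hS f g)).symm
  have e' := e (T' g - T g)
  rw [sobInner_eq_inner hlam hlm, sobInner_eq_inner hlam hlm] at e'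
  rw [sobInner_eq_inner hlam hlm, map_sub (sobShift d lam m hlam), inner_sub_right, e', sub_self,
    Complex.zero_re]

theorem integrable_opC_sobolev (hd : 1 ≤ d) {lam : ℝ} (hlam : 0 < lam) {m n : ℕ}
    (hm : (d : ℝ) < lam + 2 * m) (hn : (d : ℝ) < lam + 2 * n) {φ : CSpace d → ℂ}
    (hφ : ContDiffOn ℝ ((2 * n : ℕ) : WithTop ℕ∞) φ (unitBall d))
    (hbdd : ∀ k ≤ n, ∀ l ≤ n, ∃ M : ℝ, ∀ z ∈ unitBall d, ‖numOpBar^[k] (numOp^[l] φ) z‖ ≤ M)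
    (f g : sobolev d lam m) :
    Integrable (fun z => opC lam n
      (fun w => starRingEnd ℂ ((f : CSpace d → ℂ) w) * φ w * (g : CSpace d → ℂ) w) z *
        (((1 - ‖z‖ ^ 2) ^ (lam + 2 * n) : ℝ) : ℂ)) (tau d) := by
  obtain ⟨D, _, _, hD, _⟩ := exists_iterate_maps hd hlam hm hn
  have hmem : ∀ (f : sobolev d lam m), ∀ j ≤ n,
      MemLp (numOp^[j] (f : CSpace d → ℂ)) 2 (mu d (lam + 2 * n)) := fun f j hj =>
    (memLp_congr_ae (hD j hj f)).1 (Lp.memLp _)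
  exact (toeplitzForm_expansion hφ hbdd f.2.1 g.2.1 hn (hmem f) (hmem g)).1

end
end GenBergman

theorem mainTheorem5 (n : ℕ) (hn : 1 ≤ n) (lam : ℝ) (hlam : 0 < lam) :
    ∃ A : ℕ → ℕ → ℕ → ℕ → ℂ,
      ∀ (d : ℕ) (_hd : 1 ≤ d) (φ : CSpace d → ℂ)
        (_hφ : ContDiffOn ℝ ((2 * n : ℕ) : WithTop ℕ∞) φ (unitBall d))
        (_hbdd : ∀ k ≤ n, ∀ l ≤ n, ∃ M : ℝ, ∀ z ∈ unitBall d,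
          ‖numOpBar^[k] (numOp^[l] φ) z‖ ≤ M),
        -- the case `λ > d`: multiply and project
        ((d : ℝ) < lam →
          ∃ hφ' : MemLp φ ⊤ (mu d lam),
            ∀ (u v : bergman d lam) (f g : CSpace d → ℂ),
              DifferentiableOn ℂ f (unitBall d) → DifferentiableOn ℂ g (unitBall d) →
              (u : Lp ℂ 2 (mu d lam)) =ᵐ[mu d lam] f →
              (v : Lp ℂ 2 (mu d lam)) =ᵐ[mu d lam] g →
              Integrable (fun z => opC lam n (fun w => starRingEnd ℂ (f w) * φ w * g w) z *
                (((1 - ‖z‖ ^ 2) ^ (lam + 2 * n) : ℝ) : ℂ)) (tau d) ∧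
              inner ℂ u (toeplitz d lam (hφ'.toLp φ) v) = toeplitzForm d lam n φ f g ∧
              (∀ j ≤ n, MemLp (numOp^[j] f) 2 (mu d (lam + 2 * n))) ∧
              (∀ k ≤ n, ∀ l ≤ n, ∀ m ≤ n,
                MemLp (fun z => numOpBar^[k] (numOp^[l] φ) z * numOp^[m] g z) 2
                  (mu d (lam + 2 * n))) ∧
              inner ℂ u (toeplitz d lam (hφ'.toLp φ) v) =
                ∑ j ∈ Finset.range (n + 1), ∑ k ∈ Finset.range (n + 1),
                  ∑ l ∈ Finset.range (n + 1), ∑ m ∈ Finset.range (n + 1),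
                    A j k l m * ∫ z, starRingEnd ℂ (numOp^[j] f z) *
                      (numOpBar^[k] (numOp^[l] φ) z * numOp^[m] g z) ∂(mu d (lam + 2 * n))) ∧
        -- the case `0 < λ ≤ d`: the same form defines a bounded operator on `H(𝔹^d, λ)`
        (lam ≤ d → (d : ℝ) < lam + 2 * n → ∀ m : ℕ, (d : ℝ) < lam + 2 * m →
          (∀ f g : sobolev d lam m,
            Integrable (fun z => opC lam n
              (fun w => starRingEnd ℂ ((f : CSpace d → ℂ) w) * φ w * (g : CSpace d → ℂ) w) z *
                (((1 - ‖z‖ ^ 2) ^ (lam + 2 * n) : ℝ) : ℂ)) (tau d)) ∧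
          ∃! T : sobolev d lam m →ₗ[ℂ] sobolev d lam m,
            (∃ M : ℝ, ∀ f : sobolev d lam m, sobNorm d lam m (T f) ≤ M * sobNorm d lam m f) ∧
            ∀ f g : sobolev d lam m,
              sobInner d lam m f (T g) = toeplitzForm d lam n φ f g) := by
  -- The Leibniz coefficients for s = t = n, with shifts starting at λ for N and at λ + n for N̄;
  -- neither d nor φ enters.
  refine ⟨mixCoef lam (lam + n) n n, fun d hd φ hφ hbdd => ⟨fun hlam' =>
    toeplitz_bergman hd hlam' hφ hbdd, fun _ hln m hlm => ⟨fun f g =>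
    integrable_opC_sobolev hd hlam hlm hln hφ hbdd f g,
    toeplitz_sobolev hd hlam hlm hln hφ hbdd⟩⟩⟩
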